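/- Let $d=n_0+n_1+\dots+n_\kappa$ and split $z\in\mathbb R^d$ into blocks of sizes $n_\kappa,\dots,n_1,n_0$; a hat denotes the part of a vector (or of $\nabla$) in the last block, of size $n_0$. Let $W:\mathbb R^d\to\mathbb R$ be differentiable with $W(z)\to\infty$ as $|z|\to\infty$ and $W(z)\ge c_1|z|^q-c_2$ for some $q>1$, $c_1,c_2>0$. Let $\widehat{\mathbf A}(z)$ be a bounded, Hölder continuous, uniformly elliptic (not necessarily symmetric) $n_0\times n_0$ matrix field, let $b(z)=(0,\widehat b(z))$ with $\widehat b:\mathbb R^d\to\mathbb R^{n_0}$ continuous, and let $\mathbf B$ be the constant matrix that maps the block $j-1$ of $z$ into the block $j$ by a matrix $\mathbf B_j\in\mathbb R^{n_j\times n_{j-1}}$ of rank $n_j$, $1\le j\le\kappa$, and whose other blocks vanish. Fix $\varepsilon>0$, put $Z_\varepsilon=\int e^{-W/\varepsilon}dz$, $\rho_\varepsilon(dz)=Z_\varepsilon^{-1}e^{-W/\varepsilon}dz$, and assume that $\nabla\cdot\big((b+\mathbf Bz)e^{-W/\varepsilon}\big)=0$ in $\mathbb R^d$ (weakly) and that $b\in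 L^2(\rho_\varepsilon)$. Consider $$\mathscr L_\varepsilon f=\varepsilon e^{W/\varepsilon}\widehat\nabla\cdot\big[e^{-W/\varepsilon}\widehat{\mathbf A}\widehat\nabla f\big]+(b+\mathbf Bz)\cdot\nabla f$$ and its adjoint $\mathscr L_\varepsilon^\dagger$ with respect to $\rho_\varepsilon$, obtained by replacing $(\widehat{\mathbf A},b,\mathbf B)$ by $(\widehat{\mathbf A}^{T},-b,-\mathbf B)$. Let $\mathcal A,\mathcal B\subset\mathbb R^d$ be bounded open sets with $C^{2,\alpha}$ boundaries, $0<\alpha<1$, at positive distance from each other, let $\Omega=(\overline{\mathcal A\cup\mathcal B})^c$, let $n_\Omega$ be its unit outward normal and $\sigma$ the surface measure. Let $$\Gamma=\{z\in\partial\Omega:\ \widehat n_\Omega(z)\ne0\ \text{or}\ \mathbf Bz\cdot n_\Omega(z)>0\},\qquad \Gamma^\dagger=\{z\in\partial\Omega:\ \widehat n_\Omega(z)\ne0\ \text{or}\ \mathbf Bz\cdot n_\Omega(z)<0\}$$ be the regular parts of $\partial\Omega$ for the two operators. Let $h_\varepsilon\in C(\overline\Omega)\cap C^1(\Omega)$ be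 a weak solution of $\mathscr L_\varepsilon h_\varepsilon=0$ in $\Omega$, that is, $h_\varepsilon,\widehat\nabla h_\varepsilon\in L^2(\Omega,\rho_\varepsilon)$ and $$\int_\Omega\big(\varepsilon\widehat{\mathbf A}\widehat\nabla h_\varepsilon\cdot\widehat\nabla\varphi+h_\varepsilon(b+\mathbf Bz)\cdot\nabla\varphi\big)\rho_\varepsilon(dz)=0\qquad\text{for all }\varphi\in C^1_c(\Omega),$$ with $h_\varepsilon=1$ on $\Gamma\cap\partial\mathcal A$ and $h_\varepsilon=0$ on $\Gamma\cap\partial\mathcal B$. Assume that the $\widehat{\mathbf A}$-normal derivative $$\widehat{\mathbf A}\widehat\nabla h_\varepsilon\cdot\widehat n_\Omega\,(z_0):=\lim_{\delta\downarrow0}\,(\widehat{\mathbf A}\widehat\nabla h_\varepsilon)(z_0-\delta n_\Omega(z_0))\cdot\widehat n_\Omega(z_0)$$ exists at every $z_0\in\partial\Omega$, the quantities under the limit being bounded uniformly in $z_0\in\partial\Omega$ and in all sufficiently small $\delta>0$. Let $h_\varepsilon^\dagger$ have the same properties with respect to $\mathscr L_\varepsilon^\dagger$, $\widehat{\mathbf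 A}^T$ and $\Gamma^\dagger$. Then the integrands below are $\sigma$-integrable on $\partial\mathcal A$, and with $$\mathrm{cap}_\varepsilon(\mathcal A,\mathcal B)=\frac1{Z_\varepsilon}\int_{\partial\mathcal A}\Big(\varepsilon\,\widehat{\mathbf A}\widehat\nabla h_\varepsilon\cdot\widehat n_\Omega+(h_\varepsilon-1)(b+\mathbf Bz)\cdot n_\Omega\Big)e^{-W/\varepsilon}\,\sigma(dz),$$ $$\mathrm{cap}^\dagger_\varepsilon(\mathcal A,\mathcal B)=\frac1{Z_\varepsilon}\int_{\partial\mathcal A}\Big(\varepsilon\,\widehat{\mathbf A}^T\widehat\nabla h^\dagger_\varepsilon\cdot\widehat n_\Omega+(1-h^\dagger_\varepsilon)(b+\mathbf Bz)\cdot n_\Omega\Big)e^{-W/\varepsilon}\,\sigma(dz)$$ one has $\mathrm{cap}_\varepsilon(\mathcal A,\mathcal B)=\mathrm{cap}^\dagger_\varepsilon(\mathcal A,\mathcal B)$. -/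

import Mathlib

open MeasureTheory Filter Topology Set
open scoped Gradient Matrix

noncomputable section

namespace FokkerPlanck

/-- The space `ℝ^d`, `d = n₀ + n₁ + ⋯ + n_κ`, with its Euclidean norm and with its coordinates
grouped into blocks of sizes `n₀, …, n_κ`. Block `0` is the block of the diffusive coordinates
(those carrying a hat). -/
abbrev Space {κ : ℕ} (n : Fin (κ + 1) → ℕ) : Type :=
  EuclideanSpace ℝ (Σ j : Fin (κ + 1), Fin (n j))

/-- The block of size `n₀` of a vector, e.g. `hat (∇ f z)` and `hat ν` for a normal vector `ν`. -/
def hat {κ : ℕ} {n : Fin (κ + 1) → ℕ} (v : Space n) : EuclideanSpace ℝ (Fin (n 0)) :=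
  WithLp.toLp 2 fun i => v ⟨0, i⟩

/-- The coefficients of `L_ε f = ε e^{W/ε} ∇·[e^{-W/ε} A ∇f] + (b + B z)·∇f`:
`Ahat` is the only non-zero block of `A`, `bhat` the only non-zero block of `b`, and
`Bblock j` is the `n_{j+1} × n_j` block of the constant matrix `B` that sends the block `j` of `z`
to the block `j + 1`; all the other blocks of `B` vanish. -/
structure Coefficients (κ : ℕ) (n : Fin (κ + 1) → ℕ) where
  Ahat : Space n → Matrix (Fin (n 0)) (Fin (n 0)) ℝ
  bhat : Space n → EuclideanSpace ℝ (Fin (n 0))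
  Bblock : (j : Fin κ) → Matrix (Fin (n j.succ)) (Fin (n j.castSucc)) ℝ
  W : Space n → ℝ

namespace Coefficients

variable {κ : ℕ} {n : Fin (κ + 1) → ℕ}

/-- The vector `B z`. -/
def Bmul (c : Coefficients κ n) (z : Space n) : Space n :=
  WithLp.toLp 2 fun p =>
    Fin.cases (motive := fun j => Fin (n j) → ℝ) (fun _ => 0)
      (fun j => c.Bblock j *ᵥ fun k => z ⟨j.castSucc, k⟩) p.1 p.2

/-- The vector `b(z)`, with all the blocks but the block `0` equal to zero. -/
def b (c : Coefficients κ n) (z : Space n) : Space n :=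
  WithLp.toLp 2 fun p =>
    Fin.cases (motive := fun j => Fin (n j) → ℝ) (fun i => c.bhat z i) (fun _ _ => 0) p.1 p.2

/-- The drift `b(z) + B z`. -/
def drift (c : Coefficients κ n) (z : Space n) : Space n := c.b z + c.Bmul z

/-- The vector `Â(z) u`. -/
def Amul (c : Coefficients κ n) (z : Space n) (u : EuclideanSpace ℝ (Fin (n 0))) :
    EuclideanSpace ℝ (Fin (n 0)) :=
  WithLp.toLp 2 (c.Ahat z *ᵥ fun i => u i)

/-- The coefficients of the adjoint operator
`L_ε† f = ε e^{W/ε} ∇·[e^{-W/ε} Aᵀ ∇f] - (b + B z)·∇f`. -/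
def adjoint (c : Coefficients κ n) : Coefficients κ n where
  Ahat z := (c.Ahat z)ᵀ
  bhat z := - c.bhat z
  Bblock j := - c.Bblock j
  W := c.W

/-- Structural assumptions on the coefficients. -/
structure Admissible (c : Coefficients κ n) : Prop where
  A_bounded : ∃ M : ℝ, ∀ z i j, |c.Ahat z i j| ≤ M
  A_holder : ∃ α : ℝ, 0 < α ∧ α < 1 ∧ ∃ M : ℝ, ∀ z z' i j,
    |c.Ahat z i j - c.Ahat z' i j| ≤ M * ‖z - z'‖ ^ α
  A_elliptic : ∃ l : ℝ, 0 < l ∧ ∀ z (ξ : EuclideanSpace ℝ (Fin (n 0))),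
    l * ‖ξ‖ ^ 2 ≤ inner ℝ ξ (c.Amul z ξ)
  b_continuous : Continuous c.bhat
  B_rank : ∀ j, (c.Bblock j).rank = n j.succ
  W_differentiable : Differentiable ℝ c.W
  W_confining : Tendsto c.W (cocompact (Space n)) atTop
  W_growth : ∃ q c₁ c₂ : ℝ, 1 < q ∧ 0 < c₁ ∧ 0 < c₂ ∧ ∀ z, c₁ * ‖z‖ ^ q - c₂ ≤ c.W z

/-- The normalization `Z_ε = ∫ e^{-W/ε} dz`. -/
def Z (c : Coefficients κ n) (ε : ℝ) : ℝ := ∫ z, Real.exp (-(c.W z) / ε)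

/-- The measure `ρ_ε(dz) = Z_ε⁻¹ e^{-W/ε} dz`. -/
def rho (c : Coefficients κ n) (ε : ℝ) : Measure (Space n) :=
  volume.withDensity fun z => ENNReal.ofReal (Real.exp (-(c.W z) / ε) / c.Z ε)

/-- `∇·((b + B z) e^{-W/ε}) = 0` on `ℝ^d`, in the weak sense (`b` is only continuous). -/
def WeightedDivFree (c : Coefficients κ n) (ε : ℝ) : Prop :=
  ∀ φ : Space n → ℝ, ContDiff ℝ 1 φ → HasCompactSupport φ →
    ∫ z, inner ℝ (c.drift z) (∇ φ z) ∂(c.rho ε) = 0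

/-- A function `u`, continuously differentiable in the open set `D`, is a weak solution of
`L_ε u = 0` in `D`: `u` and the hat-part of `∇u` lie in `L²(D, ρ_ε)`, and the equation holds
against all `C¹` functions with compact support in `D`. -/
structure IsWeakSolution (c : Coefficients κ n) (ε : ℝ) (D : Set (Space n)) (u : Space n → ℝ) :
    Prop where
  contDiffOn : ContDiffOn ℝ 1 u D
  memLp : MemLp u 2 ((c.rho ε).restrict D)
  memLp_grad : MemLp (fun z => hat (∇ u z)) 2 ((c.rho ε).restrict D)
  eqn : ∀ φ : Space n → ℝ, ContDiff ℝ 1 φ → HasCompactSupport φ → tsupport φ ⊆ D →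
    ∫ z in D, (ε * inner ℝ (c.Amul z (hat (∇ u z))) (hat (∇ φ z))
      + u z * inner ℝ (c.drift z) (∇ φ z)) ∂(c.rho ε) = 0

end Coefficients

variable {κ : ℕ} {n : Fin (κ + 1) → ℕ}

/-- The set `D` has a `C^{2,α}` boundary: near each boundary point it is the sublevel set of a
`C^{2,α}` function whose gradient does not vanish there. -/
def HasC2HolderBoundary (α : ℝ) (D : Set (Space n)) : Prop :=
  ∀ z₀ ∈ frontier D, ∃ U : Set (Space n), IsOpen U ∧ z₀ ∈ U ∧ ∃ ψ : Space n → ℝ,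
    ContDiffOn ℝ 2 ψ U ∧
    (∃ M : ℝ, ∀ x ∈ U, ∀ y ∈ U,
      ‖iteratedFDeriv ℝ 2 ψ x - iteratedFDeriv ℝ 2 ψ y‖ ≤ M * ‖x - y‖ ^ α) ∧
    ∇ ψ z₀ ≠ 0 ∧ ∀ z ∈ U, z ∈ D ↔ ψ z < 0

/-- `ν` is the unit outward normal to `D` at the boundary point `z`. -/
def IsOutwardNormal (D : Set (Space n)) (z ν : Space n) : Prop :=
  z ∈ frontier D ∧ ‖ν‖ = 1 ∧ ∃ U : Set (Space n), IsOpen U ∧ z ∈ U ∧ ∃ ψ : Space n → ℝ,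
    ContDiffOn ℝ 1 ψ U ∧ (∀ y ∈ U, y ∈ D ↔ ψ y < 0) ∧ ∃ t : ℝ, 0 < t ∧ ∇ ψ z = t • ν

open Classical in
/-- The unit outward normal `n_D(z)` (and `0` where there is none). -/
def outwardNormal (D : Set (Space n)) (z : Space n) : Space n :=
  if h : ∃ ν, IsOutwardNormal D z ν then h.choose else 0

/-- The surface measure: the `(d-1)`-dimensional Hausdorff measure, normalized so that it agrees
with Lebesgue measure on hyperplanes. -/
def surfaceMeasure (n : Fin (κ + 1) → ℕ) : Measure (Space n) := μHE[(∑ j, n j) - 1]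

/-- Assumptions on the two sets. -/
structure AdmissiblePair (A B : Set (Space n)) : Prop where
  isOpen_left : IsOpen A
  isOpen_right : IsOpen B
  bounded_left : Bornology.IsBounded A
  bounded_right : Bornology.IsBounded B
  boundary : ∃ α : ℝ, 0 < α ∧ α < 1 ∧ HasC2HolderBoundary α A ∧ HasC2HolderBoundary α B
  separated : ∃ r : ℝ, 0 < r ∧ ∀ x ∈ A, ∀ y ∈ B, r ≤ dist x y

/-- The domain `Ω`, the complement of the closure of `A ∪ B`. -/
def outerDomain (A B : Set (Space n)) : Set (Space n) := (closure (A ∪ B))ᶜ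

namespace Coefficients

/-- The regular part `Γ(D)` of the boundary, in the sense of Fichera: the points that are
non-characteristic for the diffusion, and the characteristic ones at which the drift points
strictly out of `D` (at a characteristic point the drift has normal component `B z · n_D`).
For `c.adjoint` this is the regular part for the adjoint problem. -/
def regularBoundary (c : Coefficients κ n) (D : Set (Space n)) : Set (Space n) :=
  {z ∈ frontier D | hat (outwardNormal D z) ≠ 0 ∨ 0 < inner ℝ (c.Bmul z) (outwardNormal D z)}

/-- The quantity `Â ∇̂f · n̂_D(z₀)`, with `Â ∇̂f` taken at the distance `δ` from the boundary
point `z₀` along the inner normal. -/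
def conormalQuotient (c : Coefficients κ n) (D : Set (Space n)) (f : Space n → ℝ)
    (z₀ : Space n) (δ : ℝ) : ℝ :=
  inner ℝ (c.Amul (z₀ - δ • outwardNormal D z₀) (hat (∇ f (z₀ - δ • outwardNormal D z₀))))
    (hat (outwardNormal D z₀))

/-- The `Â`-normal derivative of `f` at a boundary point `z₀` of `D`. -/
def conormalDeriv (c : Coefficients κ n) (D : Set (Space n)) (f : Space n → ℝ)
    (z₀ : Space n) : ℝ :=
  limUnder (𝓝[>] (0 : ℝ)) (c.conormalQuotient D f z₀)

/-- The `Â`-normal derivative of `f` exists on the boundary of `D` and is uniformly bounded. -/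
def HasBoundedConormalDeriv (c : Coefficients κ n) (D : Set (Space n)) (f : Space n → ℝ) : Prop :=
  (∀ z ∈ frontier D, ∃ l : ℝ, Tendsto (c.conormalQuotient D f z) (𝓝[>] (0 : ℝ)) (𝓝 l)) ∧
  ∃ M δ₀ : ℝ, 0 < δ₀ ∧ ∀ z ∈ frontier D, ∀ δ : ℝ, 0 < δ → δ < δ₀ →
    |c.conormalQuotient D f z δ| ≤ M

/-- `h` is an equilibrium potential of the pair `A, B` for the operator with coefficients `c`. -/
structure IsEquilibriumPotential (c : Coefficients κ n) (ε : ℝ) (A B : Set (Space n))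
    (h : Space n → ℝ) : Prop where
  continuousOn : ContinuousOn h (closure (outerDomain A B))
  weakSolution : c.IsWeakSolution ε (outerDomain A B) h
  eq_one : ∀ z ∈ c.regularBoundary (outerDomain A B) ∩ frontier A, h z = 1
  eq_zero : ∀ z ∈ c.regularBoundary (outerDomain A B) ∩ frontier B, h z = 0
  conormal : c.HasBoundedConormalDeriv (outerDomain A B) h

/-- The density of the capacity with respect to the surface measure, without the factor `1/Z_ε`. -/
def capIntegrand (c : Coefficients κ n) (ε : ℝ) (A B : Set (Space n)) (h : Space n → ℝ)
    (z : Space n) : ℝ :=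
  (ε * c.conormalDeriv (outerDomain A B) h z
    + (h z - 1) * inner ℝ (c.drift z) (outwardNormal (outerDomain A B) z))
    * Real.exp (-(c.W z) / ε)

/-- The capacity `cap_ε(A, B)` computed from the equilibrium potential `h`. The adjoint capacity
is the same expression for the coefficients `c.adjoint` and the adjoint equilibrium potential. -/
def cap (c : Coefficients κ n) (ε : ℝ) (A B : Set (Space n)) (h : Space n → ℝ) : ℝ :=
  (1 / c.Z ε) * ∫ z in frontier A, c.capIntegrand ε A B h z ∂(surfaceMeasure n)

end Coefficients

end FokkerPlanck

end

/-! Write w for the adjoint potential, ρ for the density of `rho` and d for the drift b + Bz.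
Testing the equation of h with φw, that of w with φh, and using that ρd is divergence free shows,
formally, that Y = ρ(ε w Â∇̂h − ε h Âᵀ∇̂w + h w d) has zero divergence in Ω: the two quadratic terms
cancel because Âᵀ∇̂w·∇̂h = Â∇̂h·∇̂w. So the flux of Y through ∂Ω is zero
(`integral_frontier_eq_zero`).

Let e be the boundary value, 1 on ∂A and 0 on ∂B. Where n̂ ≠ 0 both potentials equal e. Where n̂ = 0
both conormal derivatives vanish and d·n = Bz·n; the sign of this number decides which of h, w
equals e, and if it is zero nothing is needed. Hence (h−e)(w−e) d·n = 0 on all of ∂Ω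
(`boundary_terms_eq_zero`). On ∂B the flux density is therefore zero. On ∂A one may replace hw by
(h−1) − (1−w) + 1, and the density becomes the difference of the two capacity densities plus ρ d·n.
The last term integrates to zero over ∂A, since ρd is divergence free on the whole space
(`integral_drift_frontier_eq_zero`). This gives the equality of the capacities
(`cap_eq_cap_adjoint`).

Three points need care. The gradients are not known to extend to ∂Ω; only bounded limits along
normals exist. `green_formula` is a Gauss–Green formula for such fields. It is obtained from collar
charts (`exists_collarChart`), boundary-layer test functions, and measure comparisons with error
factors 1+η in place of Jacobians; a partition of unity makes the estimate global and η → 0 makes it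
exact.

The domain is unbounded and d grows. `setIntegral_eq_of_hasWeakDiv` uses cut-offs with gradients of
order 1/(1+‖z‖), which suffices because ρX/(1+‖z‖) is integrable for the fields X in question.

The potentials are only in L², so h w d need not be integrable. They are replaced by T(h), T(w) with
a truncation T at height k. The divergence is then no longer zero, but it is bounded by a multiple
of the energy densities, uniformly in k, and it tends to 0 pointwise (`hasWeakDiv_truncated`,
`exists_isTruncation`). On the compact boundary h and w are bounded, so a high truncation is
invisible there. -/

noncomputable section

namespace FokkerPlanck

/-! ### Comparison of measures and integrals under nearly isometric maps. -/

section MeasureComparison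

/-- Together with the reverse bound below, this replaces the change-of-variables formula: a map that
is bi-Lipschitz with constants near 1 distorts volume and surface measure by a factor near 1. -/
theorem euclideanHausdorffMeasure_image_le {X Y : Type*} [EMetricSpace X] [MeasurableSpace X]
    [BorelSpace X] [EMetricSpace Y] [MeasurableSpace Y] [BorelSpace Y] {f : X → Y} {s : Set X}
    {K : NNReal} (hf : LipschitzOnWith K f s) (d : ℕ) :
    (μHE[d] : Measure Y) (f '' s) ≤ (K : ENNReal) ^ d * (μHE[d] : Measure X) s := by
  simp only [Measure.euclideanHausdorffMeasure_def, Measure.smul_apply, ENNReal.smul_def,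
    smul_eq_mul]
  have h := hf.hausdorffMeasure_image_le (d := (d : ℝ)) (Nat.cast_nonneg d)
  rw [ENNReal.rpow_natCast] at h
  rw [mul_left_comm]
  gcongr

theorem euclideanHausdorffMeasure_le_image {X Y : Type*} [EMetricSpace X] [MeasurableSpace X]
    [BorelSpace X] [EMetricSpace Y] [MeasurableSpace Y] [BorelSpace Y] {f : X → Y} {s : Set X}
    {K : NNReal} (hf : ∀ x ∈ s, ∀ y ∈ s, edist x y ≤ K * edist (f x) (f y)) (d : ℕ) :
    (μHE[d] : Measure X) s ≤ (K : ENNReal) ^ d * (μHE[d] : Measure Y) (f '' s) := by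
  rcases s.eq_empty_or_nonempty with rfl | ⟨x₀, -⟩
  · simp
  have : Nonempty X := ⟨x₀⟩
  have hinj : InjOn f s := by
    intro x hx y hy hxy
    have := hf x hx y hy
    simpa [hxy] using this
  have hL : LipschitzOnWith K (Function.invFunOn f s) (f '' s) := by
    rintro _ ⟨x, hx, rfl⟩ _ ⟨y, hy, rfl⟩
    rw [hinj.leftInvOn_invFunOn hx, hinj.leftInvOn_invFunOn hy]
    exact hf x hx y hy
  have h := euclideanHausdorffMeasure_image_le hL d
  rwa [hinj.invFunOn_image Subset.rfl] at h

theorem abs_integral_sub_integral_le {X : Type*} [MeasurableSpace X] {α β : Measure X} {η : ℝ}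
    (hη : 0 ≤ η) (hη1 : η ≤ 1) (hαβ : α ≤ ENNReal.ofReal (1 + η) • β)
    (hβα : β ≤ ENNReal.ofReal (1 + η) • α) {F : X → ℝ} (hF : Integrable F β) :
    |∫ x, F x ∂α - ∫ x, F x ∂β| ≤ 2 * η * ∫ x, |F x| ∂β := by
  have hintg : ∀ G : X → ℝ, Integrable G β → Integrable G α := fun G hG =>
    (hG.smul_measure ENNReal.ofReal_ne_top).mono_measure hαβ
  have key : ∀ G : X → ℝ, Integrable G β → (∀ x, 0 ≤ G x) →
      |∫ x, G x ∂α - ∫ x, G x ∂β| ≤ 2 * η * ∫ x, G x ∂β := by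
    intro G hG h0
    have h1 : ∫ x, G x ∂α ≤ (1 + η) * ∫ x, G x ∂β := by
      have := integral_mono_measure hαβ (ae_of_all _ h0)
        (hG.smul_measure ENNReal.ofReal_ne_top)
      rwa [integral_smul_measure, ENNReal.toReal_ofReal (by linarith), smul_eq_mul] at this
    have h2 : ∫ x, G x ∂β ≤ (1 + η) * ∫ x, G x ∂α := by
      have := integral_mono_measure hβα (ae_of_all _ h0)
        ((hintg G hG).smul_measure ENNReal.ofReal_ne_top)
      rwa [integral_smul_measure, ENNReal.toReal_ofReal (by linarith), smul_eq_mul] at this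
    have h3 : 0 ≤ ∫ x, G x ∂β := integral_nonneg h0
    have h4 : 0 ≤ ∫ x, G x ∂α := integral_nonneg h0
    rw [abs_le]
    constructor
    -- The factor 2 comes from this side: ∫G∂β − ∫G∂α ≤ η∫G∂α ≤ η(1+η)∫G∂β, and 1+η ≤ 2.
    · nlinarith [mul_le_mul_of_nonneg_left h1 hη, mul_nonneg (mul_nonneg hη (sub_nonneg.2 hη1)) h3]
    · nlinarith [mul_nonneg hη h3]
  have hp := key (fun x => max (F x) 0) hF.pos_part (fun x => le_max_right _ _)
  have hn := key (fun x => max (-F x) 0) hF.neg_part (fun x => le_max_right _ _)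
  have e1 : ∀ μ : Measure X, Integrable F μ →
      ∫ x, F x ∂μ = ∫ x, max (F x) 0 ∂μ - ∫ x, max (-F x) 0 ∂μ := by
    intro μ hμ
    rw [← integral_sub hμ.pos_part hμ.neg_part]
    refine integral_congr_ae (ae_of_all _ fun x => ?_)
    rcases le_total 0 (F x) with h | h <;> simp [h]
  have e2 : ∫ x, |F x| ∂β = ∫ x, max (F x) 0 ∂β + ∫ x, max (-F x) 0 ∂β := by
    rw [← integral_add hF.pos_part hF.neg_part]
    refine integral_congr_ae (ae_of_all _ fun x => ?_)
    rcases le_total 0 (F x) with h | h <;> simp [h, abs_of_nonneg, abs_of_nonpos]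
  rw [e1 α (hintg F hF), e1 β hF, e2]
  rw [abs_le] at hp hn ⊢
  constructor <;> linarith [hp.1, hp.2, hn.1, hn.2]

end MeasureComparison

/-! ### Normal coordinates along a level set of a C² function. -/

section NormalCoordinates

variable {E : Type*} [NormedAddCommGroup E] [InnerProductSpace ℝ E] [CompleteSpace E]

/-- The normalized gradient of `ψ`. -/
def unitGrad (ψ : E → ℝ) (x : E) : E := ‖∇ ψ x‖⁻¹ • ∇ ψ x

theorem norm_unitGrad {ψ : E → ℝ} {x : E} (h : ∇ ψ x ≠ 0) : ‖unitGrad ψ x‖ = 1 := by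
  rw [unitGrad, norm_smul, norm_inv, norm_norm, inv_mul_cancel₀ (norm_ne_zero_iff.2 h)]

theorem norm_smul_unitGrad {ψ : E → ℝ} {x : E} (h : ∇ ψ x ≠ 0) :
    ‖∇ ψ x‖ • unitGrad ψ x = ∇ ψ x := by
  rw [unitGrad, smul_smul, mul_inv_cancel₀ (norm_ne_zero_iff.2 h), one_smul]

theorem contDiffAt_gradient {ψ : E → ℝ} {x : E} {m k : WithTop ℕ∞} (h : ContDiffAt ℝ k ψ x)
    (hmk : m + 1 ≤ k) : ContDiffAt ℝ m (∇ ψ) x :=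
  ((InnerProductSpace.toDual ℝ E).symm.contDiff.contDiffAt).comp x (h.fderiv_right hmk)

theorem contDiffAt_unitGrad {ψ : E → ℝ} {x : E} (h : ContDiffAt ℝ 2 ψ x) (h0 : ∇ ψ x ≠ 0) :
    ContDiffAt ℝ 1 (unitGrad ψ) x := by
  have hg : ContDiffAt ℝ 1 (∇ ψ) x := contDiffAt_gradient h (by norm_num)
  exact ((hg.norm ℝ h0).inv (norm_ne_zero_iff.2 h0)).smul hg

/-- Straightening of the level sets of `ψ` by a map with derivative the identity. -/
theorem exists_straightening {ψ : E → ℝ} {z₀ : E} (hψ : ContDiffAt ℝ 2 ψ z₀) (h0 : ∇ ψ z₀ ≠ 0)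
    (hz : ψ z₀ = 0) :
    ∃ H : E → E, ContDiffAt ℝ 1 H 0 ∧ H 0 = z₀ ∧
      HasFDerivAt H (ContinuousLinearMap.id ℝ E) 0 ∧
      ∀ᶠ w in 𝓝 (0 : E), ψ (H w) = ‖∇ ψ z₀‖ * inner ℝ (unitGrad ψ z₀) w := by
  set e := unitGrad ψ z₀ with he
  have hn : ‖∇ ψ z₀‖ ≠ 0 := norm_ne_zero_iff.2 h0
  have hee : inner ℝ e e = 1 := by rw [real_inner_self_eq_norm_sq, norm_unitGrad h0]; norm_num
  -- The component of x − z₀ along e is exchanged for ψ(x)/‖∇ψ(z₀)‖. The two agree to first order,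
  -- so the derivative at z₀ is the identity and the local inverse straightens the level sets.
  let Θ : E → E := fun x => (x - z₀) + (‖∇ ψ z₀‖⁻¹ * ψ x - inner ℝ e (x - z₀)) • e
  have hΘ0 : Θ z₀ = 0 := by simp [Θ, hz]
  have hψd : HasFDerivAt ψ (innerSL ℝ (∇ ψ z₀)) z₀ :=
    (hψ.differentiableAt (by norm_num)).hasGradientAt.hasFDerivAt
  have hsub : HasFDerivAt (fun x : E => x - z₀) (ContinuousLinearMap.id ℝ E) z₀ :=
    (hasFDerivAt_id z₀).sub_const z₀
  have hΘd : HasFDerivAt Θ ((ContinuousLinearEquiv.refl ℝ E : E ≃L[ℝ] E) : E →L[ℝ] E) z₀ := by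
    have h1 := hsub.add (((hψd.const_mul ‖∇ ψ z₀‖⁻¹).sub
      ((innerSL ℝ e).hasFDerivAt.comp z₀ hsub)).smul_const e)
    refine h1.congr_fderiv ?_
    ext u
    have : ‖∇ ψ z₀‖⁻¹ * inner ℝ (∇ ψ z₀) u = inner ℝ e u := by
      rw [he, unitGrad, inner_smul_left]; rfl
    rw [inner_gradient_left] at this
    simp [this]
  have hΘc : ContDiffAt ℝ 1 Θ z₀ := by
    have h1 : ContDiffAt ℝ 1 ψ z₀ := hψ.of_le (by norm_num)
    have h2 : ContDiffAt ℝ 1 (fun x : E => x - z₀) z₀ := contDiffAt_id.sub contDiffAt_const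
    exact h2.add (((contDiffAt_const.mul h1).sub
      ((contDiffAt_const (c := e)).inner ℝ h2)).smul contDiffAt_const)
  have hst := hΘc.hasStrictFDerivAt' hΘd one_ne_zero
  refine ⟨hst.localInverse Θ _ z₀, ?_, ?_, ?_, ?_⟩
  · have := hΘc.to_localInverse hΘd one_ne_zero
    rw [hΘ0] at this
    exact this
  · have := hst.localInverse_apply_image
    rwa [hΘ0] at this
  · have := hst.to_localInverse.hasFDerivAt
    rw [hΘ0] at this
    exact this
  · have := hst.eventually_right_inverse
    rw [hΘ0] at this
    filter_upwards [this] with w hw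
    set x := hst.localInverse Θ _ z₀ w
    have h2 : inner ℝ e (Θ x) = ‖∇ ψ z₀‖⁻¹ * ψ x := by
      simp only [Θ, inner_add_right, inner_smul_right, hee]; ring
    rw [← hw, h2]
    field_simp

/-- Normal coordinates along the level set `ψ = 0`. -/
theorem exists_normal_coordinates {ψ : E → ℝ} {z₀ : E} (hψ : ContDiffAt ℝ 2 ψ z₀)
    (h0 : ∇ ψ z₀ ≠ 0) (hz : ψ z₀ = 0) {U : Set E} (hU : U ∈ 𝓝 z₀) {c : ℝ} (hc : 0 < c) :
    ∃ (G : E → E) (F : OpenPartialHomeomorph E E) (ρ : ℝ), 0 < ρ ∧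
      (∀ w, G w = G (w - inner ℝ (unitGrad ψ z₀) w • unitGrad ψ z₀)) ∧
      F 0 = z₀ ∧
      Metric.ball 0 ρ ⊆ F.source ∧
      (∀ w ∈ Metric.ball (0 : E) ρ, ∀ w' ∈ Metric.ball (0 : E) ρ,
        ‖F w - F w' - (w - w')‖ ≤ c * ‖w - w'‖) ∧
      (∀ w ∈ Metric.ball (0 : E) ρ,
        F w = G w + inner ℝ (unitGrad ψ z₀) w • unitGrad ψ (G w) ∧ F w ∈ U ∧ G w ∈ U ∧
        ψ (G w) = 0 ∧ ∇ ψ (G w) ≠ 0 ∧ 0 < inner ℝ (unitGrad ψ z₀) (unitGrad ψ (G w)) ∧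
        (ψ (F w) < 0 ↔ inner ℝ (unitGrad ψ z₀) w < 0) ∧
        (ψ (F w) = 0 ↔ inner ℝ (unitGrad ψ z₀) w = 0) ∧
        ContDiffAt ℝ 1 F.symm (F w) ∧
        HasGradientAt (fun x => - inner ℝ (unitGrad ψ z₀) (F.symm x))
          (- unitGrad ψ (G w)) (F w)) := by
  obtain ⟨H, hHc, hH0, hHd, hHψ⟩ := exists_straightening hψ h0 hz
  set e := unitGrad ψ z₀ with he
  have hne : ‖e‖ = 1 := norm_unitGrad h0
  have hee : inner ℝ e e = 1 := by rw [real_inner_self_eq_norm_sq, hne]; norm_num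
  let π : E →L[ℝ] E := ContinuousLinearMap.id ℝ E - (innerSL ℝ e).smulRight e
  have hπ : ∀ w, π w = w - inner ℝ e w • e := fun w => by simp [π]
  have hππ : ∀ w, π (π w) = π w := fun w => by
    simp [hπ, inner_sub_right, inner_smul_right, hne]
  have hπe : ∀ w, inner ℝ e (π w) = 0 := fun w => by
    simp [hπ, inner_sub_right, inner_smul_right, hne]
  let G : E → E := fun w => H (π w)
  have hG0 : G 0 = z₀ := by simp [G, hH0]
  have hπ0 : π 0 = 0 := map_zero π
  have hGc : ContDiffAt ℝ 1 G 0 := by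
    have : ContDiffAt ℝ 1 H (π 0) := by rwa [hπ0]
    exact this.comp 0 π.contDiff.contDiffAt
  have hGd : HasFDerivAt G π 0 := by
    have : HasFDerivAt H (ContinuousLinearMap.id ℝ E) (π 0) := by rwa [hπ0]
    exact this.comp 0 π.hasFDerivAt
  have hNc : ContDiffAt ℝ 1 (fun w => unitGrad ψ (G w)) 0 := by
    have : ContDiffAt ℝ 1 (unitGrad ψ) (G 0) := by rw [hG0]; exact contDiffAt_unitGrad hψ h0
    exact this.comp 0 hGc
  -- G parametrizes the level set by the hyperplane orthogonal to e, and Φ leaves it along the unit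
  -- normal. The derivative at 0 is π + e⊗e, the identity; ψ being C² makes the normal, hence Φ, of
  -- class C¹.
  let Φ : E → E := fun w => G w + inner ℝ e w • unitGrad ψ (G w)
  have hΦ0 : Φ 0 = z₀ := by simp [Φ, hG0]
  have hΦc : ContDiffAt ℝ 1 Φ 0 :=
    hGc.add ((contDiffAt_const.inner ℝ contDiffAt_id).smul hNc)
  have hinner : ∀ w, HasFDerivAt (fun w : E => inner ℝ e w) (innerSL ℝ e) w :=
    fun w => (innerSL ℝ e).hasFDerivAt
  have hΦd : HasFDerivAt Φ ((ContinuousLinearEquiv.refl ℝ E : E ≃L[ℝ] E) : E →L[ℝ] E) 0 := by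
    have h1 := hGd.add ((hinner 0).smul (hNc.differentiableAt one_ne_zero).hasFDerivAt)
    refine h1.congr_fderiv ?_
    ext u
    simp [hπ, hG0, ← he]
  have hst := hΦc.hasStrictFDerivAt' hΦd one_ne_zero
  let F := hst.toOpenPartialHomeomorph Φ
  have hF : ∀ w, F w = Φ w := fun w => rfl
  have hsymm : ContDiffAt ℝ 1 F.symm z₀ := by
    have := hΦc.to_localInverse hΦd one_ne_zero
    rw [hΦ0] at this
    exact this
  -- the conditions to be satisfied near `0`
  have c1 : ∀ᶠ w in 𝓝 (0 : E), w ∈ F.source :=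
    F.open_source.mem_nhds hst.mem_toOpenPartialHomeomorph_source
  have tΦ : Tendsto Φ (𝓝 0) (𝓝 z₀) := by
    have := hΦc.continuousAt; rwa [ContinuousAt, hΦ0] at this
  have tG : Tendsto G (𝓝 0) (𝓝 z₀) := by
    have := hGc.continuousAt; rwa [ContinuousAt, hG0] at this
  have c2 : ∀ᶠ w in 𝓝 (0 : E), Φ w ∈ U := tΦ hU
  have c3 : ∀ᶠ w in 𝓝 (0 : E), G w ∈ U := tG hU
  have c4 : ∀ᶠ w in 𝓝 (0 : E), ψ (G w) = 0 := by
    have : Tendsto π (𝓝 0) (𝓝 0) := by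
      have := π.continuous.tendsto 0; rwa [hπ0] at this
    filter_upwards [this.eventually hHψ] with w hw
    simp only [G]
    rw [hw, hπe, mul_zero]
  have hgc : ContinuousAt (∇ ψ) z₀ := (contDiffAt_gradient (m := 1) hψ (by norm_num)).continuousAt
  have c5 : ∀ᶠ w in 𝓝 (0 : E), ∇ ψ (G w) ≠ 0 := tG.eventually (hgc.eventually_ne h0)
  have tN : Tendsto (fun w => inner ℝ e (unitGrad ψ (G w))) (𝓝 0) (𝓝 1) := by
    have h1 : ContinuousAt (fun w => inner ℝ e (unitGrad ψ (G w))) 0 :=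
      continuousAt_const.inner hNc.continuousAt
    rw [ContinuousAt, hG0, ← he, hee] at h1
    exact h1
  have c6 : ∀ᶠ w in 𝓝 (0 : E), 1 / 2 < inner ℝ e (unitGrad ψ (G w)) :=
    tN.eventually_const_lt (by norm_num)
  have c7 : ∀ᶠ w in 𝓝 (0 : E), ContDiffAt ℝ 1 F.symm (Φ w) :=
    tΦ.eventually (hsymm.eventually (by simp))
  have c8 : ∀ᶠ w in 𝓝 (0 : E), ContDiffAt ℝ 2 ψ (G w) :=
    tG.eventually (hψ.eventually (by simp))
  have c9 : ∀ᶠ w in 𝓝 (0 : E), ContDiffAt ℝ 1 G w := hGc.eventually (by simp)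
  have hψst : HasStrictFDerivAt ψ (innerSL ℝ (∇ ψ z₀)) z₀ :=
    hψ.hasStrictFDerivAt' (hψ.differentiableAt (by norm_num)).hasGradientAt.hasFDerivAt
      (by norm_num)
  have hn : 0 < ‖∇ ψ z₀‖ := norm_pos_iff.2 h0
  have c10 : ∀ᶠ w in 𝓝 (0 : E),
      |ψ (Φ w) - ψ (G w) - inner ℝ (∇ ψ z₀) (Φ w - G w)| ≤ ‖∇ ψ z₀‖ / 4 * ‖Φ w - G w‖ := by
    have := hψst.isLittleO.def (c := ‖∇ ψ z₀‖ / 4) (by positivity)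
    have t2 : Tendsto (fun w => (Φ w, G w)) (𝓝 0) (𝓝 (z₀, z₀)) := tΦ.prodMk_nhds tG
    simpa using t2.eventually this
  obtain ⟨V, hVo, hV0, hV⟩ := exists_nhds_square (hst.isLittleO.def hc)
  have c0 : ∀ᶠ w in 𝓝 (0 : E), w ∈ V := hVo.mem_nhds hV0
  obtain ⟨ρ, hρ, hρs⟩ := Metric.eventually_nhds_iff_ball.1
    (c0.and (c1.and (c2.and (c3.and
      (c4.eventually_nhds.and (c5.eventually_nhds.and (c6.and (c7.and (c8.and (c9.and c10))))))))))
  refine ⟨G, F, ρ, hρ, fun w => ?_, hΦ0, fun w hw => (hρs w hw).2.1, ?_, ?_⟩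
  · simp only [G, ← hπ, hππ]
  · intro w hw w' hw'
    have := @hV (w, w') ⟨(hρs w hw).1, (hρs w' hw').1⟩
    rw [hF, hF]
    simpa using this
  · intro w hw
    obtain ⟨-, d1, d2, d3, d4, d5, d6, d7, d8, d9, d10⟩ := hρs w hw
    have d4' := d4.self_of_nhds
    have d5' := d5.self_of_nhds
    -- The main term has size at least |⟨e,w⟩| ‖∇ψ(z₀)‖/2 and the error is at most half of that, so
    -- ψ(Φ w) has the sign of ⟨e,w⟩.
    have hsign : |ψ (Φ w) - inner ℝ e w * (‖∇ ψ z₀‖ * inner ℝ e (unitGrad ψ (G w)))|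
        ≤ ‖∇ ψ z₀‖ / 4 * |inner ℝ e w| := by
      have e1 : Φ w - G w = inner ℝ e w • unitGrad ψ (G w) := by simp [Φ]
      rw [e1, d4', sub_zero, norm_smul, norm_unitGrad d5', mul_one, Real.norm_eq_abs,
        inner_smul_right, ← norm_smul_unitGrad h0, inner_smul_left, ← he] at d10
      simpa [norm_smul, hne] using d10
    set a := inner ℝ e w with ha
    set p := ‖∇ ψ z₀‖ with hp
    set k := inner ℝ e (unitGrad ψ (G w))
    have hpk : p / 2 < p * k := by nlinarith
    have hneg : a < 0 → ψ (Φ w) < 0 := fun h => by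
      rw [abs_of_neg h, abs_le] at hsign
      nlinarith [hsign.2, mul_lt_mul_of_neg_left hpk h, mul_neg_of_pos_of_neg hn h]
    have hpos : 0 < a → 0 < ψ (Φ w) := fun h => by
      rw [abs_of_pos h, abs_le] at hsign
      nlinarith [hsign.1, mul_lt_mul_of_pos_left hpk h, mul_pos hn h]
    have hzero : a = 0 → ψ (Φ w) = 0 := fun h => by
      rw [h] at hsign; simpa using hsign
    refine ⟨rfl, d2, d3, d4', d5', by linarith, ⟨fun h => ?_, hneg⟩, ⟨fun h => ?_, hzero⟩, d7, ?_⟩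
    · rw [hF] at h
      rcases lt_trichotomy a 0 with h1 | h1 | h1
      · exact h1
      · rw [hzero h1] at h; exact absurd h (lt_irrefl _)
      · exact absurd (hpos h1) h.not_gt
    · rw [hF] at h
      rcases lt_trichotomy a 0 with h1 | h1 | h1
      · exact absurd h (hneg h1).ne
      · exact h1
      · exact absurd h (hpos h1).ne'
    · -- the gradient of the normal coordinate
      rw [hF]
      have hFw : F.symm (Φ w) = w := F.left_inv d1
      have hG' := (d9.differentiableAt one_ne_zero).hasFDerivAt
      set G' := fderiv ℝ G w
      have hM : DifferentiableAt ℝ (fun w => unitGrad ψ (G w)) w :=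
        ((contDiffAt_unitGrad d8 d5').differentiableAt one_ne_zero).comp w
          (d9.differentiableAt one_ne_zero)
      have hM' := hM.hasFDerivAt
      set M' := fderiv ℝ (fun w => unitGrad ψ (G w)) w
      -- The normal N at G w is orthogonal to the range of G' (tangent to the level set) and to that
      -- of M' (since ‖N‖ = 1). Hence ⟨N, Φ'u⟩ = ⟨e,u⟩, and composing with the derivative of the
      -- inverse identifies the gradient of the normal coordinate as N.
      have o1 : ∀ u, inner ℝ (unitGrad ψ (G w)) (G' u) = 0 := by
        intro u
        have hcomp : HasFDerivAt (fun w => ψ (G w)) ((innerSL ℝ (∇ ψ (G w))).comp G') w :=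
          ((d8.differentiableAt (by norm_num)).hasGradientAt.hasFDerivAt).comp w hG'
        have hz' : HasFDerivAt (fun w => ψ (G w)) (0 : E →L[ℝ] ℝ) w :=
          (hasFDerivAt_const (0 : ℝ) w).congr_of_eventuallyEq d4
        have := congrArg (fun L => L u) (hcomp.unique hz')
        simp only [ContinuousLinearMap.comp_apply, innerSL_apply_apply,
          zero_apply] at this
        rw [unitGrad, inner_smul_left, this, mul_zero]
      have o2 : ∀ u, inner ℝ (unitGrad ψ (G w)) (M' u) = 0 := by
        intro u
        have hcomp := hM'.inner ℝ hM'
        have hz' : HasFDerivAt (fun w => inner ℝ (unitGrad ψ (G w)) (unitGrad ψ (G w)))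
            (0 : E →L[ℝ] ℝ) w := by
          refine (hasFDerivAt_const (1 : ℝ) w).congr_of_eventuallyEq ?_
          filter_upwards [d5] with w' hw'
          rw [real_inner_self_eq_norm_sq, norm_unitGrad hw']; norm_num
        have := congrArg (fun L => L u) (hcomp.unique hz')
        simp [real_inner_comm] at this
        exact this
      have hΦ' : HasFDerivAt Φ (G' + (a • M' + (innerSL ℝ e).smulRight (unitGrad ψ (G w)))) w :=
        hG'.add ((hinner w).smul hM')
      have hs' := (d7.differentiableAt one_ne_zero).hasFDerivAt
      set S' := fderiv ℝ F.symm (Φ w)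
      have hcomp : HasFDerivAt (fun x => Φ (F.symm x))
          ((G' + (a • M' + (innerSL ℝ e).smulRight (unitGrad ψ (G w)))).comp S') (Φ w) := by
        have : HasFDerivAt Φ (G' + (a • M' + (innerSL ℝ e).smulRight (unitGrad ψ (G w))))
            (F.symm (Φ w)) := by rwa [hFw]
        exact this.comp (Φ w) hs'
      have hid : HasFDerivAt (fun x => Φ (F.symm x)) (ContinuousLinearMap.id ℝ E) (Φ w) := by
        refine (hasFDerivAt_id (Φ w)).congr_of_eventuallyEq ?_
        filter_upwards [F.open_target.mem_nhds (F.map_source d1)] with x hx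
        exact F.right_inv hx
      have heq := hcomp.unique hid
      rw [hasGradientAt_iff_hasFDerivAt]
      have hfin : HasFDerivAt (fun x => - inner ℝ e (F.symm x)) (-((innerSL ℝ e).comp S')) (Φ w) :=
        ((innerSL ℝ e).hasFDerivAt.comp (Φ w) hs').neg
      refine hfin.congr_fderiv ?_
      ext v
      have hv := congrArg (fun L => inner ℝ (unitGrad ψ (G w)) (L v)) heq
      have hNN : inner ℝ (unitGrad ψ (G w)) (unitGrad ψ (G w)) = 1 := by
        rw [real_inner_self_eq_norm_sq, norm_unitGrad d5']; norm_num
      simp only [ContinuousLinearMap.comp_apply, add_apply,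
        smul_apply, ContinuousLinearMap.smulRight_apply, innerSL_apply_apply,
        inner_add_right, inner_smul_right, o1, o2, hNN, ContinuousLinearMap.id_apply] at hv
      simp [← hv]

end NormalCoordinates

/-! ### Collar charts of a C² boundary. -/

section CollarChart

variable {E : Type*} [NormedAddCommGroup E] [InnerProductSpace ℝ E] [CompleteSpace E]

/-- Near `z₀` the set `Ω` is the sublevel set of a `C²` function, whose gradient is non-zero and
points, at the points of the boundary, in the direction of the unit vector field `ν`. -/
def HasC2BoundaryAt (Ω : Set E) (ν : E → E) (z₀ : E) : Prop :=
  ∃ U : Set E, IsOpen U ∧ z₀ ∈ U ∧ ∃ ψ : E → ℝ, ContDiffOn ℝ 2 ψ U ∧ ∇ ψ z₀ ≠ 0 ∧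
    (∀ z ∈ U, z ∈ Ω ↔ ψ z < 0) ∧ ∀ z ∈ U ∩ frontier Ω, ν z = unitGrad ψ z

/-- Isometric coordinates in a Euclidean space, adapted to the hyperplane orthogonal to `e`. -/
def hyperplaneIsometry (e : E) (he : ‖e‖ = 1) :
    WithLp 2 (((ℝ ∙ e)ᗮ : Submodule ℝ E) × ℝ) →ₗᵢ[ℝ] E where
  toFun p := (p.fst : E) - p.snd • e
  map_add' p q := by simp [add_smul]; abel
  map_smul' a p := by simp [mul_smul, smul_sub]
  norm_map' p := by
    have h1 : inner ℝ e (p.fst : E) = 0 := Submodule.mem_orthogonal_singleton_iff_inner_right.1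
      p.fst.2
    have h2 : inner ℝ (p.fst : E) (p.snd • e) = 0 := by
      rw [inner_smul_right, real_inner_comm, h1, mul_zero]
    have h3 : ‖(p.fst : E) - p.snd • e‖ ^ 2 = ‖p‖ ^ 2 := by
      rw [WithLp.prod_norm_sq_eq_of_L2, norm_sub_sq_real, h2, norm_smul, he]
      simp
    exact (sq_eq_sq₀ (norm_nonneg _) (norm_nonneg _)).1 h3

theorem hyperplaneIsometry_surjective (e : E) (he : ‖e‖ = 1) :
    Function.Surjective (hyperplaneIsometry e he) := by
  intro x
  have hee : inner ℝ e e = 1 := by rw [real_inner_self_eq_norm_sq, he]; norm_num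
  refine ⟨WithLp.toLp 2 (⟨x - inner ℝ e x • e, ?_⟩, - inner ℝ e x), ?_⟩
  · rw [Submodule.mem_orthogonal_singleton_iff_inner_right, inner_sub_right, inner_smul_right,
      hee]
    ring
  · change (x - inner ℝ e x • e) - (- inner ℝ e x) • e = x
    simp

variable [FiniteDimensional ℝ E] [MeasurableSpace E] [BorelSpace E]

/-- The coordinates (y, t) ↦ y − te are isometric for the Euclidean product norm. The minus sign
makes t > 0 the inner side when e is the outward normal. -/
theorem volume_image_hyperplane (e : E) (he : ‖e‖ = 1)
    (s : Set (((ℝ ∙ e)ᗮ : Submodule ℝ E) × ℝ)) :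
    volume ((fun p : ((ℝ ∙ e)ᗮ : Submodule ℝ E) × ℝ => (p.1 : E) - p.2 • e) '' s)
      = volume s := by
  let L := LinearIsometryEquiv.ofSurjective (hyperplaneIsometry e he)
    (hyperplaneIsometry_surjective e he)
  let M : (((ℝ ∙ e)ᗮ : Submodule ℝ E) × ℝ) ≃ᵐ E :=
    (MeasurableEquiv.toLp 2 _).trans L.toHomeomorph.toMeasurableEquiv
  have hM : MeasurePreserving M volume volume :=
    (WithLp.volume_preserving_toLp _ _).trans L.measurePreserving
  have h1 : (fun p : ((ℝ ∙ e)ᗮ : Submodule ℝ E) × ℝ => (p.1 : E) - p.2 • e) = M := by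
    ext p
    rfl
  rw [h1, ← hM.measure_preimage_equiv, M.injective.preimage_image]

theorem finrank_orthogonal_singleton (e : E) (he : ‖e‖ = 1) :
    Module.finrank ℝ ((ℝ ∙ e)ᗮ : Submodule ℝ E) = Module.finrank ℝ E - 1 := by
  have h0 : e ≠ 0 := by rintro rfl; simp at he
  rw [← (ℝ ∙ e).finrank_add_finrank_orthogonal, finrank_span_singleton h0,
    Nat.add_sub_cancel_left]

/-- A chart `(y, t) ↦ g(y) - t ν(g(y))` of a neighborhood of the boundary point `z₀` of `Ω`, which
changes the volume, and the surface measure of the boundary, by a factor in `[(1+η)⁻¹, 1+η]`. -/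
structure CollarChart (Ω : Set E) (ν : E → E) (z₀ : E) (η : ℝ) where
  T : Submodule ℝ E
  r : ℝ
  Ψ : T × ℝ → E
  τ : E → ℝ
  r_pos : 0 < r
  map_zero : Ψ (0, 0) = z₀
  continuousOn : ContinuousOn Ψ (Metric.ball 0 r ×ˢ Ioo (-r) r)
  injOn : InjOn Ψ (Metric.ball 0 r ×ˢ Ioo (-r) r)
  isOpen_image : IsOpen (Ψ '' (Metric.ball 0 r ×ˢ Ioo (-r) r))
  apply_eq : ∀ y ∈ Metric.ball (0 : T) r, ∀ t ∈ Ioo (-r) r,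
    Ψ (y, t) = Ψ (y, 0) - t • ν (Ψ (y, 0))
  mem_frontier_iff : ∀ y ∈ Metric.ball (0 : T) r, ∀ t ∈ Ioo (-r) r,
    (Ψ (y, t) ∈ frontier Ω ↔ t = 0)
  mem_iff : ∀ y ∈ Metric.ball (0 : T) r, ∀ t ∈ Ioo (-r) r, (Ψ (y, t) ∈ Ω ↔ 0 < t)
  norm_normal : ∀ y ∈ Metric.ball (0 : T) r, ‖ν (Ψ (y, 0))‖ = 1
  continuousOn_normal : ContinuousOn ν (Ψ '' (Metric.ball 0 r ×ˢ Ioo (-r) r) ∩ frontier Ω)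
  contDiffOn_τ : ContDiffOn ℝ 1 τ (Ψ '' (Metric.ball 0 r ×ˢ Ioo (-r) r))
  τ_apply : ∀ y ∈ Metric.ball (0 : T) r, ∀ t ∈ Ioo (-r) r, τ (Ψ (y, t)) = t
  gradient_τ : ∀ y ∈ Metric.ball (0 : T) r, ∀ t ∈ Ioo (-r) r,
    ∇ τ (Ψ (y, t)) = - ν (Ψ (y, 0))
  volume_image_le : ∀ s ⊆ Metric.ball (0 : T) r ×ˢ Ioo (-r) r,
    volume (Ψ '' s) ≤ ENNReal.ofReal (1 + η) * volume s
  volume_le_image : ∀ s ⊆ Metric.ball (0 : T) r ×ˢ Ioo (-r) r,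
    volume s ≤ ENNReal.ofReal (1 + η) * volume (Ψ '' s)
  surface_image_le : ∀ s ⊆ Metric.ball (0 : T) r,
    (μHE[Module.finrank ℝ E - 1] : Measure E) ((fun y => Ψ (y, 0)) '' s)
      ≤ ENNReal.ofReal (1 + η) * volume s
  surface_le_image : ∀ s ⊆ Metric.ball (0 : T) r,
    volume s ≤ ENNReal.ofReal (1 + η) *
      (μHE[Module.finrank ℝ E - 1] : Measure E) ((fun y => Ψ (y, 0)) '' s)

theorem exists_one_lt_pow_le (d : ℕ) {η : ℝ} (hη : 0 < η) :
    ∃ K : NNReal, 1 < K ∧ (K : ℝ) ^ d ≤ 1 + η := by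
  have h1 : Tendsto (fun x : ℝ => x ^ d) (𝓝[>] 1) (𝓝 1) := by
    have : Tendsto (fun x : ℝ => x ^ d) (𝓝 1) (𝓝 (1 ^ d)) := (continuous_pow d).tendsto 1
    rw [one_pow] at this
    exact this.mono_left nhdsWithin_le_nhds
  obtain ⟨x, hx1, hx2⟩ := ((h1.eventually_lt_const (by linarith : (1 : ℝ) < 1 + η)).and
    self_mem_nhdsWithin).exists
  have hx : (1 : ℝ) < x := hx2
  exact ⟨⟨x, by linarith⟩, hx, hx1.le⟩

/-- The normal coordinates of the defining function are nearly isometric on a small ball, so all the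
measure bounds follow from one Lipschitz constant K with K to the power of the dimension at most
1+η. -/
theorem exists_collarChart {Ω : Set E} (hΩ : IsOpen Ω) {ν : E → E} {z₀ : E}
    (hz₀ : z₀ ∈ frontier Ω) (h : HasC2BoundaryAt Ω ν z₀) {η : ℝ} (hη : 0 < η)
    {δ₀ : ℝ} (hδ₀ : 0 < δ₀) :
    ∃ C : CollarChart Ω ν z₀ η, C.r ≤ δ₀ := by
  obtain ⟨U, hUo, hzU, ψ, hψ, hψ0, hΩψ, hν⟩ := h
  obtain ⟨K, hK1, hKη⟩ := exists_one_lt_pow_le (Module.finrank ℝ E) hη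
  have hK1' : (1 : ℝ) < K := hK1
  have hψU : ∀ z ∈ U, ContDiffAt ℝ 2 ψ z := fun z hz => (hψ z hz).contDiffAt (hUo.mem_nhds hz)
  rw [hΩ.frontier_eq] at hz₀
  -- The description of Ω by ψ < 0 says nothing about its closure; this rules out the outer side, so
  -- that inside U the frontier lies in ψ = 0.
  have notcl : ∀ z ∈ U, 0 < ψ z → z ∉ closure Ω := by
    intro z hz hpos hcl
    have h1 : ∀ᶠ x in 𝓝 z, 0 < ψ x ∧ x ∈ U :=
      ((hψU z hz).continuousAt.eventually_const_lt hpos).and (hUo.mem_nhds hz)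
    obtain ⟨x, hxΩ, hx⟩ := (mem_closure_iff_frequently.1 hcl).and_eventually h1 |>.exists
    exact absurd ((hΩψ x hx.2).1 hxΩ) hx.1.not_gt
  have hψz : ψ z₀ = 0 := by
    refine le_antisymm (not_lt.1 fun h => notcl z₀ hzU h hz₀.1) (not_lt.1 fun h => ?_)
    exact hz₀.2 ((hΩψ z₀ hzU).2 h)
  -- With this tolerance F expands distances by at most 2 − K⁻¹ ≤ K and contracts them by at most
  -- K⁻¹.
  have hc : (0 : ℝ) < 1 - (K : ℝ)⁻¹ := sub_pos.2 (inv_lt_one_of_one_lt₀ hK1')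
  obtain ⟨G, F, ρ₁, hρ₁, hG, hF0, hsrc, happ, hloc⟩ :=
    exists_normal_coordinates (hψU z₀ hzU) hψ0 hψz (hUo.mem_nhds hzU) hc
  obtain ⟨ρ, hρ, hρρ, hρδ⟩ : ∃ ρ, 0 < ρ ∧ ρ ≤ ρ₁ ∧ ρ ≤ δ₀ :=
    ⟨min ρ₁ δ₀, lt_min hρ₁ hδ₀, min_le_left _ _, min_le_right _ _⟩
  have hball : Metric.ball (0 : E) ρ ⊆ Metric.ball 0 ρ₁ := Metric.ball_subset_ball hρρ
  replace hsrc := hball.trans hsrc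
  replace happ := fun w hw w' hw' => happ w (hball hw) w' (hball hw')
  replace hloc := fun w hw => hloc w (hball hw)
  have hne : ‖unitGrad ψ z₀‖ = 1 := norm_unitGrad hψ0
  set e := unitGrad ψ z₀ with he
  have hee : inner ℝ e e = 1 := by rw [real_inner_self_eq_norm_sq, hne]; norm_num
  let T : Submodule ℝ E := (ℝ ∙ e)ᗮ
  have hT : ∀ y : T, inner ℝ e (y : E) = 0 := fun y =>
    Submodule.mem_orthogonal_singleton_iff_inner_right.1 y.2
  let ι : T × ℝ → E := fun p => (p.1 : E) - p.2 • e
  have hιe : ∀ p, inner ℝ e (ι p) = - p.2 := fun p => by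
    simp only [ι, inner_sub_right, inner_smul_right, hee, hT]; ring
  have hιc : Continuous ι := by fun_prop
  have hιinj : Function.Injective ι := by
    intro p q hpq
    have h2 : p.2 = q.2 := by
      have := congrArg (fun x => inner ℝ e x) hpq
      simp only [hιe] at this
      linarith
    have h1 : (p.1 : E) = q.1 := by
      simp only [ι, h2] at hpq
      exact sub_left_inj.1 hpq
    exact Prod.ext (Subtype.ext h1) h2
  -- Halving ρ puts y − te in the ball of radius ρ, by the triangle inequality.
  set D : Set (T × ℝ) := Metric.ball 0 (ρ / 2) ×ˢ Ioo (-(ρ / 2)) (ρ / 2) with hD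
  have hιD : ∀ p ∈ D, ι p ∈ Metric.ball (0 : E) ρ := by
    rintro ⟨y, t⟩ ⟨hy, ht⟩
    rw [mem_ball_zero_iff] at hy ⊢
    have : ‖ι (y, t)‖ ≤ ‖(y : E)‖ + ‖t • e‖ := norm_sub_le _ _
    rw [norm_smul, hne, mul_one, Real.norm_eq_abs] at this
    have h2 : |t| < ρ / 2 := abs_lt.2 ⟨ht.1, ht.2⟩
    have h3 : ‖(y : E)‖ < ρ / 2 := hy
    linarith
  have hGι : ∀ y : T, ∀ t : ℝ, G (ι (y, t)) = G y := by
    intro y t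
    rw [hG (ι (y, t)), hG y, hιe, hT]
    simp [ι]
  have h00 : (0 : ℝ) ∈ Ioo (-(ρ / 2)) (ρ / 2) := ⟨by linarith, by linarith⟩
  have hιy : ∀ y : T, ι (y, 0) = y := fun y => by simp [ι]
  let Ψ : T × ℝ → E := fun p => F (ι p)
  have hΨ0 : ∀ y ∈ Metric.ball (0 : T) (ρ / 2), Ψ (y, 0) = G y := by
    intro y hy
    have := (hloc _ (hιD (y, 0) ⟨hy, h00⟩)).1
    rw [hιe, hGι] at this
    simpa using this
  have hmem : ∀ y ∈ Metric.ball (0 : T) (ρ / 2), ∀ t ∈ Ioo (-(ρ / 2)) (ρ / 2),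
      (Ψ (y, t) ∈ Ω ↔ 0 < t) := by
    intro y hy t ht
    obtain ⟨-, hU1, -, -, -, -, h1, -⟩ := hloc _ (hιD (y, t) ⟨hy, ht⟩)
    rw [hΩψ _ hU1, h1, hιe]
    simp
  have hΨc : ContinuousOn Ψ D :=
    F.continuousOn.comp hιc.continuousOn fun p hp => hsrc (hιD p hp)
  have hfr : ∀ y ∈ Metric.ball (0 : T) (ρ / 2), ∀ t ∈ Ioo (-(ρ / 2)) (ρ / 2),
      (Ψ (y, t) ∈ frontier Ω ↔ t = 0) := by
    intro y hy t ht
    obtain ⟨-, hU1, -, -, -, -, h1, h2, -⟩ := hloc _ (hιD (y, t) ⟨hy, ht⟩)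
    rw [hΩ.frontier_eq]
    constructor
    · rintro ⟨hcl, hn⟩
      rw [hmem y hy t ht] at hn
      rcases lt_trichotomy t 0 with h | h | h
      · refine absurd hcl (notcl _ hU1 ?_)
        refine lt_of_le_of_ne (not_lt.1 fun h' => ?_) fun h' => ?_
        · have := h1.1 h'
          rw [hιe] at this
          simp only at this
          linarith
        · have := h2.1 h'.symm
          rw [hιe] at this
          simp only at this
          linarith
      · exact h
      · exact absurd h hn
    · rintro rfl
      refine ⟨?_, fun h' => lt_irrefl _ ((hmem y hy 0 ht).1 h')⟩
      have t1 : Tendsto (fun s : ℝ => Ψ (y, s)) (𝓝[>] 0) (𝓝 (Ψ (y, 0))) := by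
        have ho : IsOpen D := Metric.isOpen_ball.prod isOpen_Ioo
        have h3 : ContinuousAt Ψ (y, 0) := hΨc.continuousAt (ho.mem_nhds ⟨hy, ht⟩)
        have h4 : Continuous fun s : ℝ => (y, s) := by fun_prop
        exact (h3.tendsto.comp (h4.tendsto 0)).mono_left nhdsWithin_le_nhds
      refine mem_closure_of_tendsto t1 ?_
      filter_upwards [Ioo_mem_nhdsGT (by linarith : (0 : ℝ) < ρ / 2)] with s hs
      exact (hmem y hy s ⟨by linarith [hs.1], hs.2⟩).2 hs.1
  have hνG : ∀ y ∈ Metric.ball (0 : T) (ρ / 2), ν (Ψ (y, 0)) = unitGrad ψ (G y) := by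
    intro y hy
    obtain ⟨-, hU1, -⟩ := hloc _ (hιD (y, 0) ⟨hy, h00⟩)
    rw [← hΨ0 y hy]
    exact hν _ ⟨hU1, (hfr y hy 0 h00).2 rfl⟩
  have hinjF : InjOn Ψ D := fun p hp q hq hpq =>
    hιinj (F.injOn (hsrc (hιD p hp)) (hsrc (hιD q hq)) hpq)
  have hιD_open : IsOpen (ι '' D) := by
    have : ι '' D = (fun w : E => (⟨w - inner ℝ e w • e, by
        rw [Submodule.mem_orthogonal_singleton_iff_inner_right, inner_sub_right, inner_smul_right,
          hee]; ring⟩, - inner ℝ e w) : E → T × ℝ) ⁻¹' D := by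
      ext w
      constructor
      · rintro ⟨p, hp, rfl⟩
        have : p = (⟨ι p - inner ℝ e (ι p) • e, by
            rw [Submodule.mem_orthogonal_singleton_iff_inner_right, inner_sub_right,
              inner_smul_right, hee]; ring⟩, - inner ℝ e (ι p)) := by
          refine Prod.ext (Subtype.ext ?_) ?_
          · simp only [hιe]; simp [ι]
          · simp [hιe]
        rw [mem_preimage, ← this]
        exact hp
      · intro hw
        exact ⟨_, hw, by simp [ι]⟩
    rw [this]
    exact (Metric.isOpen_ball.prod isOpen_Ioo).preimage (by fun_prop)
  have himg : Ψ '' D = F '' (ι '' D) := by rw [image_image]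
  have hopen : IsOpen (Ψ '' D) := by
    rw [himg]
    exact F.isOpen_image_of_subset_source hιD_open (by
      rintro _ ⟨p, hp, rfl⟩
      exact hsrc (hιD p hp))
  have hlip : ∀ w ∈ Metric.ball (0 : E) ρ, ∀ w' ∈ Metric.ball (0 : E) ρ,
      dist (F w) (F w') ≤ K * dist w w' ∧ dist w w' ≤ K * dist (F w) (F w') := by
    intro w hw w' hw'
    have h1 := happ w hw w' hw'
    rw [dist_eq_norm, dist_eq_norm]
    have h2 := norm_sub_norm_le (F w - F w') (w - w')
    have h3 := norm_sub_norm_le (w - w') (F w - F w')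
    rw [norm_sub_rev (w - w')] at h3
    have h4 : (K : ℝ) * (K : ℝ)⁻¹ = 1 := mul_inv_cancel₀ (by linarith)
    have h5 : 0 ≤ ‖w - w'‖ := norm_nonneg _
    have h6 : 0 < (K : ℝ)⁻¹ := by positivity
    have h7 : 2 - (K : ℝ)⁻¹ ≤ K := by nlinarith [sq_nonneg ((K : ℝ) - 1)]
    constructor
    · nlinarith
    · have h8 : (K : ℝ)⁻¹ * ‖w - w'‖ ≤ ‖F w - F w'‖ := by linarith
      calc ‖w - w'‖ = K * ((K : ℝ)⁻¹ * ‖w - w'‖) := by rw [← mul_assoc, h4, one_mul]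
        _ ≤ K * ‖F w - F w'‖ := by gcongr
  have hlipOn : ∀ s ⊆ Metric.ball (0 : E) ρ, LipschitzOnWith K F s := fun s hs =>
    LipschitzOnWith.of_dist_le_mul fun x hx y hy => (hlip x (hs hx) y (hs hy)).1
  have hanti : ∀ x ∈ Metric.ball (0 : E) ρ, ∀ y ∈ Metric.ball (0 : E) ρ,
      edist x y ≤ K * edist (F x) (F y) := by
    intro x hx y hy
    have := (hlip x hx y hy).2
    rw [edist_nndist, edist_nndist]
    exact_mod_cast this
  have hKd : (K : ENNReal) ^ Module.finrank ℝ E ≤ ENNReal.ofReal (1 + η) := by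
    have : (K : ENNReal) ^ Module.finrank ℝ E
        = ENNReal.ofReal ((K : ℝ) ^ Module.finrank ℝ E) := by
      rw [ENNReal.ofReal_pow (NNReal.coe_nonneg K), ENNReal.ofReal_coe_nnreal]
    rw [this]
    exact ENNReal.ofReal_le_ofReal hKη
  have hKd' : (K : ENNReal) ^ (Module.finrank ℝ E - 1) ≤ ENNReal.ofReal (1 + η) :=
    (pow_le_pow_right₀ (by exact_mod_cast hK1.le) (Nat.sub_le _ _)).trans hKd
  have hvol := InnerProductSpace.euclideanHausdorffMeasure_eq_volume (V := E)
  have hvolT : (μHE[Module.finrank ℝ E - 1] : Measure T) = volume := by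
    rw [← finrank_orthogonal_singleton e hne]
    exact InnerProductSpace.euclideanHausdorffMeasure_eq_volume
  have hcoe : ∀ s ⊆ Metric.ball (0 : T) (ρ / 2), ∀ y ∈ s, (y : E) ∈ Metric.ball (0 : E) ρ := by
    intro s hs y hy
    have := hιD (y, 0) ⟨hs hy, h00⟩
    rwa [hιy] at this
  have hΨimg : ∀ s : Set T, (fun y => Ψ (y, 0)) '' s = (fun y : T => F (y : E)) '' s := by
    intro s
    refine image_congr fun y _ => ?_
    simp only [Ψ, hιy]
  refine ⟨{ T := T, r := ρ / 2, Ψ := Ψ, τ := fun x => - inner ℝ e (F.symm x)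
            r_pos := by linarith, map_zero := ?_, continuousOn := hΨc, injOn := hinjF
            isOpen_image := hopen, apply_eq := ?_, mem_frontier_iff := hfr, mem_iff := hmem
            norm_normal := ?_, continuousOn_normal := ?_, contDiffOn_τ := ?_, τ_apply := ?_
            gradient_τ := ?_, volume_image_le := ?_, volume_le_image := ?_
            surface_image_le := ?_, surface_le_image := ?_ },
    by change ρ / 2 ≤ δ₀; linarith⟩
  · have : ι (0, 0) = 0 := by simp [ι]
    simp only [Ψ, this, hF0]
  · intro y hy t ht
    have := (hloc _ (hιD (y, t) ⟨hy, ht⟩)).1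
    rw [hιe, hGι] at this
    rw [hνG y hy, hΨ0 y hy]
    simp only [Ψ]
    rw [this, neg_smul, sub_eq_add_neg]
  · intro y hy
    rw [hνG y hy]
    have := hloc _ (hιD (y, 0) ⟨hy, h00⟩)
    rw [hGι] at this
    exact norm_unitGrad this.2.2.2.2.1
  · have hsub : ∀ x ∈ Ψ '' D ∩ frontier Ω, x ∈ U ∧ ∇ ψ x ≠ 0 := by
      rintro _ ⟨⟨⟨y, t⟩, ⟨hy, ht⟩, rfl⟩, hx⟩
      obtain rfl := (hfr y hy t ht).1 hx
      have := hloc _ (hιD (y, 0) ⟨hy, h00⟩)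
      rw [hGι] at this
      rw [hΨ0 y hy]
      exact ⟨this.2.2.1, this.2.2.2.2.1⟩
    refine ContinuousOn.congr (f := unitGrad ψ) (fun x hx => ?_) fun x hx => ?_
    · exact (contDiffAt_unitGrad (hψU x (hsub x hx).1) (hsub x hx).2).continuousAt.continuousWithinAt
    · exact hν x ⟨(hsub x hx).1, hx.2⟩
  · rintro _ ⟨p, hp, rfl⟩
    exact (contDiffAt_const.inner ℝ (hloc _ (hιD p hp)).2.2.2.2.2.2.2.2.1).neg.contDiffWithinAt
  · intro y hy t ht
    simp only [Ψ]
    rw [F.left_inv (hsrc (hιD (y, t) ⟨hy, ht⟩)), hιe, neg_neg]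
  · intro y hy t ht
    have := (hloc _ (hιD (y, t) ⟨hy, ht⟩)).2.2.2.2.2.2.2.2.2
    rw [hGι] at this
    rw [hνG y hy]
    exact this.gradient
  · intro s hs
    have h1 : Ψ '' s = F '' (ι '' s) := by rw [image_image]
    rw [h1, ← volume_image_hyperplane e hne s, ← hvol]
    refine (euclideanHausdorffMeasure_image_le (hlipOn (ι '' s) ?_) _).trans ?_
    · rintro _ ⟨p, hp, rfl⟩
      exact hιD p (hs hp)
    · gcongr
  · intro s hs
    have h1 : Ψ '' s = F '' (ι '' s) := by rw [image_image]
    rw [h1, ← volume_image_hyperplane e hne s, ← hvol]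
    refine (euclideanHausdorffMeasure_le_image (K := K) (f := F) (s := ι '' s) ?_ _).trans ?_
    · rintro _ ⟨p, hp, rfl⟩ _ ⟨q, hq, rfl⟩
      exact hanti _ (hιD p (hs hp)) _ (hιD q (hs hq))
    · gcongr
  · intro s hs
    rw [hΨimg, ← hvolT]
    refine (euclideanHausdorffMeasure_image_le (K := K) (f := fun y : T => F (y : E)) ?_ _).trans ?_
    · exact LipschitzOnWith.of_dist_le_mul fun x hx y hy =>
        (hlip x (hcoe s hs x hx) y (hcoe s hs y hy)).1
    · gcongr
  · intro s hs
    rw [hΨimg, ← hvolT]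
    refine (euclideanHausdorffMeasure_le_image (K := K) (f := fun y : T => F (y : E)) ?_ _).trans ?_
    · exact fun x hx y hy => hanti x (hcoe s hs x hx) y (hcoe s hs y hy)
    · gcongr

end CollarChart

/-! ### Boundary-layer cut-offs as one-sided approximate identities. -/

section Layer

/-- A smooth monotone function, equal to `0` on `(-∞, δ]` and to `1` on `[2δ, ∞)`. -/
def layerCut (δ t : ℝ) : ℝ := Real.smoothTransition (t / δ - 1)

/-- The derivative of `layerCut δ`, an approximate identity supported in `[δ, 2δ]`. -/
def layerKernel (δ t : ℝ) : ℝ := deriv (layerCut δ) t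

theorem contDiff_layerCut (δ : ℝ) : ContDiff ℝ 1 (layerCut δ) :=
  (Real.smoothTransition.contDiff (n := 1)).comp
    ((contDiff_id.div_const δ).sub contDiff_const)

theorem hasDerivAt_layerCut (δ t : ℝ) : HasDerivAt (layerCut δ) (layerKernel δ t) t :=
  ((contDiff_layerCut δ).differentiable one_ne_zero t).hasDerivAt

theorem continuous_layerKernel (δ : ℝ) : Continuous (layerKernel δ) :=
  (contDiff_layerCut δ).continuous_deriv le_rfl

theorem layerCut_eq_zero {δ t : ℝ} (hδ : 0 < δ) (ht : t ≤ δ) : layerCut δ t = 0 := by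
  refine Real.smoothTransition.zero_of_nonpos ?_
  rw [sub_nonpos, div_le_one hδ]
  exact ht

theorem layerCut_eq_one {δ t : ℝ} (hδ : 0 < δ) (ht : 2 * δ ≤ t) : layerCut δ t = 1 := by
  refine Real.smoothTransition.one_of_one_le ?_
  rw [le_sub_iff_add_le, le_div_iff₀ hδ]
  linarith

theorem abs_layerCut_le (δ t : ℝ) : |layerCut δ t| ≤ 1 := by
  rw [layerCut, abs_of_nonneg (Real.smoothTransition.nonneg _)]
  exact Real.smoothTransition.le_one _

theorem layerKernel_nonneg {δ : ℝ} (hδ : 0 < δ) (t : ℝ) : 0 ≤ layerKernel δ t := by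
  have : Monotone (layerCut δ) := fun a b hab =>
    Real.smoothTransition.monotone (by gcongr)
  exact this.deriv_nonneg

theorem layerKernel_eq_zero {δ t : ℝ} (hδ : 0 < δ) (ht : 2 * δ < t) : layerKernel δ t = 0 := by
  have : layerCut δ =ᶠ[𝓝 t] fun _ => 1 := by
    filter_upwards [lt_mem_nhds ht] with s hs
    exact layerCut_eq_one hδ hs.le
  rw [layerKernel, this.deriv_eq, deriv_const]

theorem integral_layerKernel {δ r : ℝ} (hδ : 0 < δ) (hr : 2 * δ ≤ r) :
    ∫ t in Ioo 0 r, layerKernel δ t = 1 := by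
  rw [← integral_Ioc_eq_integral_Ioo, ← intervalIntegral.integral_of_le (by linarith),
    intervalIntegral.integral_eq_sub_of_hasDerivAt (fun t _ => hasDerivAt_layerCut δ t)
      ((continuous_layerKernel δ).intervalIntegrable _ _),
    layerCut_eq_one hδ hr, layerCut_eq_zero hδ hδ.le, sub_zero]

theorem integrableOn_layerKernel (δ r : ℝ) : IntegrableOn (layerKernel δ) (Ioo 0 r) :=
  ((continuous_layerKernel δ).continuousOn.integrableOn_compact isCompact_Icc).mono_set
    Ioo_subset_Icc_self

theorem integrableOn_layerKernel_mul (δ : ℝ) {r B : ℝ} {g : ℝ → ℝ}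
    (hg : AEStronglyMeasurable g (volume.restrict (Ioo 0 r))) (hB : ∀ t ∈ Ioo 0 r, |g t| ≤ B) :
    IntegrableOn (fun t => layerKernel δ t * g t) (Ioo 0 r) := by
  have hae : ∀ᵐ t ∂(volume.restrict (Ioo 0 r)), ‖g t‖ ≤ B :=
    (ae_restrict_iff' measurableSet_Ioo).2 (ae_of_all _ hB)
  have := (integrableOn_layerKernel δ r).bdd_mul hg hae
  simpa [mul_comm, IntegrableOn] using this

theorem abs_integral_layerKernel_mul_le {δ r B : ℝ} (hδ : 0 < δ) (hr : 2 * δ ≤ r) {g : ℝ → ℝ}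
    (hB : ∀ t ∈ Ioo 0 r, t ≤ 2 * δ → |g t| ≤ B) :
    |∫ t in Ioo 0 r, layerKernel δ t * g t| ≤ B := by
  have h1 : ∀ᵐ t ∂(volume.restrict (Ioo 0 r)), ‖layerKernel δ t * g t‖ ≤ layerKernel δ t * B := by
    refine (ae_restrict_iff' measurableSet_Ioo).2 (ae_of_all _ fun t ht => ?_)
    rcases le_or_gt t (2 * δ) with h | h
    · rw [norm_mul, Real.norm_eq_abs, abs_of_nonneg (layerKernel_nonneg hδ t)]
      exact mul_le_mul_of_nonneg_left (hB t ht h) (layerKernel_nonneg hδ t)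
    · simp [layerKernel_eq_zero hδ h]
  have h2 := norm_integral_le_of_norm_le ((integrableOn_layerKernel δ r).mul_const B) h1
  rwa [integral_mul_const, integral_layerKernel hδ hr, one_mul] at h2

/-- The kernel is nonnegative, has mass 1 once 2δ ≤ r, and sees only t ≤ 2δ, where g is close to its
one-sided limit. -/
theorem tendsto_integral_layerKernel_mul {r B L : ℝ} (hr : 0 < r) {g : ℝ → ℝ}
    (hg : AEStronglyMeasurable g (volume.restrict (Ioo 0 r))) (hB : ∀ t ∈ Ioo 0 r, |g t| ≤ B)
    (hL : Tendsto g (𝓝[>] 0) (𝓝 L)) :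
    Tendsto (fun δ => ∫ t in Ioo 0 r, layerKernel δ t * g t) (𝓝[>] 0) (𝓝 L) := by
  rw [Metric.tendsto_nhds]
  intro e he
  obtain ⟨a, ha, hg1⟩ : ∃ a > 0, ∀ t ∈ Ioo (0 : ℝ) a, |g t - L| ≤ e / 2 := by
    have h1 := (Metric.tendsto_nhds.1 hL) (e / 2) (by linarith)
    obtain ⟨a, ha, h2⟩ := mem_nhdsGT_iff_exists_Ioo_subset.1 h1
    exact ⟨a, ha, fun t ht => (le_of_lt (h2 ht) : dist (g t) L ≤ e / 2)⟩
  filter_upwards [Ioo_mem_nhdsGT (by positivity : 0 < min (a / 2) (r / 2))] with δ hδ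
  have hδa : 2 * δ < a := by linarith [hδ.2.trans_le (min_le_left _ _)]
  have hδr : 2 * δ ≤ r := by linarith [hδ.2.trans_le (min_le_right _ _)]
  have h1 : ∫ t in Ioo 0 r, layerKernel δ t * (g t - L)
      = (∫ t in Ioo 0 r, layerKernel δ t * g t) - L := by
    simp_rw [mul_sub]
    rw [integral_sub (integrableOn_layerKernel_mul δ hg hB)
      ((integrableOn_layerKernel δ r).mul_const L), integral_mul_const,
      integral_layerKernel hδ.1 hδr, one_mul]
  rw [Real.dist_eq, ← h1]
  refine (abs_integral_layerKernel_mul_le (B := e / 2) hδ.1 hδr fun t ht h => ?_).trans_lt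
    (by linarith)
  exact hg1 t ⟨ht.1, h.trans_lt hδa⟩

/-- Fubini reduces this to the one-dimensional limit for each y; the uniform bound B dominates the
inner integrals. A bounded pointwise limit along normals is thus all the boundary regularity that is
needed. -/
theorem tendsto_integral_layer {Y : Type*} [MeasurableSpace Y] {μ : Measure Y} [IsFiniteMeasure μ]
    {r B : ℝ} (hr : 0 < r) {G : Y × ℝ → ℝ} {G₀ : Y → ℝ}
    (hG : AEStronglyMeasurable G (μ.prod (volume.restrict (Ioo 0 r))))
    (hB : ∀ᵐ y ∂μ, ∀ t ∈ Ioo 0 r, |G (y, t)| ≤ B)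
    (hlim : ∀ᵐ y ∂μ, Tendsto (fun t => G (y, t)) (𝓝[>] 0) (𝓝 (G₀ y))) :
    (∀ δ, Integrable (fun p : Y × ℝ => layerKernel δ p.2 * G p)
      (μ.prod (volume.restrict (Ioo 0 r)))) ∧
    Tendsto (fun δ => ∫ p, layerKernel δ p.2 * G p ∂(μ.prod (volume.restrict (Ioo 0 r))))
      (𝓝[>] 0) (𝓝 (∫ y, G₀ y ∂μ)) := by
  have hae : ∀ᵐ p ∂(μ.prod (volume.restrict (Ioo 0 r))), ‖G p‖ ≤ B := by
    have h1 : ∀ᵐ p ∂(μ.prod (volume.restrict (Ioo (0 : ℝ) r))), p.2 ∈ Ioo (0 : ℝ) r :=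
      Measure.quasiMeasurePreserving_snd.ae (ae_restrict_mem measurableSet_Ioo)
    have h2 : ∀ᵐ p ∂(μ.prod (volume.restrict (Ioo (0 : ℝ) r))), ∀ t ∈ Ioo 0 r, |G (p.1, t)| ≤ B :=
      Measure.quasiMeasurePreserving_fst.ae hB
    filter_upwards [h1, h2] with p hp1 hp2
    exact hp2 p.2 hp1
  have hintg : ∀ δ, Integrable (fun p : Y × ℝ => layerKernel δ p.2 * G p)
      (μ.prod (volume.restrict (Ioo 0 r))) := by
    intro δ
    have h1 : Integrable (fun p : Y × ℝ => layerKernel δ p.2)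
        (μ.prod (volume.restrict (Ioo 0 r))) := by
      simpa using (integrable_const (1 : ℝ) (μ := μ)).mul_prod (integrableOn_layerKernel δ r)
    simpa [mul_comm] using h1.bdd_mul hG hae
  refine ⟨hintg, ?_⟩
  have hsec : ∀ᵐ y ∂μ, AEStronglyMeasurable (fun t => G (y, t)) (volume.restrict (Ioo 0 r)) :=
    hG.prodMk_left
  have hF : ∀ δ, ∫ p, layerKernel δ p.2 * G p ∂(μ.prod (volume.restrict (Ioo 0 r)))
      = ∫ y, (∫ t in Ioo 0 r, layerKernel δ t * G (y, t)) ∂μ := fun δ =>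
    integral_prod _ (hintg δ)
  simp_rw [hF]
  refine tendsto_integral_filter_of_dominated_convergence (fun _ => B) ?_ ?_
    (integrable_const B) ?_
  · exact Eventually.of_forall fun δ => (hintg δ).aestronglyMeasurable.integral_prod_right'
  · filter_upwards [Ioo_mem_nhdsGT (by positivity : 0 < r / 2)] with δ hδ
    filter_upwards [hB] with y hy
    exact abs_integral_layerKernel_mul_le hδ.1 (by linarith [hδ.2]) fun t ht _ => hy t ht
  · filter_upwards [hB, hlim, hsec] with y h1 h2 h3
    exact tendsto_integral_layerKernel_mul hr h3 h1 h2

end Layer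

/-! ### The volume and surface measures of a collar against those of its model. -/

namespace CollarChart

variable {E : Type*} [NormedAddCommGroup E] [InnerProductSpace ℝ E] [CompleteSpace E]
  [FiniteDimensional ℝ E] [MeasurableSpace E] [BorelSpace E]
  {Ω : Set E} {ν : E → E} {z₀ : E} {η : ℝ} (C : CollarChart Ω ν z₀ η)

/-- The neighborhood of `z₀` covered by the chart. -/
def img : Set E := C.Ψ '' (Metric.ball 0 C.r ×ˢ Ioo (-C.r) C.r)

theorem isOpen_img : IsOpen C.img := C.isOpen_image

theorem zero_mem : (0 : ℝ) ∈ Ioo (-C.r) C.r := ⟨by linarith [C.r_pos], C.r_pos⟩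

theorem pos_mem {t : ℝ} (ht : t ∈ Ioo 0 C.r) : t ∈ Ioo (-C.r) C.r :=
  ⟨by linarith [C.r_pos, ht.1], ht.2⟩

theorem mem_img {y : C.T} (hy : y ∈ Metric.ball 0 C.r) {t : ℝ} (ht : t ∈ Ioo (-C.r) C.r) :
    C.Ψ (y, t) ∈ C.img := ⟨(y, t), ⟨hy, ht⟩, rfl⟩

theorem center_mem_img : z₀ ∈ C.img := by
  have := C.mem_img (Metric.mem_ball_self C.r_pos) C.zero_mem
  rwa [C.map_zero] at this

theorem img_inter_eq : C.img ∩ Ω = C.Ψ '' (Metric.ball 0 C.r ×ˢ Ioo 0 C.r) := by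
  ext x
  constructor
  · rintro ⟨⟨⟨y, t⟩, ⟨hy, ht⟩, rfl⟩, hx⟩
    exact ⟨(y, t), ⟨hy, (C.mem_iff y hy t ht).1 hx, ht.2⟩, rfl⟩
  · rintro ⟨⟨y, t⟩, ⟨hy, ht⟩, rfl⟩
    exact ⟨C.mem_img hy (C.pos_mem ht), (C.mem_iff y hy t (C.pos_mem ht)).2 ht.1⟩

theorem img_inter_frontier_eq :
    C.img ∩ frontier Ω = (fun y => C.Ψ (y, 0)) '' Metric.ball 0 C.r := by
  ext x
  constructor
  · rintro ⟨⟨⟨y, t⟩, ⟨hy, ht⟩, rfl⟩, hx⟩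
    obtain rfl := (C.mem_frontier_iff y hy t ht).1 hx
    exact ⟨y, hy, rfl⟩
  · rintro ⟨y, hy, rfl⟩
    exact ⟨C.mem_img hy C.zero_mem, (C.mem_frontier_iff y hy 0 C.zero_mem).2 rfl⟩

theorem continuousOn_pos : ContinuousOn C.Ψ (Metric.ball 0 C.r ×ˢ Ioo 0 C.r) :=
  C.continuousOn.mono (prod_mono_right fun _ ht => C.pos_mem ht)

theorem continuousOn_base : ContinuousOn (fun y => C.Ψ (y, 0)) (Metric.ball 0 C.r) :=
  C.continuousOn.comp (by fun_prop) fun _ hy => ⟨hy, C.zero_mem⟩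

/-- The Lebesgue measure of the model collar. -/
def model : Measure (C.T × ℝ) :=
  (volume.restrict (Metric.ball (0 : C.T) C.r)).prod (volume.restrict (Ioo 0 C.r))

theorem model_eq : C.model = volume.restrict (Metric.ball (0 : C.T) C.r ×ˢ Ioo 0 C.r) :=
  Measure.prod_restrict _ _

theorem measurableSet_dom : MeasurableSet (Metric.ball (0 : C.T) C.r ×ˢ Ioo 0 C.r) :=
  measurableSet_ball.prod measurableSet_Ioo

theorem aemeasurable_model : AEMeasurable C.Ψ C.model := by
  rw [C.model_eq]
  exact C.continuousOn_pos.aemeasurable C.measurableSet_dom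

theorem aemeasurable_base :
    AEMeasurable (fun y => C.Ψ (y, 0)) (volume.restrict (Metric.ball (0 : C.T) C.r)) :=
  C.continuousOn_base.aemeasurable measurableSet_ball

theorem map_model_apply {s : Set E} (hs : MeasurableSet s) :
    C.model.map C.Ψ s = volume (C.Ψ ⁻¹' s ∩ (Metric.ball (0 : C.T) C.r ×ˢ Ioo 0 C.r)) := by
  rw [Measure.map_apply_of_aemeasurable C.aemeasurable_model hs, C.model_eq,
    Measure.restrict_apply' C.measurableSet_dom]

theorem map_base_apply {s : Set E} (hs : MeasurableSet s) :
    (volume.restrict (Metric.ball (0 : C.T) C.r)).map (fun y => C.Ψ (y, 0)) s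
      = volume ((fun y => C.Ψ (y, 0)) ⁻¹' s ∩ Metric.ball (0 : C.T) C.r) := by
  rw [Measure.map_apply_of_aemeasurable C.aemeasurable_base hs,
    Measure.restrict_apply' measurableSet_ball]

theorem dom_subset : Metric.ball (0 : C.T) C.r ×ˢ Ioo 0 C.r ⊆ Metric.ball 0 C.r ×ˢ Ioo (-C.r) C.r :=
  prod_mono_right fun _ ht => C.pos_mem ht

/-- This and the next three bounds turn the set-wise distortion of the chart into inequalities of
measures, the form required by `abs_integral_sub_integral_le`. -/
theorem volume_le_map :
    volume.restrict (C.img ∩ Ω) ≤ ENNReal.ofReal (1 + η) • C.model.map C.Ψ := by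
  refine Measure.le_iff.2 fun s hs => ?_
  rw [Measure.restrict_apply hs, Measure.smul_apply, C.map_model_apply hs, C.img_inter_eq,
    inter_comm, ← image_inter_preimage, inter_comm]
  exact C.volume_image_le _ (inter_subset_right.trans C.dom_subset)

theorem map_le_volume :
    C.model.map C.Ψ ≤ ENNReal.ofReal (1 + η) • volume.restrict (C.img ∩ Ω) := by
  refine Measure.le_iff.2 fun s hs => ?_
  rw [Measure.smul_apply, Measure.restrict_apply hs, C.map_model_apply hs, C.img_inter_eq,
    inter_comm s, ← image_inter_preimage, inter_comm (Metric.ball (0 : C.T) C.r ×ˢ Ioo 0 C.r)]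
  exact C.volume_le_image _ (inter_subset_right.trans C.dom_subset)

theorem surface_le_map :
    (μHE[Module.finrank ℝ E - 1] : Measure E).restrict (C.img ∩ frontier Ω)
      ≤ ENNReal.ofReal (1 + η) •
        (volume.restrict (Metric.ball (0 : C.T) C.r)).map (fun y => C.Ψ (y, 0)) := by
  refine Measure.le_iff.2 fun s hs => ?_
  rw [Measure.restrict_apply hs, Measure.smul_apply, C.map_base_apply hs,
    C.img_inter_frontier_eq, inter_comm, ← image_inter_preimage, inter_comm]
  exact C.surface_image_le _ inter_subset_right

theorem map_le_surface :
    (volume.restrict (Metric.ball (0 : C.T) C.r)).map (fun y => C.Ψ (y, 0))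
      ≤ ENNReal.ofReal (1 + η) •
        (μHE[Module.finrank ℝ E - 1] : Measure E).restrict (C.img ∩ frontier Ω) := by
  refine Measure.le_iff.2 fun s hs => ?_
  rw [Measure.smul_apply, Measure.restrict_apply hs, C.map_base_apply hs,
    C.img_inter_frontier_eq, inter_comm s, ← image_inter_preimage,
    inter_comm (Metric.ball (0 : C.T) C.r)]
  exact C.surface_le_image _ inter_subset_right

theorem surface_lt_top :
    (μHE[Module.finrank ℝ E - 1] : Measure E) (C.img ∩ frontier Ω) < ⊤ := by
  rw [C.img_inter_frontier_eq]
  exact (C.surface_image_le _ Subset.rfl).trans_lt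
    (ENNReal.mul_lt_top ENNReal.ofReal_lt_top measure_ball_lt_top)

end CollarChart

/-! ### Gradients, normal traces, and the Gauss–Green estimate in one collar. -/

section Green

variable {E : Type*} [NormedAddCommGroup E] [InnerProductSpace ℝ E] [CompleteSpace E]

theorem continuous_gradient {φ : E → ℝ} (hφ : ContDiff ℝ 1 φ) : Continuous (∇ φ) :=
  continuous_iff_continuousAt.2 fun _ =>
    (contDiffAt_gradient (m := 0) hφ.contDiffAt (by norm_num)).continuousAt

theorem continuousOn_gradient {φ : E → ℝ} {s : Set E} (hs : IsOpen s) (hφ : ContDiffOn ℝ 1 φ s) :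
    ContinuousOn (∇ φ) s := fun x hx =>
  (contDiffAt_gradient (m := 0) ((hφ x hx).contDiffAt (hs.mem_nhds hx))
    (by norm_num)).continuousAt.continuousWithinAt

theorem gradient_eq_zero_of_notMem_tsupport {φ : E → ℝ} {x : E} (hx : x ∉ tsupport φ) :
    ∇ φ x = 0 := by
  have h : φ =ᶠ[𝓝 x] fun _ => 0 := notMem_tsupport_iff_eventuallyEq.1 hx
  have h2 : HasGradientAt φ 0 x := by
    rw [hasGradientAt_iff_hasFDerivAt, map_zero]
    exact (hasFDerivAt_const (0 : ℝ) x).congr_of_eventuallyEq h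
  exact h2.gradient

theorem hasGradientAt_mul {u v : E → ℝ} {x : E} (hu : DifferentiableAt ℝ u x)
    (hv : DifferentiableAt ℝ v x) :
    HasGradientAt (fun y => u y * v y) (u x • ∇ v x + v x • ∇ u x) x := by
  rw [hasGradientAt_iff_hasFDerivAt]
  refine (hu.hasGradientAt.hasFDerivAt.mul hv.hasGradientAt.hasFDerivAt).congr_fderiv ?_
  simp

theorem gradient_mul {u v : E → ℝ} {x : E} (hu : DifferentiableAt ℝ u x)
    (hv : DifferentiableAt ℝ v x) :
    ∇ (fun y => u y * v y) x = u x • ∇ v x + v x • ∇ u x :=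
  (hasGradientAt_mul hu hv).gradient

theorem gradient_comp {g : ℝ → ℝ} {g' : ℝ} {u : E → ℝ} {x : E} (hg : HasDerivAt g g' (u x))
    (hu : DifferentiableAt ℝ u x) : ∇ (fun y => g (u y)) x = g' • ∇ u x := by
  refine HasGradientAt.gradient ?_
  rw [hasGradientAt_iff_hasFDerivAt]
  refine (hg.comp_hasFDerivAt x hu.hasGradientAt.hasFDerivAt).congr_fderiv ?_
  simp

/-- Cutting off by φ makes functions that are C¹ only on an open set, such as the potentials and the
normal coordinate, admissible in test functions. -/
theorem contDiff_mul_of_tsupport_subset {φ u : E → ℝ} {s : Set E} (hs : IsOpen s)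
    (hφ : ContDiff ℝ 1 φ) (hsupp : tsupport φ ⊆ s) (hu : ContDiffOn ℝ 1 u s) :
    ContDiff ℝ 1 fun x => φ x * u x := by
  rw [contDiff_iff_contDiffAt]
  intro x
  by_cases hx : x ∈ tsupport φ
  · exact hφ.contDiffAt.mul ((hu x (hsupp hx)).contDiffAt (hs.mem_nhds (hsupp hx)))
  · have h : φ =ᶠ[𝓝 x] fun _ => 0 := notMem_tsupport_iff_eventuallyEq.1 hx
    have h2 : (fun x => φ x * u x) =ᶠ[𝓝 x] fun _ => 0 := by
      filter_upwards [h] with y hy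
      simp [hy]
    exact contDiffAt_const.congr_of_eventuallyEq h2

theorem gradient_mul_of_tsupport_subset {φ u : E → ℝ} {s : Set E} (hs : IsOpen s)
    (hφ : ContDiff ℝ 1 φ) (hsupp : tsupport φ ⊆ s) (hu : ContDiffOn ℝ 1 u s) (x : E) :
    ∇ (fun x => φ x * u x) x = φ x • ∇ u x + u x • ∇ φ x := by
  by_cases hx : x ∈ tsupport φ
  · exact gradient_mul (hφ.differentiable one_ne_zero x)
      (((hu x (hsupp hx)).contDiffAt (hs.mem_nhds (hsupp hx))).differentiableAt one_ne_zero)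
  · have h2 : x ∉ tsupport fun x => φ x * u x := fun h => hx (closure_mono (by
      intro y hy h0
      exact hy (by simp [h0])) h)
    rw [gradient_eq_zero_of_notMem_tsupport hx, gradient_eq_zero_of_notMem_tsupport h2,
      image_eq_zero_of_notMem_tsupport hx]
    simp

variable [FiniteDimensional ℝ E] [MeasurableSpace E] [BorelSpace E]

/-- The vector field `X`, continuous in the open set `Ω`, has the normal trace `q` on the boundary
of `Ω`, as a bounded pointwise limit along the normals. -/
structure HasNormalTrace (Ω : Set E) (ν : E → E) (X : E → E) (q : E → ℝ) : Prop where
  continuousOn : ContinuousOn X Ω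
  integrableOn : ∀ K, IsCompact K → IntegrableOn X (Ω ∩ K)
  tendsto : ∀ z ∈ frontier Ω,
    Tendsto (fun δ : ℝ => inner ℝ (X (z - δ • ν z)) (ν z)) (𝓝[>] 0) (𝓝 (q z))
  bounded : ∃ M δ₀ : ℝ, 0 < δ₀ ∧ ∀ z ∈ frontier Ω, ∀ δ ∈ Ioo 0 δ₀,
    |inner ℝ (X (z - δ • ν z)) (ν z)| ≤ M

/-- The divergence of `X` in the open set `Ω` is `f`, in the weak sense. -/
def HasWeakDiv (Ω : Set E) (X : E → E) (f : E → ℝ) : Prop :=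
  ∀ φ : E → ℝ, ContDiff ℝ 1 φ → HasCompactSupport φ → tsupport φ ⊆ Ω →
    ∫ x in Ω, (inner ℝ (X x) (∇ φ x) + f x * φ x) = 0

theorem HasNormalTrace.integrableOn_inner {Ω : Set E} {ν : E → E} {X : E → E} {q : E → ℝ}
    (hX : HasNormalTrace Ω ν X q) (hΩ : IsOpen Ω) {φ : E → ℝ} (hφ : ContDiff ℝ 1 φ)
    (hc : HasCompactSupport φ) : IntegrableOn (fun x => inner ℝ (X x) (∇ φ x)) Ω := by
  have h0 : ∀ x ∈ Ω \ (Ω ∩ tsupport φ), inner ℝ (X x) (∇ φ x) = 0 := by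
    rintro x ⟨hx, hx2⟩
    rw [gradient_eq_zero_of_notMem_tsupport fun h => hx2 ⟨hx, h⟩, inner_zero_right]
  have hgc := continuous_gradient hφ
  obtain ⟨B, hB⟩ := hc.exists_bound_of_continuousOn hgc.continuousOn
  have hm : MeasurableSet (Ω ∩ tsupport φ) :=
    hΩ.measurableSet.inter (isClosed_tsupport φ).measurableSet
  have h1 : IntegrableOn (fun x => inner ℝ (X x) (∇ φ x)) (Ω ∩ tsupport φ) := by
    have hi := hX.integrableOn _ hc
    refine Integrable.mono' (hi.norm.mul_const B)
      (hi.aestronglyMeasurable.inner hgc.aestronglyMeasurable) ?_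
    refine (ae_restrict_iff' hm).2 (ae_of_all _ fun x hx => ?_)
    exact (norm_inner_le_norm _ _).trans (by gcongr; exact hB x hx.2)
  exact h1.of_forall_sdiff_eq_zero hΩ.measurableSet h0

theorem integrableOn_mul_of_hasCompactSupport {Ω : Set E} {f : E → ℝ} (hf : IntegrableOn f Ω)
    {φ : E → ℝ} (hφ : Continuous φ) (hc : HasCompactSupport φ) :
    IntegrableOn (fun x => f x * φ x) Ω := by
  obtain ⟨B, hB⟩ := hφ.bounded_above_of_compact_support hc
  exact hf.mul_bdd hφ.aestronglyMeasurable (ae_of_all _ hB)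

theorem HasNormalTrace.abs_le {Ω : Set E} {ν : E → E} {X : E → E} {q : E → ℝ}
    (hX : HasNormalTrace Ω ν X q) {M δ₀ : ℝ} (hδ₀ : 0 < δ₀)
    (hM : ∀ z ∈ frontier Ω, ∀ δ ∈ Ioo 0 δ₀, |inner ℝ (X (z - δ • ν z)) (ν z)| ≤ M)
    {z : E} (hz : z ∈ frontier Ω) : |q z| ≤ M := by
  refine le_of_tendsto (hX.tendsto z hz).abs ?_
  filter_upwards [Ioo_mem_nhdsGT hδ₀] with δ hδ
  exact hM z hz δ hδ

namespace CollarChart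

variable {Ω : Set E} {ν : E → E} {z₀ : E} {η : ℝ} (C : CollarChart Ω ν z₀ η)

/-- The trace is a pointwise limit of the normal components at fixed depths, each of which is
continuous on this part of the boundary. -/
theorem aestronglyMeasurable_trace {X : E → E} {q : E → ℝ} (hX : HasNormalTrace Ω ν X q)
    (μ : Measure E) : AEStronglyMeasurable q (μ.restrict (C.img ∩ frontier Ω)) := by
  have hm : MeasurableSet (C.img ∩ frontier Ω) :=
    C.isOpen_img.measurableSet.inter isClosed_frontier.measurableSet
  let d : ℕ → ℝ := fun k => C.r / (k + 2)
  have hd : ∀ k, d k ∈ Ioo 0 C.r := by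
    intro k
    have := C.r_pos
    refine ⟨by positivity, ?_⟩
    rw [div_lt_iff₀ (by positivity)]
    nlinarith [(Nat.cast_nonneg k : (0 : ℝ) ≤ k)]
  have hd0 : Tendsto d atTop (𝓝[>] 0) := by
    refine tendsto_nhdsWithin_iff.2 ⟨?_, Eventually.of_forall fun k => (hd k).1⟩
    refine tendsto_const_nhds.div_atTop ?_
    exact tendsto_atTop_add_const_right _ _ tendsto_natCast_atTop_atTop
  refine aestronglyMeasurable_of_tendsto_ae atTop
    (f := fun k z => inner ℝ (X (z - d k • ν z)) (ν z)) (fun k => ?_) ?_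
  · refine ContinuousOn.aestronglyMeasurable ?_ hm
    have hν := C.continuousOn_normal
    refine ContinuousOn.inner (hX.continuousOn.comp
      (continuousOn_id.sub (hν.const_smul (d k))) ?_) hν
    intro z hz
    rw [C.img_inter_frontier_eq] at hz
    obtain ⟨y, hy, rfl⟩ := hz
    have := C.apply_eq y hy (d k) (C.pos_mem (hd k))
    simp only
    rw [← this]
    exact (C.mem_iff y hy _ (C.pos_mem (hd k))).2 (hd k).1
  · refine (ae_restrict_iff' hm).2 (ae_of_all _ fun z hz => ?_)
    exact (hX.tendsto z hz.2).comp hd0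

/-- The weak divergence is tested with φ times a cut-off of the normal coordinate τ. The gradient of
the cut-off yields an average of φ X·ν over a thin layer, since −∇τ is the normal at the foot point;
in the model this average tends to the integral of φq. The error is of the form η∫|φ|, so it can be
summed over a partition of unity. -/
theorem abs_green_sub_le (hη : 0 < η) (hη1 : η ≤ 1) (hΩ : IsOpen Ω) {X : E → E} {q f : E → ℝ}
    (hX : HasNormalTrace Ω ν X q) (hf : IntegrableOn f Ω) (hdiv : HasWeakDiv Ω X f)
    {M δ₀ : ℝ} (hδ₀ : 0 < δ₀) (hr : C.r ≤ δ₀)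
    (hM : ∀ z ∈ frontier Ω, ∀ δ ∈ Ioo 0 δ₀, |inner ℝ (X (z - δ • ν z)) (ν z)| ≤ M)
    {φ : E → ℝ} (hφ : ContDiff ℝ 1 φ) (hc : HasCompactSupport φ) (hs : tsupport φ ⊆ C.img) :
    |(∫ x in Ω, (inner ℝ (X x) (∇ φ x) + f x * φ x))
      - ∫ z in frontier Ω, φ z * q z ∂μHE[Module.finrank ℝ E - 1]|
      ≤ 8 * η * M * ∫ z in frontier Ω, |φ z| ∂μHE[Module.finrank ℝ E - 1] := by
  set σ : Measure E := μHE[Module.finrank ℝ E - 1] with hσ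
  have hmI : MeasurableSet (C.img ∩ Ω) := C.isOpen_img.measurableSet.inter hΩ.measurableSet
  have hmF : MeasurableSet (C.img ∩ frontier Ω) :=
    C.isOpen_img.measurableSet.inter isClosed_frontier.measurableSet
  have hφ0 : ∀ x ∉ C.img, φ x = 0 := fun x hx =>
    image_eq_zero_of_notMem_tsupport fun h => hx (hs h)
  have hgφ0 : ∀ x ∉ C.img, ∇ φ x = 0 := fun x hx =>
    gradient_eq_zero_of_notMem_tsupport fun h => hx (hs h)
  obtain ⟨S, hS⟩ := hφ.continuous.bounded_above_of_compact_support hc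
  have hM0 : ∀ z ∈ frontier Ω, |q z| ≤ M := fun z hz => hX.abs_le hδ₀ hM hz
  -- the functions on the model collar
  let g : C.T → E := fun y => C.Ψ (y, 0)
  let G : C.T × ℝ → ℝ := fun p => φ (C.Ψ p) * inner ℝ (X (C.Ψ p)) (ν (g p.1))
  have hgν : ContinuousOn (fun y => ν (g y)) (Metric.ball 0 C.r) :=
    C.continuousOn_normal.comp C.continuousOn_base fun y hy => by
      change g y ∈ C.img ∩ frontier Ω
      rw [C.img_inter_frontier_eq]; exact ⟨y, hy, rfl⟩
  have hgF : ∀ y ∈ Metric.ball (0 : C.T) C.r, g y ∈ frontier Ω := fun y hy =>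
    (C.mem_frontier_iff y hy 0 C.zero_mem).2 rfl
  have hGc : ContinuousOn G (Metric.ball 0 C.r ×ˢ Ioo 0 C.r) := by
    refine (hφ.continuous.comp_continuousOn C.continuousOn_pos).mul
      (ContinuousOn.inner (hX.continuousOn.comp C.continuousOn_pos ?_)
        (hgν.comp continuousOn_fst fun p hp => hp.1))
    rintro ⟨y, t⟩ ⟨hy, ht⟩
    exact (C.mem_iff y hy t (C.pos_mem ht)).2 ht.1
  have hGm : AEStronglyMeasurable G C.model := by
    rw [C.model_eq]
    exact hGc.aestronglyMeasurable C.measurableSet_dom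
  have hGeq : ∀ y ∈ Metric.ball (0 : C.T) C.r, ∀ t ∈ Ioo 0 C.r,
      G (y, t) = φ (C.Ψ (y, t)) * inner ℝ (X (g y - t • ν (g y))) (ν (g y)) := by
    intro y hy t ht
    simp only [G]
    rw [C.apply_eq y hy t (C.pos_mem ht)]
  have hS0 : 0 ≤ S := (norm_nonneg _).trans (hS z₀)
  have hGb : ∀ᵐ y ∂(volume.restrict (Metric.ball (0 : C.T) C.r)), ∀ t ∈ Ioo 0 C.r,
      |G (y, t)| ≤ S * M := by
    refine (ae_restrict_iff' measurableSet_ball).2 (ae_of_all _ fun y hy t ht => ?_)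
    rw [hGeq y hy t ht, abs_mul]
    exact mul_le_mul (hS _) (hM _ (hgF y hy) t ⟨ht.1, ht.2.trans_le hr⟩) (abs_nonneg _) hS0
  have hGl : ∀ᵐ y ∂(volume.restrict (Metric.ball (0 : C.T) C.r)),
      Tendsto (fun t => G (y, t)) (𝓝[>] 0) (𝓝 (φ (g y) * q (g y))) := by
    refine (ae_restrict_iff' measurableSet_ball).2 (ae_of_all _ fun y hy => ?_)
    have h1 : Tendsto (fun t : ℝ => C.Ψ (y, t)) (𝓝[>] 0) (𝓝 (g y)) := by
      have ho : IsOpen (Metric.ball (0 : C.T) C.r ×ˢ Ioo (-C.r) C.r) :=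
        Metric.isOpen_ball.prod isOpen_Ioo
      have h3 : ContinuousAt C.Ψ (y, 0) :=
        C.continuousOn.continuousAt (ho.mem_nhds ⟨hy, C.zero_mem⟩)
      have h4 : Continuous fun s : ℝ => (y, s) := by fun_prop
      exact (h3.tendsto.comp (h4.tendsto 0)).mono_left nhdsWithin_le_nhds
    have h2 := ((hφ.continuous.tendsto _).comp h1).mul (hX.tendsto _ (hgF y hy))
    refine h2.congr' ?_
    filter_upwards [Ioo_mem_nhdsGT C.r_pos] with t ht
    rw [hGeq y hy t ht]; rfl
  have : IsFiniteMeasure (volume.restrict (Metric.ball (0 : C.T) C.r)) :=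
    ⟨by rw [Measure.restrict_apply_univ]; exact measure_ball_lt_top⟩
  obtain ⟨hintg, hlim⟩ := tendsto_integral_layer C.r_pos hGm hGb hGl
  obtain ⟨-, hlim'⟩ := tendsto_integral_layer C.r_pos (G := fun p => |G p|) (B := S * M)
    hGm.norm (by simpa using hGb) (hGl.mono fun y hy => hy.abs)
  -- the functions on the collar
  let F : ℝ → E → ℝ := fun δ x => layerKernel δ (C.τ x) * (φ x * inner ℝ (X x) (- ∇ C.τ x))
  have hτc : ContinuousOn C.τ (C.img ∩ Ω) := C.contDiffOn_τ.continuousOn.mono inter_subset_left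
  have hgτ : ContinuousOn (∇ C.τ) (C.img ∩ Ω) :=
    (continuousOn_gradient C.isOpen_img C.contDiffOn_τ).mono inter_subset_left
  have hFm : ∀ δ, AEStronglyMeasurable (F δ) (volume.restrict (C.img ∩ Ω)) := by
    intro δ
    refine ContinuousOn.aestronglyMeasurable ?_ hmI
    exact ((continuous_layerKernel δ).comp_continuousOn hτc).mul (hφ.continuous.continuousOn.mul
      (ContinuousOn.inner (hX.continuousOn.mono inter_subset_right) hgτ.neg))
  have hac : C.model.map C.Ψ ≪ volume.restrict (C.img ∩ Ω) :=
    (Measure.absolutelyContinuous_of_le C.map_le_volume).trans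
      (Measure.AbsolutelyContinuous.rfl.smul_left _)
  have hFm' : ∀ δ, AEStronglyMeasurable (F δ) (C.model.map C.Ψ) := fun δ =>
    (hFm δ).mono_ac hac
  have hFΨ : ∀ δ, (fun p => F δ (C.Ψ p)) =ᵐ[C.model] fun p => layerKernel δ p.2 * G p := by
    intro δ
    rw [C.model_eq]
    refine (ae_restrict_iff' C.measurableSet_dom).2 (ae_of_all _ ?_)
    rintro ⟨y, t⟩ ⟨hy, ht⟩
    simp only [F, G]
    rw [C.τ_apply y hy t (C.pos_mem ht), C.gradient_τ y hy t (C.pos_mem ht), neg_neg]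
  have hFi : ∀ δ, Integrable (F δ) (C.model.map C.Ψ) := fun δ =>
    (integrable_map_measure (hFm' δ) C.aemeasurable_model).2 ((hintg δ).congr (hFΨ δ).symm)
  have hFvol : ∀ δ, IntegrableOn (F δ) (C.img ∩ Ω) := fun δ =>
    ((hFi δ).smul_measure ENNReal.ofReal_ne_top).mono_measure C.volume_le_map
  have hFint : ∀ δ, ∫ x, F δ x ∂(C.model.map C.Ψ) = ∫ p, layerKernel δ p.2 * G p ∂C.model :=
    fun δ => by
      rw [integral_map C.aemeasurable_model (hFm' δ)]
      exact integral_congr_ae (hFΨ δ)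
  have hFabs : ∀ δ, 0 < δ →
      ∫ x, |F δ x| ∂(C.model.map C.Ψ) = ∫ p, layerKernel δ p.2 * |G p| ∂C.model := by
    intro δ hδ
    have h1 := integral_map C.aemeasurable_model (hFm' δ).norm
    simp only [Real.norm_eq_abs] at h1
    rw [h1]
    refine integral_congr_ae ?_
    filter_upwards [hFΨ δ] with p hp
    rw [hp, abs_mul, abs_of_nonneg (layerKernel_nonneg hδ _)]
  -- the tested equation
  let H : E → ℝ := fun x => inner ℝ (X x) (∇ φ x) + f x * φ x
  have hHi : IntegrableOn H Ω := (hX.integrableOn_inner hΩ hφ hc).add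
    (integrableOn_mul_of_hasCompactSupport hf hφ.continuous hc)
  have hH0 : ∀ x ∈ Ω \ (C.img ∩ Ω), H x = 0 := by
    rintro x ⟨hx, hx2⟩
    have : x ∉ C.img := fun h => hx2 ⟨h, hx⟩
    simp only [H]
    rw [hφ0 x this, hgφ0 x this, inner_zero_right, mul_zero, add_zero]
  have hHI : ∫ x in Ω, H x = ∫ x in C.img ∩ Ω, H x :=
    (setIntegral_eq_of_subset_of_forall_sdiff_eq_zero hΩ.measurableSet inter_subset_right hH0)
  have hcutc : ∀ δ, ContinuousOn (fun x => layerCut δ (C.τ x)) (C.img ∩ Ω) := fun δ =>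
    (contDiff_layerCut δ).continuous.comp_continuousOn hτc
  have hHcut : ∀ δ, IntegrableOn (fun x => H x * layerCut δ (C.τ x)) (C.img ∩ Ω) := fun δ =>
    (hHi.mono_set inter_subset_right).mul_bdd (c := 1)
      ((hcutc δ).aestronglyMeasurable hmI) (ae_of_all _ fun x => abs_layerCut_le δ _)
  have htest : ∀ δ, 0 < δ →
      ∫ x in C.img ∩ Ω, F δ x = ∫ x in C.img ∩ Ω, H x * layerCut δ (C.τ x) := by
    intro δ hδ
    have hcut : ContDiffOn ℝ 1 (fun x => layerCut δ (C.τ x)) C.img :=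
      (contDiff_layerCut δ).comp_contDiffOn C.contDiffOn_τ
    have h1 := contDiff_mul_of_tsupport_subset C.isOpen_img hφ hs hcut
    -- The product is supported where τ ≥ δ > 0, which keeps it off the boundary and makes it a
    -- legitimate test function in Ω.
    have hsub : (tsupport fun x => φ x * layerCut δ (C.τ x)) ⊆ tsupport φ ∩ Ω := by
      have hτs : ContinuousOn C.τ (tsupport φ) := C.contDiffOn_τ.continuousOn.mono hs
      have hcl : IsClosed (tsupport φ ∩ C.τ ⁻¹' Ici δ) :=
        hτs.preimage_isClosed_of_isClosed (isClosed_tsupport φ) isClosed_Ici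
      refine (closure_minimal (fun x hx => ?_) hcl).trans fun x hx => ⟨hx.1, ?_⟩
      · have hx1 : φ x ≠ 0 := fun h => hx (by simp [h])
        refine ⟨subset_tsupport φ hx1, ?_⟩
        by_contra h
        exact hx (by simp [layerCut_eq_zero hδ (le_of_lt (not_le.1 h))])
      · obtain ⟨⟨y, t⟩, ⟨hy, ht⟩, rfl⟩ := hs hx.1
        have h2 : δ ≤ C.τ (C.Ψ (y, t)) := hx.2
        rw [C.τ_apply y hy t ht] at h2
        exact (C.mem_iff y hy t ht).2 (hδ.trans_le h2)
    have h2 := hdiv _ h1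
      (hc.of_isClosed_subset (isClosed_tsupport _) (hsub.trans inter_subset_left))
      (hsub.trans inter_subset_right)
    have h3 : ∀ x ∈ C.img ∩ Ω, inner ℝ (X x) (∇ (fun x => φ x * layerCut δ (C.τ x)) x)
        + f x * (φ x * layerCut δ (C.τ x)) = H x * layerCut δ (C.τ x) - F δ x := by
      intro x hx
      rw [gradient_mul_of_tsupport_subset C.isOpen_img hφ hs hcut,
        gradient_comp (hasDerivAt_layerCut δ (C.τ x)) (((C.contDiffOn_τ x hx.1).contDiffAt
          (C.isOpen_img.mem_nhds hx.1)).differentiableAt one_ne_zero)]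
      simp only [H, F, inner_add_right, inner_smul_right, inner_neg_right]
      ring
    have h4 : ∀ x ∈ Ω \ (C.img ∩ Ω),
        inner ℝ (X x) (∇ (fun x => φ x * layerCut δ (C.τ x)) x)
        + f x * (φ x * layerCut δ (C.τ x)) = 0 := by
      rintro x ⟨hx, hx2⟩
      have : x ∉ C.img := fun h => hx2 ⟨h, hx⟩
      rw [gradient_mul_of_tsupport_subset C.isOpen_img hφ hs hcut, hφ0 x this, hgφ0 x this]
      simp
    rw [setIntegral_eq_of_subset_of_forall_sdiff_eq_zero hΩ.measurableSet inter_subset_right h4,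
      setIntegral_congr_fun hmI h3, integral_sub (hHcut δ) (hFvol δ)] at h2
    linarith
  have hcutlim : Tendsto (fun δ => ∫ x in C.img ∩ Ω, H x * layerCut δ (C.τ x)) (𝓝[>] 0)
      (𝓝 (∫ x in C.img ∩ Ω, H x)) := by
    refine tendsto_integral_filter_of_dominated_convergence (fun x => ‖H x‖)
      (Eventually.of_forall fun δ => (hHcut δ).aestronglyMeasurable)
      (Eventually.of_forall fun δ => ae_of_all _ fun x => ?_)
      (hHi.mono_set inter_subset_right).norm ?_
    · rw [norm_mul]
      exact mul_le_of_le_one_right (norm_nonneg _) (abs_layerCut_le δ _)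
    · refine (ae_restrict_iff' hmI).2 (ae_of_all _ fun x hx => ?_)
      have hpos : 0 < C.τ x := by
        rw [C.img_inter_eq] at hx
        obtain ⟨⟨y, t⟩, ⟨hy, ht⟩, rfl⟩ := hx
        rw [C.τ_apply y hy t (C.pos_mem ht)]
        exact ht.1
      refine tendsto_const_nhds.congr' ?_
      filter_upwards [Ioo_mem_nhdsGT (by positivity : 0 < C.τ x / 2)] with δ hδ
      rw [layerCut_eq_one hδ.1 (by linarith [hδ.2]), mul_one]
  -- comparison of the volumes
  have hcmp : |(∫ x in Ω, H x) - ∫ y in Metric.ball (0 : C.T) C.r, φ (g y) * q (g y)|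
      ≤ 2 * η * ∫ y in Metric.ball (0 : C.T) C.r, |φ (g y) * q (g y)| := by
    rw [hHI]
    refine le_of_tendsto_of_tendsto (hcutlim.sub hlim).abs (hlim'.const_mul (2 * η)) ?_
    filter_upwards [self_mem_nhdsWithin] with δ hδ
    have h1 := abs_integral_sub_integral_le hη.le hη1 C.volume_le_map C.map_le_volume (hFi δ)
    rw [htest δ hδ, hFint δ, hFabs δ hδ] at h1
    exact h1
  -- comparison of the surface measures
  set β := (volume.restrict (Metric.ball (0 : C.T) C.r)).map g with hβ
  have hacβ : β ≪ σ.restrict (C.img ∩ frontier Ω) :=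
    (Measure.absolutelyContinuous_of_le C.map_le_surface).trans
      (Measure.AbsolutelyContinuous.rfl.smul_left _)
  have hqm : AEStronglyMeasurable (fun z => φ z * q z) (σ.restrict (C.img ∩ frontier Ω)) :=
    hφ.continuous.aestronglyMeasurable.mul (C.aestronglyMeasurable_trace hX σ)
  have hfin : IsFiniteMeasure (σ.restrict (C.img ∩ frontier Ω)) :=
    ⟨by rw [Measure.restrict_apply_univ]; exact C.surface_lt_top⟩
  have hφi : Integrable (fun z => |φ z|) (σ.restrict (C.img ∩ frontier Ω)) :=
    Integrable.of_bound hφ.continuous.abs.aestronglyMeasurable S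
      (ae_of_all _ fun z => by simpa using hS z)
  have hbd : ∀ᵐ z ∂(σ.restrict (C.img ∩ frontier Ω)), ‖φ z * q z‖ ≤ |φ z| * M := by
    refine (ae_restrict_iff' hmF).2 (ae_of_all _ fun z hz => ?_)
    rw [norm_mul]
    exact mul_le_mul_of_nonneg_left (hM0 z hz.2) (abs_nonneg _)
  have hqi : Integrable (fun z => φ z * q z) (σ.restrict (C.img ∩ frontier Ω)) :=
    Integrable.mono' (hφi.mul_const M) hqm hbd
  have hqβ : Integrable (fun z => φ z * q z) β :=
    (hqi.smul_measure ENNReal.ofReal_ne_top).mono_measure C.map_le_surface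
  have e1 : ∫ y in Metric.ball (0 : C.T) C.r, φ (g y) * q (g y) = ∫ z, φ z * q z ∂β :=
    (integral_map C.aemeasurable_base (hqm.mono_ac hacβ)).symm
  have e2 : ∫ y in Metric.ball (0 : C.T) C.r, |φ (g y) * q (g y)| = ∫ z, |φ z * q z| ∂β :=
    (integral_map C.aemeasurable_base (hqm.mono_ac hacβ).norm).symm
  have hcmp2 : |∫ z, φ z * q z ∂(σ.restrict (C.img ∩ frontier Ω)) - ∫ z, φ z * q z ∂β|
      ≤ 2 * η * ∫ z, |φ z * q z| ∂β :=
    abs_integral_sub_integral_le hη.le hη1 C.surface_le_map C.map_le_surface hqβ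
  have hle1 : ∫ z, |φ z * q z| ∂β
      ≤ (1 + η) * ∫ z in C.img ∩ frontier Ω, |φ z * q z| ∂σ := by
    have h1 := integral_mono_measure C.map_le_surface (f := fun z => |φ z * q z|)
      (ae_of_all _ fun z => abs_nonneg _) (hqi.norm.smul_measure ENNReal.ofReal_ne_top)
    rwa [integral_smul_measure, ENNReal.toReal_ofReal (by linarith), smul_eq_mul] at h1
  have hle2 : ∫ z in C.img ∩ frontier Ω, |φ z * q z| ∂σ
      ≤ (∫ z in C.img ∩ frontier Ω, |φ z| ∂σ) * M := by
    rw [← integral_mul_const]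
    exact integral_mono_ae hqi.norm (hφi.mul_const M) hbd
  have hF0 : ∀ u : E → ℝ, (∀ z ∉ C.img, u z = 0) →
      ∫ z in frontier Ω, u z ∂σ = ∫ z in C.img ∩ frontier Ω, u z ∂σ := fun u hu =>
    setIntegral_eq_of_subset_of_forall_sdiff_eq_zero isClosed_frontier.measurableSet
      inter_subset_right fun z hz => hu z fun h => hz.2 ⟨h, hz.1⟩
  rw [hF0 (fun z => φ z * q z) fun z hz => by simp [hφ0 z hz],
    hF0 (fun z => |φ z|) fun z hz => by simp [hφ0 z hz]]
  rw [e1, e2] at hcmp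
  have hnn : 0 ≤ ∫ z in C.img ∩ frontier Ω, |φ z * q z| ∂σ :=
    integral_nonneg fun z => abs_nonneg _
  have hle3 : ∫ z, |φ z * q z| ∂β ≤ 2 * ((∫ z in C.img ∩ frontier Ω, |φ z| ∂σ) * M) := by
    nlinarith
  -- Volume and surface comparison each cost 2η∫|φq|∂β, and this integral is at most (1+η)M∫|φ| ≤
  -- 2M∫|φ|; the total is 8ηM∫|φ|.
  have h5 : 2 * η * ∫ z, |φ z * q z| ∂β
      ≤ 2 * η * (2 * ((∫ z in C.img ∩ frontier Ω, |φ z| ∂σ) * M)) := by gcongr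
  rw [abs_le] at hcmp hcmp2 ⊢
  change _ ≤ (∫ x in Ω, H x) - _ ∧ (∫ x in Ω, H x) - _ ≤ _
  constructor <;> linarith [hcmp.1, hcmp.2, hcmp2.1, hcmp2.2]

end CollarChart

end Green

/-! ### The global Gauss–Green formula on a compact boundary. -/

section GreenFormula

open scoped Manifold ContDiff

variable {E : Type*} [NormedAddCommGroup E] [InnerProductSpace ℝ E] [CompleteSpace E]
  [FiniteDimensional ℝ E] [MeasurableSpace E] [BorelSpace E]
  {Ω : Set E} {ν : E → E}

/-- Used for finiteness of the surface measure and measurability of the trace only, so the crude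
distortion η = 1 is enough. -/
theorem exists_finite_collar_cover (hΩ : IsOpen Ω) (hF : IsCompact (frontier Ω))
    (hbd : ∀ z ∈ frontier Ω, HasC2BoundaryAt Ω ν z) :
    ∃ (t : Finset (frontier Ω)) (C : ∀ z : frontier Ω, CollarChart Ω ν z 1),
      frontier Ω = ⋃ z : t, ((C z).img ∩ frontier Ω) := by
  have hex : ∀ z : frontier Ω, Nonempty (CollarChart Ω ν (z : E) 1) := fun z =>
    ⟨(exists_collarChart hΩ z.2 (hbd z z.2) one_pos one_pos).choose⟩
  let C : ∀ z : frontier Ω, CollarChart Ω ν z 1 := fun z => (hex z).some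
  obtain ⟨t, ht⟩ := hF.elim_finite_subcover (fun z => (C z).img) (fun z => (C z).isOpen_img)
    fun z hz => mem_iUnion.2 ⟨⟨z, hz⟩, (C ⟨z, hz⟩).center_mem_img⟩
  refine ⟨t, C, Subset.antisymm (fun z hz => ?_) (iUnion_subset fun z => inter_subset_right)⟩
  obtain ⟨w, hw, hzw⟩ := mem_iUnion₂.1 (ht hz)
  exact mem_iUnion.2 ⟨⟨w, hw⟩, hzw, hz⟩

theorem surface_frontier_lt_top (hΩ : IsOpen Ω) (hF : IsCompact (frontier Ω))
    (hbd : ∀ z ∈ frontier Ω, HasC2BoundaryAt Ω ν z) :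
    (μHE[Module.finrank ℝ E - 1] : Measure E) (frontier Ω) < ⊤ := by
  obtain ⟨t, C, hC⟩ := exists_finite_collar_cover hΩ hF hbd
  rw [hC]
  refine (measure_iUnion_fintype_le _ _).trans_lt ?_
  exact ENNReal.sum_lt_top.2 fun z _ => (C z).surface_lt_top

theorem aestronglyMeasurable_trace (hΩ : IsOpen Ω) (hF : IsCompact (frontier Ω))
    (hbd : ∀ z ∈ frontier Ω, HasC2BoundaryAt Ω ν z) {X : E → E} {q : E → ℝ}
    (hX : HasNormalTrace Ω ν X q) (μ : Measure E) :
    AEStronglyMeasurable q (μ.restrict (frontier Ω)) := by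
  obtain ⟨t, C, hC⟩ := exists_finite_collar_cover hΩ hF hbd
  rw [hC]
  exact AEStronglyMeasurable.iUnion fun z => (C z).aestronglyMeasurable_trace hX μ

theorem integrableOn_trace (hΩ : IsOpen Ω) (hF : IsCompact (frontier Ω))
    (hbd : ∀ z ∈ frontier Ω, HasC2BoundaryAt Ω ν z) {X : E → E} {q : E → ℝ}
    (hX : HasNormalTrace Ω ν X q) :
    IntegrableOn q (frontier Ω) μHE[Module.finrank ℝ E - 1] := by
  obtain ⟨M, δ₀, hδ₀, hM⟩ := hX.bounded
  have : IsFiniteMeasure ((μHE[Module.finrank ℝ E - 1] : Measure E).restrict (frontier Ω)) :=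
    ⟨by rw [Measure.restrict_apply_univ]; exact surface_frontier_lt_top hΩ hF hbd⟩
  refine Integrable.of_bound (aestronglyMeasurable_trace hΩ hF hbd hX _) M ?_
  exact (ae_restrict_iff' isClosed_frontier.measurableSet).2
    (ae_of_all _ fun z hz => hX.abs_le hδ₀ hM hz)

/-- The Gauss–Green formula for a vector field with a bounded normal trace. -/
theorem green_formula (hΩ : IsOpen Ω) (hF : IsCompact (frontier Ω))
    (hbd : ∀ z ∈ frontier Ω, HasC2BoundaryAt Ω ν z) {X : E → E} {q f : E → ℝ}
    (hX : HasNormalTrace Ω ν X q) (hf : IntegrableOn f Ω) (hdiv : HasWeakDiv Ω X f)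
    {φ : E → ℝ} (hφ : ContDiff ℝ 1 φ) (hc : HasCompactSupport φ) :
    ∫ x in Ω, (inner ℝ (X x) (∇ φ x) + f x * φ x)
      = ∫ z in frontier Ω, φ z * q z ∂μHE[Module.finrank ℝ E - 1] := by
  set σ : Measure E := μHE[Module.finrank ℝ E - 1] with hσ
  obtain ⟨M₀, δ₀, hδ₀, hM₀⟩ := hX.bounded
  obtain ⟨M, hM0, hM⟩ : ∃ M, 0 ≤ M ∧ ∀ z ∈ frontier Ω, ∀ δ ∈ Ioo 0 δ₀,
      |inner ℝ (X (z - δ • ν z)) (ν z)| ≤ M :=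
    ⟨max M₀ 0, le_max_right _ _, fun z hz δ hδ => (hM₀ z hz δ hδ).trans (le_max_left _ _)⟩
  have hfin : IsFiniteMeasure (σ.restrict (frontier Ω)) :=
    ⟨by rw [Measure.restrict_apply_univ]; exact surface_frontier_lt_top hΩ hF hbd⟩
  have hqi : IntegrableOn q (frontier Ω) σ := integrableOn_trace hΩ hF hbd hX
  let Λ : (E → ℝ) → ℝ := fun u => (∫ x in Ω, (inner ℝ (X x) (∇ u x) + f x * u x))
    - ∫ z in frontier Ω, u z * q z ∂σ
  have hint1 : ∀ u : E → ℝ, ContDiff ℝ 1 u → HasCompactSupport u →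
      IntegrableOn (fun x => inner ℝ (X x) (∇ u x) + f x * u x) Ω := fun u hu hcu =>
    (hX.integrableOn_inner hΩ hu hcu).add
      (integrableOn_mul_of_hasCompactSupport hf hu.continuous hcu)
  have hint2 : ∀ u : E → ℝ, ContDiff ℝ 1 u → HasCompactSupport u →
      IntegrableOn (fun z => u z * q z) (frontier Ω) σ := by
    intro u hu hcu
    obtain ⟨B, hB⟩ := hu.continuous.bounded_above_of_compact_support hcu
    exact hqi.bdd_mul hu.continuous.aestronglyMeasurable (ae_of_all _ hB)
  have hint3 : ∀ u : E → ℝ, ContDiff ℝ 1 u → HasCompactSupport u →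
      IntegrableOn (fun z => |u z|) (frontier Ω) σ := by
    intro u hu hcu
    obtain ⟨B, hB⟩ := hu.continuous.bounded_above_of_compact_support hcu
    exact Integrable.of_bound hu.continuous.abs.aestronglyMeasurable B
      (ae_of_all _ fun z => by simpa using hB z)
  -- the local estimate
  have hloc : ∀ η : ℝ, 0 < η → η ≤ 1 → ∀ x : E, ∃ U : Set E, IsOpen U ∧ x ∈ U ∧
      ∀ u : E → ℝ, ContDiff ℝ 1 u → HasCompactSupport u → tsupport u ⊆ U →
        |Λ u| ≤ 8 * η * M * ∫ z in frontier Ω, |u z| ∂σ := by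
    intro η hη hη1 x
    have hnn : ∀ u : E → ℝ, 0 ≤ 8 * η * M * ∫ z in frontier Ω, |u z| ∂σ := fun u => by
      have : 0 ≤ ∫ z in frontier Ω, |u z| ∂σ := integral_nonneg fun z => abs_nonneg _
      positivity
    have hbz : ∀ u : E → ℝ, (∀ z ∈ frontier Ω, u z = 0) →
        ∫ z in frontier Ω, u z * q z ∂σ = 0 := fun u hu =>
      setIntegral_eq_zero_of_forall_eq_zero fun z hz => by rw [hu z hz, zero_mul]
    by_cases hxF : x ∈ frontier Ω
    · obtain ⟨C, hC⟩ := exists_collarChart hΩ hxF (hbd x hxF) hη hδ₀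
      exact ⟨C.img, C.isOpen_img, C.center_mem_img, fun u hu hcu hsu =>
        C.abs_green_sub_le hη hη1 hΩ hX hf hdiv hδ₀ hC hM hu hcu hsu⟩
    by_cases hxΩ : x ∈ Ω
    · refine ⟨Ω, hΩ, hxΩ, fun u hu hcu hsu => ?_⟩
      have : Λ u = 0 := by
        simp only [Λ]
        rw [hdiv u hu hcu hsu, hbz u fun z hz => ?_, sub_zero]
        refine image_eq_zero_of_notMem_tsupport fun h => ?_
        rw [hΩ.frontier_eq] at hz
        exact hz.2 (hsu h)
      rw [this, abs_zero]
      exact hnn u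
    · refine ⟨(closure Ω)ᶜ, isClosed_closure.isOpen_compl, fun h => hxF ?_, fun u hu hcu hsu => ?_⟩
      · rw [hΩ.frontier_eq]
        exact ⟨h, hxΩ⟩
      · have hns : ∀ z ∈ closure Ω, z ∉ tsupport u := fun z hz h => hsu h hz
        have : Λ u = 0 := by
          simp only [Λ]
          rw [hbz u fun z hz => image_eq_zero_of_notMem_tsupport
              (hns z (frontier_subset_closure hz)),
            setIntegral_eq_zero_of_forall_eq_zero fun z hz => ?_, sub_zero]
          rw [gradient_eq_zero_of_notMem_tsupport (hns z (subset_closure hz)),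
            image_eq_zero_of_notMem_tsupport (hns z (subset_closure hz)), inner_zero_right,
            mul_zero, add_zero]
        rw [this, abs_zero]
        exact hnn u
  -- globalization by a partition of unity
  have hglob : ∀ η : ℝ, 0 < η → η ≤ 1 →
      |Λ φ| ≤ 8 * η * M * ∫ z in frontier Ω, |φ z| ∂σ := by
    intro η hη hη1
    choose U hUo hxU hU using hloc η hη hη1
    obtain ⟨t, ht⟩ := hc.isCompact.elim_finite_subcover U hUo
      fun x _ => mem_iUnion.2 ⟨x, hxU x⟩
    obtain ⟨ρ, hρ⟩ := SmoothPartitionOfUnity.exists_isSubordinate 𝓘(ℝ, E)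
      (isClosed_tsupport φ) (fun i : t => U i) (fun i => hUo i)
      (fun x hx => by
        obtain ⟨i, hi, hxi⟩ := mem_iUnion₂.1 (ht hx)
        exact mem_iUnion.2 ⟨⟨i, hi⟩, hxi⟩)
    let u : t → E → ℝ := fun i x => ρ i x * φ x
    have hu : ∀ i, ContDiff ℝ 1 (u i) := fun i =>
      ((ρ i).contMDiff.contDiff.of_le (by simp)).mul hφ
    have hcu : ∀ i, HasCompactSupport (u i) := fun i => hc.mul_left
    have hsu : ∀ i, tsupport (u i) ⊆ U i := fun i =>
      (closure_mono (by
        intro y hy h0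
        exact hy (by simp [u, h0]))).trans (hρ i)
    have hsum1 : ∀ x ∈ tsupport φ, ∑ i, ρ i x = 1 := fun x hx => by
      rw [← finsum_eq_sum_of_fintype]
      exact ρ.sum_eq_one hx
    have hsum : ∀ x, φ x = ∑ i, u i x := by
      intro x
      simp only [u]
      rw [← Finset.sum_mul]
      by_cases hx : x ∈ tsupport φ
      · rw [hsum1 x hx, one_mul]
      · rw [image_eq_zero_of_notMem_tsupport hx, mul_zero]
    -- Since the partition functions are nonnegative, the local errors add up to 8ηM∫|φ| however
    -- many patches are used. This is why η can be sent to 0 although the cover depends on η.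
    have habs : ∀ x, |φ x| = ∑ i, |u i x| := by
      intro x
      have h1 : ∀ i, |u i x| = ρ i x * |φ x| := fun i => by
        simp only [u, abs_mul, abs_of_nonneg (ρ.nonneg i x)]
      simp only [h1]
      rw [← Finset.sum_mul]
      by_cases hx : x ∈ tsupport φ
      · rw [hsum1 x hx, one_mul]
      · rw [image_eq_zero_of_notMem_tsupport hx, abs_zero, mul_zero]
    have hgrad : ∀ x, inner ℝ (X x) (∇ φ x) = ∑ i, inner ℝ (X x) (∇ (u i) x) := by
      intro x
      have h1 : φ = fun x => ∑ i, u i x := funext hsum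
      have h2 : fderiv ℝ φ x = ∑ i, fderiv ℝ (u i) x := by
        conv_lhs => rw [h1]
        exact fderiv_fun_sum fun i _ => (hu i).differentiable one_ne_zero x
      have h3 : ∀ v : E → ℝ, inner ℝ (X x) (∇ v x) = fderiv ℝ v x (X x) := fun v => by
        rw [real_inner_comm, inner_gradient_left]
      simp only [h3]
      rw [h2]
      simp
    have hΛ : Λ φ = ∑ i, Λ (u i) := by
      simp only [Λ]
      rw [Finset.sum_sub_distrib, ← integral_finsetSum _ fun i _ => hint1 (u i) (hu i) (hcu i),
        ← integral_finsetSum _ fun i _ => hint2 (u i) (hu i) (hcu i)]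
      congr 1
      · refine integral_congr_ae (ae_of_all _ fun x => ?_)
        simp only
        rw [Finset.sum_add_distrib, ← hgrad, ← Finset.mul_sum, ← hsum]
      · refine integral_congr_ae (ae_of_all _ fun x => ?_)
        simp only
        rw [← Finset.sum_mul, ← hsum]
    calc |Λ φ| ≤ ∑ i, |Λ (u i)| := by rw [hΛ]; exact Finset.abs_sum_le_sum_abs _ _
      _ ≤ ∑ i, 8 * η * M * ∫ z in frontier Ω, |u i z| ∂σ :=
        Finset.sum_le_sum fun i _ => hU i (u i) (hu i) (hcu i) (hsu i)
      _ = 8 * η * M * ∫ z in frontier Ω, |φ z| ∂σ := by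
        rw [← Finset.mul_sum, ← integral_finsetSum _ fun i _ => hint3 (u i) (hu i) (hcu i)]
        simp only [habs]
  have hzero : |Λ φ| ≤ 0 := by
    have h1 : Tendsto (fun η : ℝ => 8 * η * M * ∫ z in frontier Ω, |φ z| ∂σ) (𝓝[>] 0) (𝓝 0) := by
      have : Continuous fun η : ℝ => 8 * η * M * ∫ z in frontier Ω, |φ z| ∂σ := by fun_prop
      have h2 := this.tendsto 0
      simp only [mul_zero, zero_mul] at h2
      exact h2.mono_left nhdsWithin_le_nhds
    refine ge_of_tendsto h1 ?_
    filter_upwards [Ioo_mem_nhdsGT (zero_lt_one' ℝ)] with η hη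
    exact hglob η hη.1 hη.2.le
  exact sub_eq_zero.1 (abs_nonpos_iff.1 hzero)

end GreenFormula

/-! ### Defining functions and the uniqueness of the normal. -/

section Boundary

variable {E : Type*} [NormedAddCommGroup E] [InnerProductSpace ℝ E] [CompleteSpace E]

theorem eq_zero_of_mem_frontier {D U : Set E} {ψ : E → ℝ} {z : E} (hz : z ∈ frontier D)
    (hU : U ∈ 𝓝 z) (hψ : ContinuousAt ψ z) (hD : ∀ y ∈ U, y ∈ D ↔ ψ y < 0) : ψ z = 0 := by
  rcases lt_trichotomy (ψ z) 0 with h | h | h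
  · have : D ∈ 𝓝 z := by
      filter_upwards [hU, hψ.eventually_lt_const h] with y hy h2
      exact (hD y hy).2 h2
    exact absurd (mem_interior_iff_mem_nhds.2 this) hz.2
  · exact h
  · have h1 : ∀ᶠ y in 𝓝 z, y ∉ D := by
      filter_upwards [hU, hψ.eventually_const_lt h] with y hy h2 h3
      exact absurd ((hD y hy).1 h3) h2.not_gt
    exact absurd hz.1 fun hcl => (mem_closure_iff_frequently.1 hcl) h1

theorem eventually_neg_of_inner_gradient_neg {ψ : E → ℝ} {z w : E} (hψ : DifferentiableAt ℝ ψ z)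
    (h0 : ψ z = 0) (hw : inner ℝ (∇ ψ z) w < 0) : ∀ᶠ s : ℝ in 𝓝[>] 0, ψ (z + s • w) < 0 := by
  have hd : HasDerivAt (fun s : ℝ => ψ (z + s • w)) (inner ℝ (∇ ψ z) w) 0 := by
    have h1 : HasDerivAt (fun s : ℝ => z + s • w) w 0 := by
      simpa using ((hasDerivAt_id (0 : ℝ)).smul_const w).const_add z
    have h2 : HasFDerivAt ψ (innerSL ℝ (∇ ψ z)) (z + (0 : ℝ) • w) := by
      rw [zero_smul, add_zero]
      exact hψ.hasGradientAt.hasFDerivAt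
    exact h2.comp_hasDerivAt 0 h1
  have h3 := (hasDerivAt_iff_tendsto_slope.1 hd).eventually_lt_const hw
  have h4 : ∀ᶠ s : ℝ in 𝓝[>] 0, slope (fun s : ℝ => ψ (z + s • w)) 0 s < 0 :=
    h3.filter_mono (nhdsWithin_mono _ fun s (hs : 0 < s) => hs.ne')
  filter_upwards [h4, self_mem_nhdsWithin] with s hs hpos
  rw [slope_def_field] at hs
  simp only [zero_smul, add_zero, h0, sub_zero] at hs
  have hpos' : (0 : ℝ) < s := hpos
  by_contra h
  exact absurd (div_nonneg (not_lt.1 h) hpos'.le) hs.not_ge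

theorem tendsto_add_smul (z w : E) : Tendsto (fun s : ℝ => z + s • w) (𝓝[>] 0) (𝓝 z) := by
  have : Continuous fun s : ℝ => z + s • w := by fun_prop
  simpa using (this.tendsto 0).mono_left nhdsWithin_le_nhds

theorem gradient_neg_fun (ψ : E → ℝ) (z : E) : ∇ (fun x => -ψ x) z = - ∇ ψ z := by
  simp only [gradient]
  rw [fderiv_fun_neg, map_neg]

/-- If the unit gradients a and b differed, then a short step in the direction b − a would make ψ₁
negative and ψ₂ positive, placing one point both inside and outside D. -/
theorem unitGrad_eq_of_sublevel {D U₁ U₂ : Set E} {ψ₁ ψ₂ : E → ℝ} {z : E} (hz : z ∈ frontier D)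
    (hU₁ : U₁ ∈ 𝓝 z) (hU₂ : U₂ ∈ 𝓝 z) (hψ₁ : DifferentiableAt ℝ ψ₁ z)
    (hψ₂ : DifferentiableAt ℝ ψ₂ z) (hD₁ : ∀ y ∈ U₁, y ∈ D ↔ ψ₁ y < 0)
    (hD₂ : ∀ y ∈ U₂, y ∈ D ↔ ψ₂ y < 0) (h₁ : ∇ ψ₁ z ≠ 0) (h₂ : ∇ ψ₂ z ≠ 0) :
    unitGrad ψ₁ z = unitGrad ψ₂ z := by
  by_contra hne
  set a := unitGrad ψ₁ z
  set b := unitGrad ψ₂ z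
  have ha : ‖a‖ = 1 := norm_unitGrad h₁
  have hb : ‖b‖ = 1 := norm_unitGrad h₂
  have hab : inner ℝ a b < 1 :=
    lt_of_le_of_ne (by simpa [ha, hb] using real_inner_le_norm a b)
      fun h => hne ((inner_eq_one_iff_of_norm_eq_one ha hb).1 h)
  have haa : inner ℝ a a = 1 := by rw [real_inner_self_eq_norm_sq, ha]; norm_num
  have hbb : inner ℝ b b = 1 := by rw [real_inner_self_eq_norm_sq, hb]; norm_num
  have p1 := norm_pos_iff.2 h₁
  have p2 := norm_pos_iff.2 h₂
  have e1 : inner ℝ (∇ ψ₁ z) (b - a) < 0 := by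
    rw [← norm_smul_unitGrad h₁, inner_smul_left, inner_sub_right]
    change ‖∇ ψ₁ z‖ * (inner ℝ a b - inner ℝ a a) < 0
    rw [haa]
    nlinarith
  have e2 : inner ℝ (∇ (fun x => - ψ₂ x) z) (b - a) < 0 := by
    rw [gradient_neg_fun, inner_neg_left, ← norm_smul_unitGrad h₂, inner_smul_left,
      inner_sub_right]
    change -(‖∇ ψ₂ z‖ * (inner ℝ b b - inner ℝ b a)) < 0
    rw [hbb, real_inner_comm]
    nlinarith
  have z1 := eq_zero_of_mem_frontier hz hU₁ hψ₁.continuousAt hD₁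
  have z2 := eq_zero_of_mem_frontier hz hU₂ hψ₂.continuousAt hD₂
  have f1 := eventually_neg_of_inner_gradient_neg hψ₁ z1 e1
  have f2 := eventually_neg_of_inner_gradient_neg (ψ := fun x => - ψ₂ x) hψ₂.neg (by simp [z2]) e2
  have t := tendsto_add_smul z (b - a)
  obtain ⟨s, hs1, hs2, hs3, hs4⟩ :=
    (f1.and (f2.and ((t.eventually_mem hU₁).and (t.eventually_mem hU₂)))).exists
  have := (hD₂ _ hs4).1 ((hD₁ _ hs3).2 hs1)
  linarith

/-- Lets continuity up to the closure be used for limits along the inner normal. -/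
theorem HasC2BoundaryAt.eventually_mem {Ω : Set E} {ν : E → E} {z : E} (hz : z ∈ frontier Ω)
    (h : HasC2BoundaryAt Ω ν z) : ∀ᶠ δ : ℝ in 𝓝[>] 0, z - δ • ν z ∈ Ω := by
  obtain ⟨U, hU, hzU, ψ, hψ, h0, hΩ, hν⟩ := h
  have hd : DifferentiableAt ℝ ψ z :=
    ((hψ z hzU).contDiffAt (hU.mem_nhds hzU)).differentiableAt (by norm_num)
  have h1 := eq_zero_of_mem_frontier hz (hU.mem_nhds hzU) hd.continuousAt hΩ
  have h2 : inner ℝ (∇ ψ z) (- ν z) < 0 := by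
    rw [hν z ⟨hzU, hz⟩, inner_neg_right, unitGrad, inner_smul_right, real_inner_self_eq_norm_sq]
    have := norm_pos_iff.2 h0
    have : 0 < ‖∇ ψ z‖⁻¹ * ‖∇ ψ z‖ ^ 2 := by positivity
    linarith
  filter_upwards [eventually_neg_of_inner_gradient_neg hd h1 h2,
    tendsto_add_smul z (- ν z) (hU.mem_nhds hzU)] with s hs hsU
  have : z + s • (- ν z) ∈ Ω := (hΩ _ hsU).2 hs
  rwa [smul_neg, ← sub_eq_add_neg] at this

theorem HasC2BoundaryAt.norm_eq_one {Ω : Set E} {ν : E → E} {z : E} (hz : z ∈ frontier Ω)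
    (h : HasC2BoundaryAt Ω ν z) : ‖ν z‖ = 1 := by
  obtain ⟨U, hU, hzU, ψ, hψ, h0, hΩ, hν⟩ := h
  rw [hν z ⟨hzU, hz⟩, norm_unitGrad h0]

end Boundary

/-! ### The boundary and outward normal of the outer domain. -/

section OuterDomain

variable {κ : ℕ} {n : Fin (κ + 1) → ℕ}

theorem outerDomain_comm (A B : Set (Space n)) : outerDomain A B = outerDomain B A := by
  rw [outerDomain, outerDomain, union_comm]

theorem isOpen_outerDomain (A B : Set (Space n)) : IsOpen (outerDomain A B) :=
  isClosed_closure.isOpen_compl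

/-- The normal is defined by choice; since all defining functions share the same unit gradient, any
of them computes it. -/
theorem outwardNormal_eq {D U : Set (Space n)} {ψ : Space n → ℝ} {z : Space n}
    (hz : z ∈ frontier D) (hU : IsOpen U) (hzU : z ∈ U) (hψ : ContDiffOn ℝ 1 ψ U)
    (h0 : ∇ ψ z ≠ 0) (hD : ∀ y ∈ U, y ∈ D ↔ ψ y < 0) : outwardNormal D z = unitGrad ψ z := by
  have hex : IsOutwardNormal D z (unitGrad ψ z) :=
    ⟨hz, norm_unitGrad h0, U, hU, hzU, ψ, hψ, hD, ‖∇ ψ z‖, norm_pos_iff.2 h0,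
      (norm_smul_unitGrad h0).symm⟩
  have hex' : ∃ ν, IsOutwardNormal D z ν := ⟨_, hex⟩
  rw [outwardNormal, dif_pos hex']
  obtain ⟨-, h1, V, hV, hzV, χ, hχ, hDχ, t, ht, hgrad⟩ := hex'.choose_spec
  set ν := hex'.choose
  have hχ0 : ∇ χ z ≠ 0 := by
    rw [hgrad]
    exact smul_ne_zero ht.ne' (by rw [← norm_ne_zero_iff, h1]; exact one_ne_zero)
  have h2 : unitGrad χ z = ν := by
    rw [unitGrad, hgrad, norm_smul, h1, mul_one, Real.norm_eq_abs, abs_of_pos ht, smul_smul,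
      inv_mul_cancel₀ ht.ne', one_smul]
  rw [← h2]
  exact unitGrad_eq_of_sublevel hz (hV.mem_nhds hzV) (hU.mem_nhds hzU)
    (((hχ z hzV).contDiffAt (hV.mem_nhds hzV)).differentiableAt one_ne_zero)
    (((hψ z hzU).contDiffAt (hU.mem_nhds hzU)).differentiableAt one_ne_zero) hDχ hD hχ0 h0

/-- Near a boundary point of `A` away from `B`, the outer domain is a sublevel set. -/
theorem exists_outerDomain_chart {α : ℝ} {A B : Set (Space n)} (hA : HasC2HolderBoundary α A)
    {z₀ : Space n} (hz₀ : z₀ ∈ frontier A) (hB : z₀ ∉ closure B) :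
    ∃ U : Set (Space n), IsOpen U ∧ z₀ ∈ U ∧ ∃ ψ : Space n → ℝ, ContDiffOn ℝ 2 ψ U ∧
      (∀ z ∈ U, ∇ ψ z ≠ 0) ∧ ψ z₀ = 0 ∧ ∀ z ∈ U, z ∈ outerDomain A B ↔ ψ z < 0 := by
  obtain ⟨V, hV, hzV, χ, hχ, -, hχ0, hAχ⟩ := hA z₀ hz₀
  have hgc : ContinuousOn (∇ χ) V := continuousOn_gradient hV (hχ.of_le (by norm_num))
  have hUo : IsOpen (V ∩ (∇ χ) ⁻¹' {0}ᶜ ∩ (closure B)ᶜ) :=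
    (hgc.isOpen_inter_preimage hV isOpen_compl_singleton).inter isClosed_closure.isOpen_compl
  have hd : ∀ z ∈ V, DifferentiableAt ℝ χ z := fun z hz =>
    ((hχ z hz).contDiffAt (hV.mem_nhds hz)).differentiableAt (by norm_num)
  have h0 : χ z₀ = 0 :=
    eq_zero_of_mem_frontier hz₀ (hV.mem_nhds hzV) (hd z₀ hzV).continuousAt hAχ
  refine ⟨_, hUo, ⟨⟨hzV, hχ0⟩, hB⟩, fun x => -χ x,
    (hχ.mono (inter_subset_left.trans inter_subset_left)).neg, fun z hz => ?_, by simp [h0],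
    fun z hz => ?_⟩
  · rw [gradient_neg_fun]
    exact neg_ne_zero.2 hz.1.2
  · have hzB : z ∉ closure B := hz.2
    have hzV' : z ∈ V := hz.1.1
    rw [outerDomain, closure_union, mem_compl_iff, mem_union, or_iff_left hzB, neg_lt_zero,
      not_iff_comm, not_lt]
    constructor
    · intro hle
      rcases hle.lt_or_eq with hlt | heq
      · exact subset_closure ((hAχ z hzV').2 hlt)
      -- A zero of χ is a limit of points of A, reached along −∇χ ≠ 0. So the closure of A is χ ≤ 0
      -- here, and its complement is −χ < 0.
      · have h1 : inner ℝ (∇ χ z) (- ∇ χ z) < 0 := by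
          rw [inner_neg_right, real_inner_self_eq_norm_sq]
          have : 0 < ‖∇ χ z‖ := norm_pos_iff.2 hz.1.2
          have : 0 < ‖∇ χ z‖ ^ 2 := by positivity
          linarith
        have t := tendsto_add_smul z (- ∇ χ z)
        refine mem_closure_of_tendsto t ?_
        filter_upwards [eventually_neg_of_inner_gradient_neg (hd z hzV') heq h1,
          t (hV.mem_nhds hzV')] with s hs hsV
        exact (hAχ _ hsV).2 hs
    · intro hcl
      by_contra hpos
      have h1 : ∀ᶠ y in 𝓝 z, y ∉ A := by
        filter_upwards [hV.mem_nhds hzV',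
          (hd z hzV').continuousAt.eventually_const_lt (not_le.1 hpos)] with y hy h2 h3
        exact absurd ((hAχ y hy).1 h3) h2.not_gt
      exact (mem_closure_iff_frequently.1 hcl) h1

theorem mem_frontier_outerDomain {α : ℝ} {A B : Set (Space n)} (hA : HasC2HolderBoundary α A)
    {z₀ : Space n} (hz₀ : z₀ ∈ frontier A) (hB : z₀ ∉ closure B) :
    z₀ ∈ frontier (outerDomain A B) := by
  obtain ⟨U, hU, hzU, ψ, hψ, hψ0, hz, hΩ⟩ := exists_outerDomain_chart hA hz₀ hB
  rw [(isOpen_outerDomain A B).frontier_eq]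
  refine ⟨?_, fun h => ?_⟩
  · have h1 : inner ℝ (∇ ψ z₀) (- ∇ ψ z₀) < 0 := by
      rw [inner_neg_right, real_inner_self_eq_norm_sq]
      have : 0 < ‖∇ ψ z₀‖ := norm_pos_iff.2 (hψ0 z₀ hzU)
      have : 0 < ‖∇ ψ z₀‖ ^ 2 := by positivity
      linarith
    have hd : DifferentiableAt ℝ ψ z₀ :=
      ((hψ z₀ hzU).contDiffAt (hU.mem_nhds hzU)).differentiableAt (by norm_num)
    have t := tendsto_add_smul z₀ (- ∇ ψ z₀)
    refine mem_closure_of_tendsto t ?_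
    filter_upwards [eventually_neg_of_inner_gradient_neg hd hz h1,
      t (hU.mem_nhds hzU)] with s hs hsU
    exact (hΩ _ hsU).2 hs
  · have := (hΩ z₀ hzU).1 h
    rw [hz] at this
    exact lt_irrefl _ this

theorem hasC2BoundaryAt_outerDomain {α : ℝ} {A B : Set (Space n)} (hA : HasC2HolderBoundary α A)
    {z₀ : Space n} (hz₀ : z₀ ∈ frontier A) (hB : z₀ ∉ closure B) :
    HasC2BoundaryAt (outerDomain A B) (outwardNormal (outerDomain A B)) z₀ := by
  obtain ⟨U, hU, hzU, ψ, hψ, hψ0, hz, hΩ⟩ := exists_outerDomain_chart hA hz₀ hB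
  exact ⟨U, hU, hzU, ψ, hψ, hψ0 z₀ hzU, hΩ, fun z hz =>
    outwardNormal_eq hz.2 hU hz.1 (hψ.of_le (by norm_num)) (hψ0 z hz.1) hΩ⟩

namespace AdmissiblePair

variable {A B : Set (Space n)}

theorem disjoint_closure (h : AdmissiblePair A B) : Disjoint (closure A) (closure B) := by
  obtain ⟨r, hr, hsep⟩ := h.separated
  rw [Set.disjoint_left]
  intro z hA hB
  obtain ⟨a, ha, hza⟩ := Metric.mem_closure_iff.1 hA (r / 2) (by linarith)
  obtain ⟨b, hb, hzb⟩ := Metric.mem_closure_iff.1 hB (r / 2) (by linarith)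
  have h1 := hsep a ha b hb
  have h2 := dist_triangle_left a b z
  linarith

theorem frontier_outerDomain (h : AdmissiblePair A B) :
    frontier (outerDomain A B) = frontier A ∪ frontier B := by
  obtain ⟨α, -, -, hA, hB⟩ := h.boundary
  have hd := h.disjoint_closure
  refine Subset.antisymm ?_ (union_subset (fun z hz => ?_) fun z hz => ?_)
  · rw [outerDomain, frontier_compl]
    refine (frontier_closure_subset).trans ((frontier_union_subset A B).trans ?_)
    exact union_subset_union inter_subset_left inter_subset_right
  · exact mem_frontier_outerDomain hA hz
      (Set.disjoint_left.1 hd (frontier_subset_closure hz))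
  · rw [outerDomain_comm]
    exact mem_frontier_outerDomain hB hz
      (Set.disjoint_right.1 hd (frontier_subset_closure hz))

theorem hasC2BoundaryAt (h : AdmissiblePair A B) :
    ∀ z ∈ frontier (outerDomain A B),
      HasC2BoundaryAt (outerDomain A B) (outwardNormal (outerDomain A B)) z := by
  obtain ⟨α, -, -, hA, hB⟩ := h.boundary
  have hd := h.disjoint_closure
  intro z hz
  rw [h.frontier_outerDomain] at hz
  rcases hz with hz | hz
  · exact hasC2BoundaryAt_outerDomain hA hz
      (Set.disjoint_left.1 hd (frontier_subset_closure hz))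
  · rw [outerDomain_comm]
    exact hasC2BoundaryAt_outerDomain hB hz
      (Set.disjoint_right.1 hd (frontier_subset_closure hz))

theorem isCompact_frontier (h : AdmissiblePair A B) : IsCompact (frontier (outerDomain A B)) := by
  rw [h.frontier_outerDomain]
  exact (h.bounded_left.isCompact_closure.of_isClosed_subset isClosed_frontier
    frontier_subset_closure).union (h.bounded_right.isCompact_closure.of_isClosed_subset
      isClosed_frontier frontier_subset_closure)

end AdmissiblePair

theorem surfaceMeasure_eq : surfaceMeasure n = μHE[Module.finrank ℝ (Space n) - 1] := by
  simp [surfaceMeasure]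

end OuterDomain

/-! ### Block structure, the adjoint coefficients, and integrability of the Gibbs weight. -/

variable {κ : ℕ} {n : Fin (κ + 1) → ℕ}

/-- The projection onto the diffusive block, as a continuous linear map. -/
def hatL : Space n →L[ℝ] EuclideanSpace ℝ (Fin (n 0)) :=
  LinearMap.toContinuousLinearMap
    { toFun := hat
      map_add' := fun _ _ => rfl
      map_smul' := fun _ _ => rfl }

theorem hatL_apply (v : Space n) : hatL v = hat v := rfl

/-- The inclusion of the diffusive block. -/
def unhat : EuclideanSpace ℝ (Fin (n 0)) →L[ℝ] Space n := ContinuousLinearMap.adjoint hatL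

theorem inner_unhat (u : EuclideanSpace ℝ (Fin (n 0))) (v : Space n) :
    inner ℝ (unhat u) v = inner ℝ u (hat v) := by
  rw [unhat, ContinuousLinearMap.adjoint_inner_left, hatL_apply]

namespace Coefficients

variable (c : Coefficients κ n)

theorem inner_b (z v : Space n) : inner ℝ (c.b z) v = inner ℝ (c.bhat z) (hat v) := by
  simp [PiLp.inner_apply, Fintype.sum_sigma, Fin.sum_univ_succ, b, hat]

theorem b_eq_unhat (z : Space n) : c.b z = unhat (c.bhat z) :=
  ext_inner_right ℝ fun v => by rw [inner_b, inner_unhat]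

/-- The matrix `B`, as a continuous linear map. -/
def BmulL : Space n →L[ℝ] Space n :=
  LinearMap.toContinuousLinearMap
    { toFun := c.Bmul
      map_add' := fun u v => by
        ext ⟨j, i⟩
        refine Fin.cases (fun i => ?_) (fun j i => ?_) j i
        · simp [Bmul]
        · simp only [Bmul, Fin.cases_succ, PiLp.add_apply]
          rw [← Pi.add_apply, ← Matrix.mulVec_add]
          rfl
      map_smul' := fun a u => by
        ext ⟨j, i⟩
        refine Fin.cases (fun i => ?_) (fun j i => ?_) j i
        · simp [Bmul]
        · simp only [Bmul, Fin.cases_succ, PiLp.smul_apply, RingHom.id_apply]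
          rw [← Pi.smul_apply, ← Matrix.mulVec_smul]
          rfl }

theorem adjoint_b (z : Space n) : c.adjoint.b z = - c.b z := by
  rw [b_eq_unhat, b_eq_unhat, ← map_neg]
  rfl

theorem adjoint_Bmul (z : Space n) : c.adjoint.Bmul z = - c.Bmul z := by
  ext ⟨j, i⟩
  refine Fin.cases (fun i => ?_) (fun j i => ?_) j i
  · simp [Bmul]
  · simp [Bmul, adjoint, Matrix.neg_mulVec]

theorem adjoint_drift (z : Space n) : c.adjoint.drift z = - c.drift z := by
  rw [drift, drift, adjoint_b, adjoint_Bmul, neg_add]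

theorem inner_Amul (z : Space n) (u v : EuclideanSpace ℝ (Fin (n 0))) :
    inner ℝ (c.Amul z u) v = ∑ i, ∑ j, c.Ahat z i j * u j * v i := by
  simp only [Amul, PiLp.inner_apply, Matrix.mulVec, dotProduct, RCLike.inner_apply, conj_trivial]
  refine Finset.sum_congr rfl fun i _ => ?_
  rw [Finset.mul_sum]
  exact Finset.sum_congr rfl fun j _ => by ring

/-- The source of the duality: the mixed gradient terms of the two equations cancel by this
identity. -/
theorem inner_adjoint_Amul (z : Space n) (u v : EuclideanSpace ℝ (Fin (n 0))) :
    inner ℝ (c.adjoint.Amul z u) v = inner ℝ (c.Amul z v) u := by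
  rw [inner_Amul, inner_Amul, Finset.sum_comm]
  refine Finset.sum_congr rfl fun i _ => Finset.sum_congr rfl fun j _ => ?_
  change c.Ahat z i j * u i * v j = _
  ring

/-- The density of `ρ_ε`. -/
def weight (ε : ℝ) (z : Space n) : ℝ := Real.exp (-(c.W z) / ε) / c.Z ε

/-- The properties of the coefficients that enter the integrations by parts. -/
structure Regular (c : Coefficients κ n) (ε : ℝ) : Prop where
  A_continuous : ∀ i j, Continuous fun z => c.Ahat z i j
  A_bounded : ∃ M : ℝ, ∀ z i j, |c.Ahat z i j| ≤ M
  b_continuous : Continuous c.bhat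
  W_continuous : Continuous c.W
  integrable_exp : Integrable fun z => Real.exp (-(c.W z) / ε)
  divFree : c.WeightedDivFree ε
  b_memLp : MemLp c.b 2 (c.rho ε)

/-- As q > 1, W dominates an affine function of ‖z‖ with positive slope; an exponential in ‖z‖ beats
the power N, one more than the dimension. -/
theorem Admissible.integrable_exp {c : Coefficients κ n} (hc : c.Admissible) {ε : ℝ} (hε : 0 < ε) :
    Integrable fun z => Real.exp (-(c.W z) / ε) := by
  obtain ⟨q, c₁, c₂, hq, hc₁, hc₂, hW⟩ := hc.W_growth
  set N : ℕ := Module.finrank ℝ (Space n) + 1 with hN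
  have hintg : Integrable fun z : Space n => (1 + ‖z‖) ^ (-(N : ℝ)) :=
    integrable_one_add_norm (by rw [hN]; push_cast; linarith)
  set a := c₁ / ε with ha
  have ha0 : 0 < a := by positivity
  refine (hintg.const_mul (Real.exp (c₂ / ε + 2 * a) * (N.factorial / a ^ N))).mono'
    (Real.continuous_exp.comp (hc.W_differentiable.continuous.neg.div_const ε)).aestronglyMeasurable
    (ae_of_all _ fun z => ?_)
  have h1 : ‖z‖ - 1 ≤ ‖z‖ ^ q := by
    rcases le_total 1 ‖z‖ with h | h
    · have := Real.rpow_le_rpow_of_exponent_le h hq.le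
      rw [Real.rpow_one] at this
      linarith
    · have := Real.rpow_nonneg (norm_nonneg z) q
      linarith
  have h2 : -(c.W z) / ε ≤ (c₂ / ε + 2 * a) - a * (1 + ‖z‖) := by
    have h3 : c₁ * (‖z‖ - 1) - c₂ ≤ c.W z := by nlinarith [hW z]
    have h4 : (c₂ / ε + 2 * a) - a * (1 + ‖z‖) = -(c₁ * (‖z‖ - 1) - c₂) / ε := by
      rw [ha]; field_simp; ring
    rw [h4]
    gcongr
  rw [Real.norm_eq_abs, abs_of_pos (Real.exp_pos _)]
  refine (Real.exp_le_exp.2 h2).trans ?_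
  rw [Real.exp_sub, div_eq_mul_inv, mul_assoc]
  gcongr
  have hx : 0 < a * (1 + ‖z‖) := by positivity
  have h5 := Real.pow_div_factorial_le_exp (a * (1 + ‖z‖)) hx.le N
  rw [Real.rpow_neg (by positivity), Real.rpow_natCast]
  have h6 : (N.factorial : ℝ) / a ^ N * ((1 + ‖z‖) ^ N)⁻¹
      = ((a * (1 + ‖z‖)) ^ N / N.factorial)⁻¹ := by
    rw [mul_pow]; field_simp
  rw [h6]
  exact inv_anti₀ (by positivity) h5

theorem Admissible.regular {c : Coefficients κ n} (hc : c.Admissible) {ε : ℝ} (hε : 0 < ε)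
    (hdiv : c.WeightedDivFree ε) (hb : MemLp c.b 2 (c.rho ε)) : c.Regular ε where
  A_continuous i j := by
    obtain ⟨α, hα, -, M, hM⟩ := hc.A_holder
    refine continuous_iff_continuousAt.2 fun z => ?_
    rw [ContinuousAt, tendsto_iff_dist_tendsto_zero]
    have h1 : Continuous fun z' : Space n => M * ‖z' - z‖ ^ α :=
      continuous_const.mul ((continuous_id.sub continuous_const).norm.rpow_const
        fun _ => Or.inr hα.le)
    have h2 := h1.tendsto z
    simp only [sub_self, norm_zero, Real.zero_rpow hα.ne', mul_zero] at h2
    exact squeeze_zero (fun _ => dist_nonneg) (fun z' => hM z' z i j) h2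
  A_bounded := hc.A_bounded
  b_continuous := hc.b_continuous
  W_continuous := hc.W_differentiable.continuous
  integrable_exp := hc.integrable_exp hε
  divFree := hdiv
  b_memLp := hb

namespace Regular

variable {c} {ε : ℝ}

theorem adjoint (hc : c.Regular ε) : c.adjoint.Regular ε where
  A_continuous i j := hc.A_continuous j i
  A_bounded := hc.A_bounded.imp fun _ hM z i j => hM z j i
  b_continuous := hc.b_continuous.neg
  W_continuous := hc.W_continuous
  integrable_exp := hc.integrable_exp
  divFree φ hφ hφc := by
    have h := hc.divFree φ hφ hφc
    simp only [adjoint_drift, inner_neg_left]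
    rw [integral_neg, neg_eq_zero]
    exact h
  b_memLp := by
    have : c.adjoint.b = fun z => - c.b z := funext fun z => c.adjoint_b z
    rw [this]
    exact hc.b_memLp.neg

end Regular

end Coefficients

/-! ### The divergence theorem in an exterior domain. -/

section Exterior

variable {E : Type*} [NormedAddCommGroup E] [InnerProductSpace ℝ E] [FiniteDimensional ℝ E]

/-- Smooth cut-offs of growing balls, with gradients decaying like `1 / (1 + ‖z‖)`. -/
theorem exists_cutoff_sequence : ∃ (φ : ℕ → E → ℝ) (G : ℝ), 0 ≤ G ∧
    (∀ k, ContDiff ℝ 1 (φ k)) ∧ (∀ k, HasCompactSupport (φ k)) ∧ (∀ k z, |φ k z| ≤ 1) ∧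
    (∀ k z, (1 + ‖z‖) * ‖∇ (φ k) z‖ ≤ G) ∧
    (∀ (k : ℕ) z, ‖z‖ < (k : ℝ) → φ k z = 1 ∧ ∇ (φ k) z = 0) := by
  let χ : ContDiffBump (0 : E) := ⟨1, 2, one_pos, one_lt_two⟩
  have hχ : ContDiff ℝ 1 χ := χ.contDiff
  have hcont : Continuous fun y : E => (1 + ‖y‖) • ∇ χ y :=
    (continuous_const.add continuous_norm).smul (continuous_gradient hχ)
  obtain ⟨G, hG⟩ := χ.hasCompactSupport.exists_bound_of_continuousOn hcont.continuousOn
  have hG' : ∀ y, (1 + ‖y‖) * ‖∇ χ y‖ ≤ max G 0 := by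
    intro y
    by_cases hy : y ∈ tsupport χ
    · have := hG y hy
      rw [norm_smul, Real.norm_of_nonneg (by positivity)] at this
      exact this.trans (le_max_left _ _)
    · rw [gradient_eq_zero_of_notMem_tsupport hy, norm_zero, mul_zero]
      exact le_max_right _ _
  have hs : ∀ k : ℕ, (0 : ℝ) < (k + 1 : ℝ)⁻¹ := fun k => by positivity
  have hgrad : ∀ (k : ℕ) z, ∇ (fun z : E => χ ((k + 1 : ℝ)⁻¹ • z)) z
      = (k + 1 : ℝ)⁻¹ • ∇ χ ((k + 1 : ℝ)⁻¹ • z) := by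
    intro k z
    refine HasGradientAt.gradient ?_
    rw [hasGradientAt_iff_hasFDerivAt]
    have h1 : HasFDerivAt (fun z : E => (k + 1 : ℝ)⁻¹ • z)
        ((k + 1 : ℝ)⁻¹ • ContinuousLinearMap.id ℝ E) z := (hasFDerivAt_id z).const_smul _
    have h2 := (hχ.differentiable one_ne_zero ((k + 1 : ℝ)⁻¹ • z)).hasGradientAt.hasFDerivAt
    refine (h2.comp z h1).congr_fderiv ?_
    ext v
    simp
  refine ⟨fun k z => χ ((k + 1 : ℝ)⁻¹ • z), max G 0, le_max_right _ _, fun k => ?_, fun k => ?_,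
    fun k z => ?_, fun k z => ?_, fun k z hz => ?_⟩
  · exact hχ.comp (contDiff_const_smul _)
  · exact χ.hasCompactSupport.comp_smul (hs k).ne'
  · rw [abs_of_nonneg χ.nonneg]
    exact χ.le_one
  · rw [hgrad, norm_smul, Real.norm_of_nonneg (hs k).le]
    -- The bound is scale invariant up to the harmless constant: (1+‖z‖)/(k+1) ≤ 1 + ‖z‖/(k+1).
    refine le_trans ?_ (hG' ((k + 1 : ℝ)⁻¹ • z))
    rw [norm_smul, Real.norm_of_nonneg (hs k).le, ← mul_assoc]
    refine mul_le_mul_of_nonneg_right ?_ (norm_nonneg _)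
    have : (k + 1 : ℝ)⁻¹ ≤ 1 := inv_le_one_of_one_le₀ (by linarith [(Nat.cast_nonneg k : (0 : ℝ) ≤ k)])
    linarith
  · have hz1 : ‖(k + 1 : ℝ)⁻¹ • z‖ < 1 := by
      rw [norm_smul, Real.norm_of_nonneg (hs k).le, inv_mul_lt_iff₀ (by positivity)]
      linarith
    have hm : (k + 1 : ℝ)⁻¹ • z ∈ Metric.ball (0 : E) χ.rIn := by
      rw [mem_ball_zero_iff]; exact hz1
    refine ⟨χ.one_of_mem_closedBall (Metric.ball_subset_closedBall hm), ?_⟩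
    have h1 : (χ : E → ℝ) =ᶠ[𝓝 ((k + 1 : ℝ)⁻¹ • z)] fun _ => 1 := χ.eventuallyEq_one_of_mem_ball hm
    have h2 : HasGradientAt χ 0 ((k + 1 : ℝ)⁻¹ • z) := by
      rw [hasGradientAt_iff_hasFDerivAt, map_zero]
      exact (hasFDerivAt_const (1 : ℝ) _).congr_of_eventuallyEq h1
    rw [hgrad, h2.gradient, smul_zero]

variable [MeasurableSpace E] [BorelSpace E]

/-- The divergence theorem in an exterior domain, for fields of moderate growth at infinity. -/
theorem setIntegral_eq_of_hasWeakDiv {Ω : Set E} {ν : E → E} {X : E → E} {q f : E → ℝ}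
    (hΩ : IsOpen Ω) (hF : IsCompact (frontier Ω)) (hbd : ∀ z ∈ frontier Ω, HasC2BoundaryAt Ω ν z)
    (hX : HasNormalTrace Ω ν X q) (hf : IntegrableOn f Ω) (hdiv : HasWeakDiv Ω X f)
    (hgrowth : IntegrableOn (fun z => (1 + ‖z‖)⁻¹ • X z) Ω) :
    ∫ x in Ω, f x = ∫ z in frontier Ω, q z ∂μHE[Module.finrank ℝ E - 1] := by
  obtain ⟨φ, G, hG, hφ, hc, hφ1, hgrad, hφeq⟩ := exists_cutoff_sequence (E := E)
  have hgreen := fun k => green_formula hΩ hF hbd hX hf hdiv (hφ k) (hc k)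
  have hlarge : ∀ z : E, ∀ᶠ k : ℕ in atTop, ‖z‖ < (k : ℝ) := fun z =>
    tendsto_natCast_atTop_atTop.eventually_gt_atTop _
  have h1 : Tendsto (fun k => ∫ x in Ω, (inner ℝ (X x) (∇ (φ k) x) + f x * φ k x)) atTop
      (𝓝 (∫ x in Ω, f x)) := by
    refine tendsto_integral_of_dominated_convergence
      (fun x => ‖(1 + ‖x‖)⁻¹ • X x‖ * G + ‖f x‖) (fun k => ?_)
      ((hgrowth.norm.mul_const G).add hf.norm) (fun k => ae_of_all _ fun x => ?_)
      (ae_of_all _ fun x => ?_)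
    · exact ((hX.integrableOn_inner hΩ (hφ k) (hc k)).add
        (integrableOn_mul_of_hasCompactSupport hf (hφ k).continuous (hc k))).aestronglyMeasurable
    · have hpos : 0 < 1 + ‖x‖ := by positivity
      refine (norm_add_le _ _).trans (add_le_add ?_ ?_)
      · refine (norm_inner_le_norm _ _).trans ?_
        rw [norm_smul, norm_inv, Real.norm_of_nonneg hpos.le]
        -- The decay of the cut-off gradients supplies exactly the factor that makes X integrable.
        calc ‖X x‖ * ‖∇ (φ k) x‖ = (1 + ‖x‖)⁻¹ * ‖X x‖ * ((1 + ‖x‖) * ‖∇ (φ k) x‖) := by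
              field_simp
          _ ≤ _ := mul_le_mul_of_nonneg_left (hgrad k x) (by positivity)
      · rw [norm_mul]
        exact mul_le_of_le_one_right (norm_nonneg _) (hφ1 k x)
    · refine tendsto_const_nhds.congr' ?_
      filter_upwards [hlarge x] with k hk
      rw [(hφeq k x hk).1, (hφeq k x hk).2, inner_zero_right, zero_add, mul_one]
  obtain ⟨R, hR⟩ := hF.isBounded.exists_norm_le
  have h2 : ∀ᶠ k : ℕ in atTop, ∫ x in Ω, (inner ℝ (X x) (∇ (φ k) x) + f x * φ k x)
      = ∫ z in frontier Ω, q z ∂μHE[Module.finrank ℝ E - 1] := by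
    filter_upwards [tendsto_natCast_atTop_atTop.eventually_gt_atTop R] with k hk
    rw [hgreen k]
    refine setIntegral_congr_fun isClosed_frontier.measurableSet fun z hz => ?_
    rw [(hφeq k z ((hR z hz).trans_lt hk)).1, one_mul]
  exact tendsto_nhds_unique h1 (tendsto_const_nhds.congr' (h2.mono fun _ h => h.symm))

theorem integrableOn_of_continuousOn_of_eq_zero {F : Type*} [NormedAddCommGroup F] {Ω K : Set E}
    (hΩ : IsOpen Ω) (hK : IsCompact K) (hKΩ : K ⊆ Ω) {g : E → F} (hg : ContinuousOn g Ω)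
    (h0 : ∀ x ∉ K, g x = 0) : IntegrableOn g Ω :=
  ((hg.mono hKΩ).integrableOn_compact hK).of_forall_sdiff_eq_zero hΩ.measurableSet
    fun x hx => h0 x hx.2

end Exterior

/-! ### Weighted fluxes of weak solutions and their integrability. -/

variable {κ : ℕ} {n : Fin (κ + 1) → ℕ}

namespace Coefficients

variable (c : Coefficients κ n)

/-- The vector `(0, Â ∇̂u)`. -/
def diffFlux (u : Space n → ℝ) (z : Space n) : Space n := unhat (c.Amul z (hat (∇ u z)))

theorem inner_diffFlux (u : Space n → ℝ) (z v : Space n) :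
    inner ℝ (c.diffFlux u z) v = inner ℝ (c.Amul z (hat (∇ u z))) (hat v) := inner_unhat _ _

theorem inner_adjoint_diffFlux (u v : Space n → ℝ) (z : Space n) :
    inner ℝ (c.adjoint.diffFlux u z) (∇ v z) = inner ℝ (c.diffFlux v z) (∇ u z) := by
  rw [inner_diffFlux, inner_diffFlux, inner_adjoint_Amul]

/-- The field `ρ_ε (a Â ∇̂u + g (b + B z))`. -/
def flux (ε : ℝ) (u a g : Space n → ℝ) (z : Space n) : Space n :=
  c.weight ε z • (a z • c.diffFlux u z + g z • c.drift z)

/-- The normal component of the field `flux`. -/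
def fluxTrace (ε : ℝ) (D : Set (Space n)) (u a g : Space n → ℝ) (z : Space n) : ℝ :=
  c.weight ε z * (a z * c.conormalDeriv D u z + g z * inner ℝ (c.drift z) (outwardNormal D z))

namespace Regular

variable {c} {ε : ℝ}

theorem Z_pos (hc : c.Regular ε) : 0 < c.Z ε := integral_exp_pos hc.integrable_exp

theorem weight_pos (hc : c.Regular ε) (z : Space n) : 0 < c.weight ε z :=
  div_pos (Real.exp_pos _) hc.Z_pos

theorem continuous_weight (hc : c.Regular ε) : Continuous (c.weight ε) :=
  (Real.continuous_exp.comp (hc.W_continuous.neg.div_const ε)).div_const _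

theorem integrable_weight (hc : c.Regular ε) : Integrable (c.weight ε) :=
  hc.integrable_exp.div_const _

theorem isFiniteMeasure_rho (hc : c.Regular ε) : IsFiniteMeasure (c.rho ε) :=
  isFiniteMeasure_withDensity_ofReal hc.integrable_weight.2

theorem measurable_density (hc : c.Regular ε) :
    Measurable fun z => ENNReal.ofReal (c.weight ε z) :=
  hc.continuous_weight.measurable.ennreal_ofReal

theorem setIntegral_rho (hc : c.Regular ε) {D : Set (Space n)} (hD : MeasurableSet D)
    (g : Space n → ℝ) : ∫ z in D, g z ∂(c.rho ε) = ∫ z in D, c.weight ε z * g z := by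
  have h := setIntegral_withDensity_eq_setIntegral_toReal_smul (μ := volume) (s := D)
    hc.measurable_density (ae_of_all _ fun _ => ENNReal.ofReal_lt_top) g hD
  simp only [ENNReal.toReal_ofReal (hc.weight_pos _).le, smul_eq_mul] at h
  exact h

theorem integrableOn_rho_iff (hc : c.Regular ε) {F : Type*} [NormedAddCommGroup F]
    [NormedSpace ℝ F] {D : Set (Space n)} (hD : MeasurableSet D) (g : Space n → F) :
    IntegrableOn g D (c.rho ε) ↔ IntegrableOn (fun z => c.weight ε z • g z) D := by
  have h := integrable_withDensity_iff_integrable_smul' (μ := volume.restrict D)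
    hc.measurable_density (ae_of_all _ fun _ => ENNReal.ofReal_lt_top) (g := g)
  rw [← restrict_withDensity hD] at h
  simp only [ENNReal.toReal_ofReal (hc.weight_pos _).le] at h
  exact h

theorem exists_inner_Amul_le (hc : c.Regular ε) : ∃ C : ℝ, 0 ≤ C ∧
    ∀ z u v, |inner ℝ (c.Amul z u) v| ≤ C * ‖u‖ * ‖v‖ := by
  obtain ⟨M, hM⟩ := hc.A_bounded
  refine ⟨(n 0 : ℝ) * ((n 0 : ℝ) * max M 0), by positivity, fun z u v => ?_⟩
  rw [inner_Amul]
  have h : ∀ i j, |c.Ahat z i j * u j * v i| ≤ max M 0 * ‖u‖ * ‖v‖ := by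
    intro i j
    rw [abs_mul, abs_mul]
    have h1 := (hM z i j).trans (le_max_left M 0)
    have h2 : |u j| ≤ ‖u‖ := PiLp.norm_apply_le u j
    have h3 : |v i| ≤ ‖v‖ := PiLp.norm_apply_le v i
    gcongr
  refine (Finset.abs_sum_le_sum_abs _ _).trans ?_
  refine (Finset.sum_le_sum fun i _ => (Finset.abs_sum_le_sum_abs _ _).trans
    (Finset.sum_le_sum fun j _ => h i j)).trans ?_
  simp only [Finset.sum_const, Finset.card_univ, Fintype.card_fin, nsmul_eq_mul]
  exact le_of_eq (by ring)

theorem exists_norm_Amul_le (hc : c.Regular ε) : ∃ C : ℝ, 0 ≤ C ∧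
    ∀ z u, ‖c.Amul z u‖ ≤ C * ‖u‖ := by
  obtain ⟨C, hC, h⟩ := hc.exists_inner_Amul_le
  refine ⟨C, hC, fun z u => ?_⟩
  have h1 := h z u (c.Amul z u)
  rw [real_inner_self_eq_norm_sq, abs_of_nonneg (by positivity), sq] at h1
  rcases (norm_nonneg (c.Amul z u)).eq_or_lt with h0 | h0
  · rw [← h0]; positivity
  · exact le_of_mul_le_mul_right h1 h0

theorem continuous_Amul (hc : c.Regular ε) :
    Continuous fun p : Space n × EuclideanSpace ℝ (Fin (n 0)) => c.Amul p.1 p.2 := by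
  refine (PiLp.continuous_toLp 2 _).comp (continuous_pi fun i => ?_)
  simp only [Matrix.mulVec, dotProduct]
  refine continuous_finsetSum _ fun j _ => ((hc.A_continuous i j).comp continuous_fst).mul ?_
  exact (EuclideanSpace.proj (𝕜 := ℝ) j).continuous.comp continuous_snd

theorem continuousOn_diffFlux (hc : c.Regular ε) {D : Set (Space n)} (hD : IsOpen D)
    {u : Space n → ℝ} (hu : ContDiffOn ℝ 1 u D) : ContinuousOn (c.diffFlux u) D :=
  unhat.continuous.comp_continuousOn (hc.continuous_Amul.comp_continuousOn
    (continuousOn_id.prodMk (hatL.continuous.comp_continuousOn (continuousOn_gradient hD hu))))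

theorem continuous_b (hc : c.Regular ε) : Continuous c.b := by
  rw [show c.b = fun z => unhat (c.bhat z) from funext c.b_eq_unhat]
  exact unhat.continuous.comp hc.b_continuous

theorem continuous_drift (hc : c.Regular ε) : Continuous c.drift :=
  hc.continuous_b.add c.BmulL.continuous

theorem integrable_weight_smul_b (hc : c.Regular ε) : Integrable fun z => c.weight ε z • c.b z := by
  have := hc.isFiniteMeasure_rho
  have h := (hc.integrableOn_rho_iff MeasurableSet.univ c.b).1
    (hc.b_memLp.integrable one_le_two).integrableOn
  rwa [integrableOn_univ] at h

/-- The linear growth of Bz is absorbed by the factor 1/(1+‖z‖), and b is integrable because `rho`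
is finite and b is in L². -/
theorem integrable_growth_drift (hc : c.Regular ε) :
    Integrable fun z => (1 + ‖z‖)⁻¹ • c.weight ε z • c.drift z := by
  have hcont : Continuous fun z : Space n => (1 + ‖z‖)⁻¹ :=
    (continuous_const.add continuous_norm).inv₀ fun z =>
      (add_pos_of_pos_of_nonneg one_pos (norm_nonneg z)).ne'
  refine Integrable.mono' (hc.integrable_weight_smul_b.norm.add
    (hc.integrable_weight.mul_const ‖c.BmulL‖))
    (hcont.smul (hc.continuous_weight.smul hc.continuous_drift)).aestronglyMeasurable
    (ae_of_all _ fun z => ?_)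
  have hw := (hc.weight_pos z).le
  have hz : 0 < 1 + ‖z‖ := by positivity
  simp only [Pi.add_apply]
  rw [norm_smul, norm_smul, norm_smul, norm_inv, Real.norm_of_nonneg hz.le, Real.norm_of_nonneg hw,
    inv_mul_le_iff₀ hz]
  have h1 : ‖c.drift z‖ ≤ ‖c.b z‖ + ‖c.BmulL‖ * ‖z‖ :=
    (norm_add_le _ _).trans (by gcongr; exact c.BmulL.le_opNorm z)
  have h2 : 0 ≤ ‖z‖ * (c.weight ε z * ‖c.b z‖) := by positivity
  have h3 : 0 ≤ c.weight ε z * ‖c.BmulL‖ := by positivity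
  nlinarith [mul_le_mul_of_nonneg_left h1 hw]

theorem integrableOn_weight_smul_diffFlux (hc : c.Regular ε) {D : Set (Space n)} (hD : IsOpen D)
    {u : Space n → ℝ} (hu : c.IsWeakSolution ε D u) :
    IntegrableOn (fun z => c.weight ε z • c.diffFlux u z) D := by
  have := hc.isFiniteMeasure_rho
  have h := (hc.integrableOn_rho_iff hD.measurableSet _).1 (hu.memLp_grad.integrable one_le_two)
  obtain ⟨C, hC, hA⟩ := hc.exists_norm_Amul_le
  refine Integrable.mono' (h.norm.const_mul (‖(unhat : _ →L[ℝ] Space n)‖ * C))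
    ((hc.continuous_weight.continuousOn.smul
      (hc.continuousOn_diffFlux hD hu.contDiffOn)).aestronglyMeasurable hD.measurableSet)
    (ae_of_all _ fun z => ?_)
  rw [norm_smul, norm_smul]
  have h1 : ‖c.diffFlux u z‖ ≤ ‖(unhat : _ →L[ℝ] Space n)‖ * (C * ‖hat (∇ u z)‖) :=
    (unhat.le_opNorm _).trans (by gcongr; exact hA _ _)
  calc _ ≤ ‖c.weight ε z‖ * (‖(unhat : _ →L[ℝ] Space n)‖ * (C * ‖hat (∇ u z)‖)) := by gcongr
    _ = _ := by ring

/-- The energy density of a weak solution is integrable. -/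
theorem integrableOn_weight_mul_inner_diffFlux (hc : c.Regular ε) {D : Set (Space n)}
    (hD : IsOpen D) {u : Space n → ℝ} (hu : c.IsWeakSolution ε D u) :
    IntegrableOn (fun z => c.weight ε z * inner ℝ (c.diffFlux u z) (∇ u z)) D := by
  have := hc.isFiniteMeasure_rho
  have h := (hc.integrableOn_rho_iff hD.measurableSet _).1 hu.memLp_grad.integrable_norm_pow'
  obtain ⟨C, hC, hA⟩ := hc.exists_inner_Amul_le
  refine Integrable.mono' (h.norm.const_mul C)
    ((hc.continuous_weight.continuousOn.mul (ContinuousOn.inner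
      (hc.continuousOn_diffFlux hD hu.contDiffOn)
      (continuousOn_gradient hD hu.contDiffOn))).aestronglyMeasurable hD.measurableSet)
    (ae_of_all _ fun z => ?_)
  rw [norm_mul, norm_smul, inner_diffFlux]
  have h1 := hA z (hat (∇ u z)) (hat (∇ u z))
  calc _ ≤ ‖c.weight ε z‖ * (C * ‖hat (∇ u z)‖ * ‖hat (∇ u z)‖) := by gcongr; exact h1
    _ = _ := by
      simp [sq]; ring

theorem integrableOn_growth_flux (hc : c.Regular ε) {D : Set (Space n)} (hD : IsOpen D)
    {u a g : Space n → ℝ} (hu : c.IsWeakSolution ε D u) (ha : ContinuousOn a D)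
    (hg : ContinuousOn g D) {K : ℝ} (hKa : ∀ z, |a z| ≤ K) (hKg : ∀ z, |g z| ≤ K) :
    IntegrableOn (fun z => (1 + ‖z‖)⁻¹ • c.flux ε u a g z) D := by
  have hcont : Continuous fun z : Space n => (1 + ‖z‖)⁻¹ :=
    (continuous_const.add continuous_norm).inv₀ fun z =>
      (add_pos_of_pos_of_nonneg one_pos (norm_nonneg z)).ne'
  have hb : ∀ z : Space n, ‖(1 + ‖z‖)⁻¹ * a z‖ ≤ K := fun z => by
    have hz : (1 + ‖z‖)⁻¹ ≤ 1 := inv_le_one_of_one_le₀ (by linarith [norm_nonneg z])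
    have hz0 : 0 ≤ (1 + ‖z‖)⁻¹ := by positivity
    rw [norm_mul, Real.norm_of_nonneg hz0]
    exact (mul_le_of_le_one_left (norm_nonneg _) hz).trans (hKa z)
  have h1 := (hc.integrableOn_weight_smul_diffFlux hD hu).bdd_smul K
    ((hcont.continuousOn.mul ha).aestronglyMeasurable hD.measurableSet) (ae_of_all _ hb)
  have h2 := (hc.integrable_growth_drift.integrableOn (s := D)).bdd_smul K
    (hg.aestronglyMeasurable hD.measurableSet) (ae_of_all _ hKg)
  refine (h1.add h2).congr (ae_of_all _ fun z => ?_)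
  simp only [flux, Pi.add_apply, Pi.smul_apply', Pi.mul_apply, smul_add, smul_smul]
  congr 2 <;> ring

end Regular

end Coefficients

/-! ### Normal traces of the fluxes and the weak equations in Lebesgue form. -/

theorem HasNormalTrace.add {E : Type*} [NormedAddCommGroup E] [InnerProductSpace ℝ E]
    [FiniteDimensional ℝ E] [MeasurableSpace E] [BorelSpace E] {Ω : Set E} {ν X Y : E → E}
    {p q : E → ℝ} (hX : HasNormalTrace Ω ν X p) (hY : HasNormalTrace Ω ν Y q) :
    HasNormalTrace Ω ν (fun z => X z + Y z) fun z => p z + q z where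
  continuousOn := hX.continuousOn.add hY.continuousOn
  integrableOn K hK := (hX.integrableOn K hK).add (hY.integrableOn K hK)
  tendsto z hz := by
    simp only [inner_add_left]
    exact (hX.tendsto z hz).add (hY.tendsto z hz)
  bounded := by
    obtain ⟨M, r, hr, hM⟩ := hX.bounded
    obtain ⟨M', r', hr', hM'⟩ := hY.bounded
    refine ⟨M + M', min r r', lt_min hr hr', fun z hz δ hδ => ?_⟩
    rw [inner_add_left]
    exact (abs_add_le _ _).trans (add_le_add
      (hM z hz δ ⟨hδ.1, hδ.2.trans_le (min_le_left _ _)⟩)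
      (hM' z hz δ ⟨hδ.1, hδ.2.trans_le (min_le_right _ _)⟩))

variable {κ : ℕ} {n : Fin (κ + 1) → ℕ}

namespace Coefficients

namespace Regular

variable {c : Coefficients κ n} {ε : ℝ}

/-- Along a normal the diffusive part is the conormal quotient, which has a bounded limit by
hypothesis; every other factor is continuous up to the boundary. The global bounds on a and g serve
integrability at infinity as well, which is why unbounded potentials must be truncated. -/
theorem hasNormalTrace_flux (hc : c.Regular ε) {D : Set (Space n)} (hD : IsOpen D)
    (hF : IsCompact (frontier D)) (hbd : ∀ z ∈ frontier D, HasC2BoundaryAt D (outwardNormal D) z)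
    {u a g : Space n → ℝ} (hu : c.IsWeakSolution ε D u) (hcon : c.HasBoundedConormalDeriv D u)
    (ha : ContinuousOn a (closure D)) (hg : ContinuousOn g (closure D)) {K : ℝ}
    (hKa : ∀ z, |a z| ≤ K) (hKg : ∀ z, |g z| ≤ K) :
    HasNormalTrace D (outwardNormal D) (c.flux ε u a g) (c.fluxTrace ε D u a g) := by
  have haD := ha.mono subset_closure
  have hgD := hg.mono subset_closure
  have hcont : ContinuousOn (c.flux ε u a g) D :=
    hc.continuous_weight.continuousOn.smul ((haD.smul (hc.continuousOn_diffFlux hD hu.contDiffOn)).add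
      (hgD.smul hc.continuous_drift.continuousOn))
  have hinner : ∀ z δ, inner ℝ (c.flux ε u a g (z - δ • outwardNormal D z)) (outwardNormal D z)
      = c.weight ε (z - δ • outwardNormal D z) * (a (z - δ • outwardNormal D z)
        * c.conormalQuotient D u z δ + g (z - δ • outwardNormal D z)
          * inner ℝ (c.drift (z - δ • outwardNormal D z)) (outwardNormal D z)) := by
    intro z δ
    rw [flux, real_inner_smul_left, inner_add_left, real_inner_smul_left, real_inner_smul_left,
      inner_diffFlux, conormalQuotient]
  refine ⟨hcont, fun L hL => ?_, fun z hz => ?_, ?_⟩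
  · have hm : MeasurableSet (D ∩ L) := hD.measurableSet.inter hL.isClosed.measurableSet
    have h1 := (hc.integrableOn_growth_flux hD hu haD hgD hKa hKg).mono_set
      (inter_subset_left (t := L))
    obtain ⟨R, hR⟩ := hL.isBounded.exists_norm_le
    have h2 := h1.bdd_smul (φ := fun z => 1 + ‖z‖) (1 + R)
      (continuous_const.add continuous_norm).aestronglyMeasurable
      ((ae_restrict_iff' hm).2 (ae_of_all _ fun z hz => by
        rw [Real.norm_of_nonneg (by positivity)]
        linarith [hR z hz.2]))
    refine h2.congr (ae_of_all _ fun z => ?_)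
    have hz : 1 + ‖z‖ ≠ 0 := (add_pos_of_pos_of_nonneg one_pos (norm_nonneg z)).ne'
    simp only [Pi.smul_apply', smul_smul, mul_inv_cancel₀ hz, one_smul]
  · simp only [hinner]
    have hlim : Tendsto (fun δ : ℝ => z - δ • outwardNormal D z) (𝓝[>] 0) (𝓝 z) := by
      have h1 : Continuous fun δ : ℝ => z - δ • outwardNormal D z := by fun_prop
      have h2 := h1.tendsto 0
      rw [zero_smul, sub_zero] at h2
      exact h2.mono_left nhdsWithin_le_nhds
    have hlim' : Tendsto (fun δ : ℝ => z - δ • outwardNormal D z) (𝓝[>] 0) (𝓝[closure D] z) :=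
      tendsto_nhdsWithin_iff.2 ⟨hlim, (HasC2BoundaryAt.eventually_mem hz (hbd z hz)).mono
        fun δ h => subset_closure h⟩
    have hzc : z ∈ closure D := frontier_subset_closure hz
    exact ((hc.continuous_weight.tendsto z).comp hlim).mul ((((ha z hzc).tendsto.comp hlim').mul
      (tendsto_nhds_limUnder (hcon.1 z hz))).add (((hg z hzc).tendsto.comp hlim').mul
        (((hc.continuous_drift.tendsto z).comp hlim).inner tendsto_const_nhds)))
  · obtain ⟨M, r, hr, hM⟩ := hcon.2
    -- The normal segments of length less than 1 stay in this compact set, where weight and drift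
    -- are bounded.
    have hT : IsCompact (Metric.cthickening 1 (frontier D)) := hF.cthickening
    obtain ⟨w, hw⟩ := hT.exists_bound_of_continuousOn hc.continuous_weight.continuousOn
    obtain ⟨v, hv⟩ := hT.exists_bound_of_continuousOn hc.continuous_drift.continuousOn
    refine ⟨w * (K * M + K * v), min r 1, lt_min hr one_pos, fun z hz δ hδ => ?_⟩
    rw [hinner]
    set y := z - δ • outwardNormal D z with hy
    have hν : ‖outwardNormal D z‖ = 1 := HasC2BoundaryAt.norm_eq_one hz (hbd z hz)
    have hyT : y ∈ Metric.cthickening 1 (frontier D) := by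
      refine Metric.mem_cthickening_of_dist_le _ z _ _ hz ?_
      rw [hy, dist_eq_norm, sub_sub_cancel_left, norm_neg, norm_smul, hν, mul_one,
        Real.norm_of_nonneg hδ.1.le]
      exact hδ.2.le.trans (min_le_right _ _)
    have h1 : |c.weight ε y| ≤ w := hw y hyT
    have h2 : |inner ℝ (c.drift y) (outwardNormal D z)| ≤ v :=
      (abs_real_inner_le_norm _ _).trans (by rw [hν, mul_one]; exact hv y hyT)
    have h3 := hM z hz δ hδ.1 (hδ.2.trans_le (min_le_left _ _))
    have h4 := hKa y
    have h5 := hKg y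
    have hK : 0 ≤ K := (abs_nonneg _).trans h4
    rw [abs_mul]
    refine mul_le_mul h1 ((abs_add_le _ _).trans ?_) (abs_nonneg _) ((abs_nonneg _).trans h1)
    rw [abs_mul, abs_mul]
    gcongr

/-- The divergence-free condition, tested in an open set and integrated against Lebesgue
measure. -/
theorem integral_weight_drift_eq_zero (hc : c.Regular ε) {D : Set (Space n)}
    {φ : Space n → ℝ} (hφ : ContDiff ℝ 1 φ) (hφc : HasCompactSupport φ) (hs : tsupport φ ⊆ D) :
    ∫ z in D, c.weight ε z * inner ℝ (c.drift z) (∇ φ z) = 0 := by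
  have h := hc.divFree φ hφ hφc
  rw [← setIntegral_univ, hc.setIntegral_rho MeasurableSet.univ, setIntegral_univ] at h
  rw [setIntegral_eq_integral_of_forall_compl_eq_zero, h]
  intro z hz
  rw [gradient_eq_zero_of_notMem_tsupport fun h => hz (hs h), inner_zero_right, mul_zero]

theorem integrableOn_weight_drift (hc : c.Regular ε) {D : Set (Space n)} (hD : IsOpen D)
    {φ : Space n → ℝ} (hφ : ContDiff ℝ 1 φ) (hφc : HasCompactSupport φ) (hs : tsupport φ ⊆ D) :
    IntegrableOn (fun z => c.weight ε z * inner ℝ (c.drift z) (∇ φ z)) D := by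
  refine integrableOn_of_continuousOn_of_eq_zero hD hφc hs (hc.continuous_weight.mul
    (hc.continuous_drift.inner (continuous_gradient hφ))).continuousOn fun z hz => ?_
  rw [gradient_eq_zero_of_notMem_tsupport hz, inner_zero_right, mul_zero]

theorem integrableOn_weight_diffFlux (hc : c.Regular ε) {D : Set (Space n)} (hD : IsOpen D)
    {u : Space n → ℝ} (hu : c.IsWeakSolution ε D u)
    {φ : Space n → ℝ} (hφ : ContDiff ℝ 1 φ) (hφc : HasCompactSupport φ) (hs : tsupport φ ⊆ D) :
    IntegrableOn (fun z => c.weight ε z * (ε * inner ℝ (c.diffFlux u z) (∇ φ z)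
      - φ z * inner ℝ (c.drift z) (∇ u z))) D := by
  refine integrableOn_of_continuousOn_of_eq_zero hD hφc hs (hc.continuous_weight.continuousOn.mul
    ((continuousOn_const.mul (ContinuousOn.inner (hc.continuousOn_diffFlux hD hu.contDiffOn)
      (continuous_gradient hφ).continuousOn)).sub (hφ.continuous.continuousOn.mul
        (ContinuousOn.inner hc.continuous_drift.continuousOn
          (continuousOn_gradient hD hu.contDiffOn))))) fun z hz => ?_
  rw [gradient_eq_zero_of_notMem_tsupport hz, image_eq_zero_of_notMem_tsupport hz,
    inner_zero_right, mul_zero, zero_mul, sub_zero, mul_zero]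

/-- The weak equation with the derivatives in the drift term on the solution. -/
theorem integral_weak_eq_zero (hc : c.Regular ε) {D : Set (Space n)} (hD : IsOpen D)
    {u : Space n → ℝ} (hu : c.IsWeakSolution ε D u)
    {φ : Space n → ℝ} (hφ : ContDiff ℝ 1 φ) (hφc : HasCompactSupport φ) (hs : tsupport φ ⊆ D) :
    ∫ z in D, c.weight ε z * (ε * inner ℝ (c.diffFlux u z) (∇ φ z)
      - φ z * inner ℝ (c.drift z) (∇ u z)) = 0 := by
  have h1 := hu.eqn φ hφ hφc hs
  rw [hc.setIntegral_rho hD.measurableSet] at h1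
  have hφu := contDiff_mul_of_tsupport_subset hD hφ hs hu.contDiffOn
  have hsub : (tsupport fun z => φ z * u z) ⊆ tsupport φ := tsupport_mul_subset_left
  have hφuc := hφc.of_isClosed_subset (isClosed_tsupport _) hsub
  -- Testing the divergence-free condition with φu moves the drift derivative from φ to u.
  have h2 := hc.integral_weight_drift_eq_zero hφu hφuc (hsub.trans hs)
  have hi1 := hc.integrableOn_weight_diffFlux hD hu hφ hφc hs
  have hi2 := hc.integrableOn_weight_drift hD hφu hφuc (hsub.trans hs)
  have h3 := integral_add hi1 hi2
  rw [h2, add_zero] at h3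
  rw [← h3, ← h1]
  refine setIntegral_congr_fun hD.measurableSet fun z hz => ?_
  rw [gradient_mul_of_tsupport_subset hD hφ hs hu.contDiffOn, inner_add_right,
    real_inner_smul_right, real_inner_smul_right, inner_diffFlux]
  ring

end Regular

end Coefficients

/-! ### Smooth truncations of the identity. -/

/-- `T` is a bounded `C²` truncation of the identity at height `k`, with derivatives `T₁`, `T₂`. -/
structure IsTruncation (T T₁ T₂ : ℝ → ℝ) (k C : ℝ) : Prop where
  hasDerivAt : ∀ s, HasDerivAt T (T₁ s) s
  hasDerivAt_deriv : ∀ s, HasDerivAt T₁ (T₂ s) s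
  continuous : Continuous T₂
  eq_self : ∀ s, |s| < k → T s = s
  deriv_eq_one : ∀ s, |s| < k → T₁ s = 1
  deriv_two_eq_zero : ∀ s, |s| < k → T₂ s = 0
  bounded : ∃ K, ∀ s, |T s| ≤ K
  abs_deriv_le : ∀ s, |T₁ s| ≤ 1
  abs_mul_le : ∀ s t, |T₂ s * T t| ≤ C

/-- All truncations are rescalings kT(s/k) of one primitive T of a bump function. The second
derivative scales like 1/k and T like k, so their product is bounded by a constant that does not
depend on k. -/
theorem exists_isTruncation :
    ∃ C, ∀ k : ℝ, 0 < k → ∃ T T₁ T₂ : ℝ → ℝ, IsTruncation T T₁ T₂ k C := by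
  let χ : ContDiffBump (0 : ℝ) := ⟨1, 2, one_pos, one_lt_two⟩
  have hχ : ContDiff ℝ 1 χ := χ.contDiff
  let T : ℝ → ℝ := fun s => ∫ t in (0 : ℝ)..s, χ t
  have hT : ∀ s, HasDerivAt T (χ s) s := fun s =>
    intervalIntegral.integral_hasDerivAt_right (hχ.continuous.intervalIntegrable _ _)
      hχ.continuous.stronglyMeasurable.stronglyMeasurableAtFilter hχ.continuous.continuousAt
  have hintg : Integrable fun t => ‖χ t‖ :=
    (hχ.continuous.integrable_of_hasCompactSupport χ.hasCompactSupport).norm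
  have hTb : ∀ s, |T s| ≤ ∫ t, ‖χ t‖ := fun s =>
    intervalIntegral.norm_integral_le_integral_norm_uIoc.trans
      (setIntegral_le_integral hintg (ae_of_all _ fun t => norm_nonneg _))
  have hdc : Continuous (deriv χ) := hχ.continuous_deriv le_rfl
  obtain ⟨C', hC'⟩ := hdc.bounded_above_of_compact_support χ.hasCompactSupport.deriv
  have hone : ∀ t : ℝ, |t| < 1 → χ =ᶠ[𝓝 t] 1 := fun t ht =>
    χ.eventuallyEq_one_of_mem_ball (by rw [mem_ball_zero_iff]; exact ht)
  refine ⟨C' * ∫ t, ‖χ t‖, fun k hk =>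
    ⟨fun s => k * T (s / k), fun s => χ (s / k), fun s => deriv χ (s / k) / k, ?_⟩⟩
  have hdiv : ∀ s, HasDerivAt (fun s : ℝ => s / k) (1 / k) s := fun s =>
    (hasDerivAt_id s).div_const k
  have hlt : ∀ s, |s| < k → |s / k| < 1 := fun s hs => by
    rw [abs_div, abs_of_pos hk, div_lt_one hk]; exact hs
  refine ⟨fun s => ?_, fun s => ?_, ?_, fun s hs => ?_, fun s hs => ?_, fun s hs => ?_, ?_,
    fun s => ?_, fun s t => ?_⟩
  · refine (((hT (s / k)).comp s (hdiv s)).const_mul k).congr_deriv ?_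
    field_simp
  · refine (((hχ.differentiable one_ne_zero) (s / k)).hasDerivAt.comp s (hdiv s)).congr_deriv ?_
    ring
  · exact (hdc.comp (continuous_id.div_const k)).div_const k
  · have h1 : T (s / k) = ∫ t in (0 : ℝ)..(s / k), (1 : ℝ) := by
      refine intervalIntegral.integral_congr fun t ht => ?_
      refine (hone t ?_).eq_of_nhds
      have := abs_sub_left_of_mem_uIcc ht
      simp only [sub_zero] at this
      exact this.trans_lt (hlt s hs)
    rw [h1]
    simp
    field_simp
  · exact (hone _ (hlt s hs)).eq_of_nhds
  · rw [(hone _ (hlt s hs)).deriv_eq]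
    simp
  · refine ⟨k * ∫ t, ‖χ t‖, fun s => ?_⟩
    rw [abs_mul, abs_of_pos hk]
    exact mul_le_mul_of_nonneg_left (hTb _) hk.le
  · rw [abs_of_nonneg χ.nonneg]
    exact χ.le_one
  · have : deriv χ (s / k) / k * (k * T (t / k)) = deriv χ (s / k) * T (t / k) := by
      field_simp
    rw [this, abs_mul]
    exact mul_le_mul (hC' _) (hTb _) (abs_nonneg _) ((norm_nonneg _).trans (hC' (s / k)))

namespace IsTruncation

variable {T T₁ T₂ : ℝ → ℝ} {k C : ℝ}

theorem contDiff_deriv (hT : IsTruncation T T₁ T₂ k C) : ContDiff ℝ 1 T₁ := by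
  rw [contDiff_one_iff_deriv]
  refine ⟨fun s => (hT.hasDerivAt_deriv s).differentiableAt, ?_⟩
  rw [show deriv T₁ = T₂ from funext fun s => (hT.hasDerivAt_deriv s).deriv]
  exact hT.continuous

theorem contDiff (hT : IsTruncation T T₁ T₂ k C) : ContDiff ℝ 1 T := by
  rw [contDiff_one_iff_deriv]
  refine ⟨fun s => (hT.hasDerivAt s).differentiableAt, ?_⟩
  rw [show deriv T = T₁ from funext fun s => (hT.hasDerivAt s).deriv]
  exact hT.contDiff_deriv.continuous

end IsTruncation

/-! ### Green's second identity by truncation. -/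

variable {κ : ℕ} {n : Fin (κ + 1) → ℕ}

namespace Coefficients

/-- The divergence of the truncated field. -/
def truncationDefect (c : Coefficients κ n) (ε : ℝ) (h w : Space n → ℝ) (T T₂ : ℝ → ℝ)
    (z : Space n) : ℝ :=
  ε * (T₂ (h z) * T (w z) * (c.weight ε z * inner ℝ (c.diffFlux h z) (∇ h z))
    - T₂ (w z) * T (h z) * (c.weight ε z * inner ℝ (c.adjoint.diffFlux w z) (∇ w z)))

variable {c : Coefficients κ n} {ε : ℝ} {T T₁ T₂ : ℝ → ℝ} {k C : ℝ}

namespace Regular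

/-- The field is ρ times ε T₁(h)T(w)Â∇̂h − ε T(h)T₁(w)Âᵀ∇̂w + T(h)T(w)d, formally the identity
tested with truncated potentials. The mixed terms T₁(h)T₁(w) and all drift derivatives cancel; what
remains comes from differentiating T₁ and carries the factor T₂. -/
theorem hasWeakDiv_truncated (hc : c.Regular ε) {D : Set (Space n)} (hD : IsOpen D)
    {h w : Space n → ℝ} (hh : c.IsWeakSolution ε D h) (hw : c.adjoint.IsWeakSolution ε D w)
    (hT : IsTruncation T T₁ T₂ k C) :
    HasWeakDiv D (fun z => c.flux ε h (fun z => ε * (T₁ (h z) * T (w z)))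
        (fun z => T (h z) * T (w z)) z
      + c.adjoint.flux ε w (fun z => -(ε * (T (h z) * T₁ (w z)))) (fun _ => 0) z)
      (c.truncationDefect ε h w T T₂) := by
  intro φ hφ hφc hs
  have hTc := hT.contDiff
  have hT1c := hT.contDiff_deriv
  have hhd := hh.contDiffOn
  have hwd := hw.contDiffOn
  have e1 : ContDiffOn ℝ 1 (fun z => T₁ (h z) * T (w z)) D :=
    (hT1c.comp_contDiffOn hhd).mul (hTc.comp_contDiffOn hwd)
  have e2 : ContDiffOn ℝ 1 (fun z => T (h z) * T₁ (w z)) D :=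
    (hTc.comp_contDiffOn hhd).mul (hT1c.comp_contDiffOn hwd)
  have e3 : ContDiffOn ℝ 1 (fun z => T (h z) * T (w z)) D :=
    (hTc.comp_contDiffOn hhd).mul (hTc.comp_contDiffOn hwd)
  have hsub : ∀ v : Space n → ℝ, (tsupport fun z => φ z * v z) ⊆ tsupport φ :=
    fun v => tsupport_mul_subset_left
  have hcs : ∀ v : Space n → ℝ, HasCompactSupport fun z => φ z * v z := fun v =>
    hφc.of_isClosed_subset (isClosed_tsupport _) (hsub v)
  have f1 := contDiff_mul_of_tsupport_subset hD hφ hs e1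
  have f2 := contDiff_mul_of_tsupport_subset hD hφ hs e2
  have f3 := contDiff_mul_of_tsupport_subset hD hφ hs e3
  -- The combination is: equation of h with φT₁(h)T(w), minus equation of w with φT(h)T₁(w), plus
  -- the divergence-free condition with φT(h)T(w).
  have I1 := hc.integral_weak_eq_zero hD hh f1 (hcs _) ((hsub _).trans hs)
  have I2 := hc.adjoint.integral_weak_eq_zero hD hw f2 (hcs _) ((hsub _).trans hs)
  have I3 := hc.integral_weight_drift_eq_zero f3 (hcs _) ((hsub _).trans hs)
  have i1 := hc.integrableOn_weight_diffFlux hD hh f1 (hcs _) ((hsub _).trans hs)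
  have i2 := hc.adjoint.integrableOn_weight_diffFlux hD hw f2 (hcs _) ((hsub _).trans hs)
  have i3 := hc.integrableOn_weight_drift hD f3 (hcs _) ((hsub _).trans hs)
  have I12 := integral_sub i1 i2
  have I123 := integral_add (i1.sub i2) i3
  simp only [Pi.sub_apply] at I123
  rw [I12, I1, I2, I3, sub_zero, add_zero] at I123
  refine Eq.trans ?_ I123
  refine setIntegral_congr_fun hD.measurableSet fun z hz => ?_
  have hhz : DifferentiableAt ℝ h z :=
    ((hhd z hz).contDiffAt (hD.mem_nhds hz)).differentiableAt one_ne_zero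
  have hwz : DifferentiableAt ℝ w z :=
    ((hwd z hz).contDiffAt (hD.mem_nhds hz)).differentiableAt one_ne_zero
  have dT : ∀ s, DifferentiableAt ℝ T s := fun s => (hT.hasDerivAt s).differentiableAt
  have dT1 : ∀ s, DifferentiableAt ℝ T₁ s := fun s => (hT.hasDerivAt_deriv s).differentiableAt
  have g1 : ∇ (fun z => T₁ (h z) * T (w z)) z
      = T₁ (h z) • T₁ (w z) • ∇ w z + T (w z) • T₂ (h z) • ∇ h z := by
    rw [gradient_mul (u := fun z => T₁ (h z)) (v := fun z => T (w z))
      ((dT1 _).comp z hhz) ((dT _).comp z hwz),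
      gradient_comp (hT.hasDerivAt_deriv _) hhz, gradient_comp (hT.hasDerivAt _) hwz]
  have g2 : ∇ (fun z => T (h z) * T₁ (w z)) z
      = T (h z) • T₂ (w z) • ∇ w z + T₁ (w z) • T₁ (h z) • ∇ h z := by
    rw [gradient_mul (u := fun z => T (h z)) (v := fun z => T₁ (w z))
      ((dT _).comp z hhz) ((dT1 _).comp z hwz),
      gradient_comp (hT.hasDerivAt_deriv _) hwz, gradient_comp (hT.hasDerivAt _) hhz]
  have g3 : ∇ (fun z => T (h z) * T (w z)) z
      = T (h z) • T₁ (w z) • ∇ w z + T (w z) • T₁ (h z) • ∇ h z := by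
    rw [gradient_mul (u := fun z => T (h z)) (v := fun z => T (w z))
      ((dT _).comp z hhz) ((dT _).comp z hwz),
      gradient_comp (hT.hasDerivAt _) hwz, gradient_comp (hT.hasDerivAt _) hhz]
  have hadj : c.adjoint.weight ε z = c.weight ε z := rfl
  simp only
  rw [gradient_mul_of_tsupport_subset hD hφ hs e1, gradient_mul_of_tsupport_subset hD hφ hs e2,
    gradient_mul_of_tsupport_subset hD hφ hs e3, g1, g2, g3]
  simp only [flux, truncationDefect, hadj, adjoint_drift, inner_add_left, inner_add_right,
    real_inner_smul_left, real_inner_smul_right, inner_neg_left]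
  rw [c.inner_adjoint_diffFlux w h]
  ring

theorem integrableOn_truncationDefect (hc : c.Regular ε) {D : Set (Space n)} (hD : IsOpen D)
    {h w : Space n → ℝ} (hh : c.IsWeakSolution ε D h) (hw : c.adjoint.IsWeakSolution ε D w)
    (hT : IsTruncation T T₁ T₂ k C) : IntegrableOn (c.truncationDefect ε h w T T₂) D := by
  have hch := hh.contDiffOn.continuousOn
  have hcw := hw.contDiffOn.continuousOn
  have h1 := (hc.integrableOn_weight_mul_inner_diffFlux hD hh).bdd_mul (c := C)
    (((hT.continuous.comp_continuousOn hch).mul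
      (hT.contDiff.continuous.comp_continuousOn hcw)).aestronglyMeasurable hD.measurableSet)
    (ae_of_all _ fun z => hT.abs_mul_le (h z) (w z))
  have h2 := (hc.adjoint.integrableOn_weight_mul_inner_diffFlux hD hw).bdd_mul (c := C)
    (((hT.continuous.comp_continuousOn hcw).mul
      (hT.contDiff.continuous.comp_continuousOn hch)).aestronglyMeasurable hD.measurableSet)
    (ae_of_all _ fun z => hT.abs_mul_le (w z) (h z))
  exact (h1.sub h2).const_mul ε

theorem abs_truncationDefect_le (hT : IsTruncation T T₁ T₂ k C) (h w : Space n → ℝ)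
    (z : Space n) : |c.truncationDefect ε h w T T₂ z| ≤ |ε| *
      (C * |c.weight ε z * inner ℝ (c.diffFlux h z) (∇ h z)|
        + C * |c.weight ε z * inner ℝ (c.adjoint.diffFlux w z) (∇ w z)|) := by
  rw [truncationDefect, abs_mul]
  refine mul_le_mul_of_nonneg_left ((abs_sub _ _).trans ?_) (abs_nonneg _)
  rw [abs_mul, abs_mul (T₂ (w z) * T (h z))]
  gcongr
  · exact hT.abs_mul_le _ _
  · exact hT.abs_mul_le _ _

theorem setIntegral_truncationDefect (hc : c.Regular ε) {D : Set (Space n)} (hD : IsOpen D)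
    (hF : IsCompact (frontier D)) (hbd : ∀ z ∈ frontier D, HasC2BoundaryAt D (outwardNormal D) z)
    {h w : Space n → ℝ} (hh : c.IsWeakSolution ε D h) (hw : c.adjoint.IsWeakSolution ε D w)
    (hhc : ContinuousOn h (closure D)) (hwc : ContinuousOn w (closure D))
    (hhn : c.HasBoundedConormalDeriv D h) (hwn : c.adjoint.HasBoundedConormalDeriv D w)
    (hT : IsTruncation T T₁ T₂ k C) :
    ∫ z in D, c.truncationDefect ε h w T T₂ z
      = ∫ z in frontier D, (c.fluxTrace ε D h (fun z => ε * (T₁ (h z) * T (w z)))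
        (fun z => T (h z) * T (w z)) z
      + c.adjoint.fluxTrace ε D w (fun z => -(ε * (T (h z) * T₁ (w z)))) (fun _ => 0) z)
      ∂(surfaceMeasure n) := by
  obtain ⟨K, hK⟩ := hT.bounded
  have hK0 : 0 ≤ K := (abs_nonneg _).trans (hK 0)
  have cT := hT.contDiff.continuous
  have cT1 := hT.contDiff_deriv.continuous
  have a1 : ContinuousOn (fun z => ε * (T₁ (h z) * T (w z))) (closure D) :=
    continuousOn_const.mul ((cT1.comp_continuousOn hhc).mul (cT.comp_continuousOn hwc))
  have a2 : ContinuousOn (fun z => T (h z) * T (w z)) (closure D) :=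
    (cT.comp_continuousOn hhc).mul (cT.comp_continuousOn hwc)
  have a3 : ContinuousOn (fun z => -(ε * (T (h z) * T₁ (w z)))) (closure D) :=
    (continuousOn_const.mul ((cT.comp_continuousOn hhc).mul (cT1.comp_continuousOn hwc))).neg
  -- The sum is a common bound for the diffusive coefficients (first summand) and the drift
  -- coefficient (second), as one constant has to serve both.
  have b1 : ∀ z, |ε * (T₁ (h z) * T (w z))| ≤ |ε| * (1 * K) + K * K := fun z => by
    rw [abs_mul, abs_mul]
    have := mul_le_mul (hT.abs_deriv_le (h z)) (hK (w z)) (abs_nonneg _) zero_le_one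
    nlinarith [abs_nonneg ε, mul_le_mul_of_nonneg_left this (abs_nonneg ε)]
  have b2 : ∀ z, |T (h z) * T (w z)| ≤ |ε| * (1 * K) + K * K := fun z => by
    rw [abs_mul]
    have := mul_le_mul (hK (h z)) (hK (w z)) (abs_nonneg _) hK0
    nlinarith [mul_nonneg (abs_nonneg ε) hK0]
  have b3 : ∀ z, |-(ε * (T (h z) * T₁ (w z)))| ≤ |ε| * (1 * K) + K * K := fun z => by
    rw [abs_neg, abs_mul, abs_mul, mul_comm |T (h z)|]
    have := mul_le_mul (hT.abs_deriv_le (w z)) (hK (h z)) (abs_nonneg _) zero_le_one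
    nlinarith [abs_nonneg ε, mul_le_mul_of_nonneg_left this (abs_nonneg ε)]
  have b4 : ∀ z : Space n, |(fun _ => (0 : ℝ)) z| ≤ |ε| * (1 * K) + K * K := fun z => by
    simp only [abs_zero]; positivity
  have t1 := hc.hasNormalTrace_flux hD hF hbd hh hhn a1 a2 b1 b2
  have t2 := hc.adjoint.hasNormalTrace_flux hD hF hbd hw hwn a3 continuousOn_const b3 b4
  have r1 := hc.integrableOn_growth_flux hD hh (a1.mono subset_closure) (a2.mono subset_closure)
    b1 b2
  have r2 := hc.adjoint.integrableOn_growth_flux hD hw (a3.mono subset_closure)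
    continuousOn_const b3 b4
  rw [surfaceMeasure_eq]
  refine setIntegral_eq_of_hasWeakDiv hD hF hbd (t1.add t2)
    (hc.integrableOn_truncationDefect hD hh hw hT) (hc.hasWeakDiv_truncated hD hh hw hT) ?_
  simp only [smul_add]
  exact r1.add r2

/-- Green's second identity for a solution and an adjoint solution. -/
theorem integral_frontier_eq_zero (hc : c.Regular ε) {D : Set (Space n)} (hD : IsOpen D)
    (hF : IsCompact (frontier D)) (hbd : ∀ z ∈ frontier D, HasC2BoundaryAt D (outwardNormal D) z)
    {h w : Space n → ℝ} (hh : c.IsWeakSolution ε D h) (hw : c.adjoint.IsWeakSolution ε D w)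
    (hhc : ContinuousOn h (closure D)) (hwc : ContinuousOn w (closure D))
    (hhn : c.HasBoundedConormalDeriv D h) (hwn : c.adjoint.HasBoundedConormalDeriv D w) :
    ∫ z in frontier D, (c.fluxTrace ε D h (fun z => ε * w z) (fun z => h z * w z) z
      + c.adjoint.fluxTrace ε D w (fun z => -(ε * h z)) (fun _ => 0) z)
      ∂(surfaceMeasure n) = 0 := by
  obtain ⟨C, hC⟩ := exists_isTruncation
  choose T T₁ T₂ hT using fun k : ℕ => hC (k + 1) (by positivity)
  have hlarge : ∀ R : ℝ, ∀ᶠ k : ℕ in atTop, R < (k : ℝ) + 1 := fun R => by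
    filter_upwards [tendsto_natCast_atTop_atTop.eventually_gt_atTop R] with k hk
    linarith
  have h1 : Tendsto (fun k => ∫ z in D, c.truncationDefect ε h w (T k) (T₂ k) z) atTop
      (𝓝 (∫ z in D, (0 : ℝ))) := by
    refine tendsto_integral_of_dominated_convergence (fun z => |ε| *
      (C * |c.weight ε z * inner ℝ (c.diffFlux h z) (∇ h z)|
        + C * |c.weight ε z * inner ℝ (c.adjoint.diffFlux w z) (∇ w z)|))
      (fun k => (hc.integrableOn_truncationDefect hD hh hw (hT k)).aestronglyMeasurable)
      ?_ (fun k => ae_of_all _ fun z => abs_truncationDefect_le (hT k) h w z)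
      (ae_of_all _ fun z => ?_)
    · exact (((hc.integrableOn_weight_mul_inner_diffFlux hD hh).abs.const_mul C).add
        ((hc.adjoint.integrableOn_weight_mul_inner_diffFlux hD hw).abs.const_mul C)).const_mul |ε|
    · refine tendsto_const_nhds.congr' ?_
      filter_upwards [hlarge |h z|, hlarge |w z|] with k hk1 hk2
      rw [truncationDefect, (hT k).deriv_two_eq_zero _ hk1, (hT k).deriv_two_eq_zero _ hk2]
      simp only [zero_mul, sub_zero, mul_zero]
  rw [integral_zero] at h1
  -- On the compact boundary both functions are bounded, so for large k the truncated boundary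
  -- integrand is the untruncated one.
  obtain ⟨R, hR⟩ := hF.exists_bound_of_continuousOn (hhc.mono frontier_subset_closure)
  obtain ⟨S, hS⟩ := hF.exists_bound_of_continuousOn (hwc.mono frontier_subset_closure)
  refine tendsto_nhds_unique (tendsto_const_nhds.congr' ?_) h1
  filter_upwards [hlarge R, hlarge S] with k hk1 hk2
  rw [hc.setIntegral_truncationDefect hD hF hbd hh hw hhc hwc hhn hwn (hT k)]
  refine setIntegral_congr_fun isClosed_frontier.measurableSet fun z hz => ?_
  have l1 : |h z| < (k : ℝ) + 1 := (hR z hz).trans_lt hk1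
  have l2 : |w z| < (k : ℝ) + 1 := (hS z hz).trans_lt hk2
  simp only [fluxTrace]
  rw [(hT k).eq_self _ l1, (hT k).eq_self _ l2, (hT k).deriv_eq_one _ l1,
    (hT k).deriv_eq_one _ l2, one_mul, mul_one]

end Regular

end Coefficients

/-! ### Boundary conditions and the equality of the capacities. -/

variable {κ : ℕ} {n : Fin (κ + 1) → ℕ}

open scoped Manifold in
/-- A smooth function with compact support that separates the two sets. -/
theorem AdmissiblePair.exists_separating {A B : Set (Space n)} (hAB : AdmissiblePair A B) :
    ∃ φ : Space n → ℝ, ContDiff ℝ 1 φ ∧ HasCompactSupport φ ∧ (∀ z ∈ closure A, φ z = 1) ∧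
      (∀ z ∈ closure B, φ z = 0) ∧ ∀ z ∈ closure (A ∪ B), ∇ φ z = 0 := by
  obtain ⟨R, hR⟩ := hAB.bounded_left.closure.exists_norm_le
  have hcl : IsClosed (closure B ∪ (Metric.ball (0 : Space n) (R + 1))ᶜ) :=
    isClosed_closure.union Metric.isOpen_ball.isClosed_compl
  have hd : Disjoint (closure B ∪ (Metric.ball (0 : Space n) (R + 1))ᶜ) (closure A) := by
    refine Disjoint.union_left hAB.disjoint_closure.symm ?_
    rw [Set.disjoint_left]
    intro z hz hzA
    exact hz (mem_ball_zero_iff.2 (by linarith [hR z hzA]))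
  obtain ⟨φ, h0, h1, -⟩ := exists_contMDiffMap_zero_one_nhds_of_isClosed (n := 1)
    𝓘(ℝ, Space n) hcl isClosed_closure hd
  have hconst : ∀ (e : ℝ) z, (∀ᶠ y in 𝓝 z, φ y = e) → ∇ φ z = 0 := by
    intro e z he
    have h2 : HasGradientAt φ 0 z := by
      rw [hasGradientAt_iff_hasFDerivAt, map_zero]
      exact (hasFDerivAt_const e z).congr_of_eventuallyEq he
    exact h2.gradient
  rw [eventually_nhdsSet_iff_forall] at h0 h1
  refine ⟨φ, φ.contMDiff.contDiff, ?_, fun z hz => (h1 z hz).self_of_nhds,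
    fun z hz => (h0 z (Or.inl hz)).self_of_nhds, fun z hz => ?_⟩
  · refine HasCompactSupport.of_support_subset_isCompact (isCompact_closedBall (0 : Space n) (R + 1))
      fun z hz => ?_
    by_contra h
    exact hz (h0 z (Or.inr fun hb => h (Metric.ball_subset_closedBall hb))).self_of_nhds
  · rw [closure_union] at hz
    rcases hz with hz | hz
    · exact hconst 1 z (h1 z hz)
    · exact hconst 0 z (h0 z (Or.inl hz))

namespace Coefficients

variable {c : Coefficients κ n} {ε : ℝ}

theorem conormalDeriv_eq_zero {D : Set (Space n)} {z : Space n} (u : Space n → ℝ)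
    (h : hat (outwardNormal D z) = 0) : c.conormalDeriv D u z = 0 := by
  have : c.conormalQuotient D u z = fun _ => 0 := by
    funext δ
    rw [conormalQuotient, h, inner_zero_right]
  rw [conormalDeriv, this]
  exact tendsto_const_nhds.limUnder_eq

theorem inner_drift_of_hat_eq_zero {ν : Space n} (h : hat ν = 0) (z : Space n) :
    inner ℝ (c.drift z) ν = inner ℝ (c.Bmul z) ν := by
  rw [drift, inner_add_left, inner_b, h, inner_zero_right, zero_add]

/-- The boundary conditions on the two regular parts of the boundary cover all terms of Green's
identity. -/
theorem boundary_terms_eq_zero {D : Set (Space n)} {z : Space n} {h w : Space n → ℝ} {e : ℝ}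
    (hz : z ∈ frontier D) (hh : z ∈ c.regularBoundary D → h z = e)
    (hw : z ∈ c.adjoint.regularBoundary D → w z = e) :
    (w z - e) * c.conormalDeriv D h z = 0 ∧ (h z - e) * c.adjoint.conormalDeriv D w z = 0 ∧
      (h z - e) * (w z - e) * inner ℝ (c.drift z) (outwardNormal D z) = 0 := by
  by_cases hν : hat (outwardNormal D z) = 0
  · rw [conormalDeriv_eq_zero h hν, conormalDeriv_eq_zero w hν, inner_drift_of_hat_eq_zero hν]
    refine ⟨mul_zero _, mul_zero _, ?_⟩
    -- At a characteristic point the sign of Bz·n selects the regular part that contains it: the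
    -- adjoint one if negative, the direct one if positive.
    rcases lt_trichotomy (inner ℝ (c.Bmul z) (outwardNormal D z)) 0 with h0 | h0 | h0
    · rw [hw ⟨hz, Or.inr (by rw [adjoint_Bmul, inner_neg_left]; linarith)⟩, sub_self, mul_zero,
        zero_mul]
    · rw [h0, mul_zero]
    · rw [hh ⟨hz, Or.inr h0⟩, sub_self, zero_mul, zero_mul]
  · rw [hh ⟨hz, Or.inl hν⟩, hw ⟨hz, Or.inl hν⟩, sub_self]
    simp only [zero_mul, and_self]

namespace Regular

/-- Up to the constant factor `Z`, the density is the normal trace of a flux with a = ε and g = h −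
1, and such traces are bounded and measurable. -/
theorem integrableOn_capIntegrand (hc : c.Regular ε) {A B : Set (Space n)}
    (hAB : AdmissiblePair A B) {h : Space n → ℝ} (hh : c.IsEquilibriumPotential ε A B h) :
    IntegrableOn (c.capIntegrand ε A B h) (frontier A) (surfaceMeasure n) := by
  have hD := isOpen_outerDomain A B
  have hF := hAB.isCompact_frontier
  have hAF : frontier A ⊆ frontier (outerDomain A B) := by
    rw [hAB.frontier_outerDomain]; exact subset_union_left
  obtain ⟨R, hR⟩ := hF.exists_bound_of_continuousOn (hh.continuousOn.mono frontier_subset_closure)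
  obtain ⟨C, hC⟩ := exists_isTruncation
  -- A globally bounded g is required, while h is known to be bounded only on the boundary; this
  -- height leaves the boundary values unchanged.
  obtain ⟨T, T₁, T₂, hT⟩ := hC (|R| + 1) (by positivity)
  obtain ⟨K, hK⟩ := hT.bounded
  have hK0 : 0 ≤ K := (abs_nonneg _).trans (hK 0)
  have ht := hc.hasNormalTrace_flux hD hF hAB.hasC2BoundaryAt hh.weakSolution hh.conormal
    (a := fun _ => ε) (g := fun z => T (h z) - 1) (K := |ε| + K + 1) continuousOn_const
    ((hT.contDiff.continuous.comp_continuousOn hh.continuousOn).sub continuousOn_const)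
    (fun z => by linarith)
    (fun z => by
      have := abs_sub (T (h z)) 1
      rw [abs_one] at this
      linarith [hK (h z), abs_nonneg ε])
  have hi := (integrableOn_trace hD hF hAB.hasC2BoundaryAt ht).mono_set hAF
  rw [← surfaceMeasure_eq] at hi
  have hm : MeasurableSet (frontier A) := isClosed_frontier.measurableSet
  refine (hi.const_mul (c.Z ε)).congr ((ae_restrict_iff' hm).2 (ae_of_all _ fun z hz => ?_))
  have hZ := hc.Z_pos.ne'
  have hTz : T (h z) = h z := hT.eq_self _ (by
    have h1 : |h z| ≤ R := hR z (hAF hz)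
    linarith [le_abs_self R])
  simp only [fluxTrace, capIntegrand, weight, hTz]
  field_simp

/-- The flux of the drift through the boundary of one of the two sets vanishes. -/
theorem integral_drift_frontier_eq_zero (hc : c.Regular ε) {A B : Set (Space n)}
    (hAB : AdmissiblePair A B) {h : Space n → ℝ} (hh : c.IsEquilibriumPotential ε A B h) :
    IntegrableOn (fun z => c.weight ε z
      * inner ℝ (c.drift z) (outwardNormal (outerDomain A B) z)) (frontier A) (surfaceMeasure n) ∧
    ∫ z in frontier A, c.weight ε z * inner ℝ (c.drift z) (outwardNormal (outerDomain A B) z)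
      ∂(surfaceMeasure n) = 0 := by
  have hD := isOpen_outerDomain A B
  have hF := hAB.isCompact_frontier
  have hAF : frontier A ⊆ frontier (outerDomain A B) := by
    rw [hAB.frontier_outerDomain]; exact subset_union_left
  have hflux : c.flux ε h (fun _ => 0) (fun _ => 1) = fun z => c.weight ε z • c.drift z := by
    funext z
    rw [flux, zero_smul, zero_add, one_smul]
  have htrace : c.fluxTrace ε (outerDomain A B) h (fun _ => 0) (fun _ => 1) = fun z =>
      c.weight ε z * inner ℝ (c.drift z) (outwardNormal (outerDomain A B) z) := by
    funext z
    rw [fluxTrace, zero_mul, zero_add, one_mul]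
  have ht := hc.hasNormalTrace_flux hD hF hAB.hasC2BoundaryAt hh.weakSolution hh.conormal
    (a := fun _ => 0) (g := fun _ => 1) (K := 1) continuousOn_const continuousOn_const
    (fun z => by simp) (fun z => by simp)
  rw [hflux, htrace] at ht
  refine ⟨?_, ?_⟩
  · have hi := (integrableOn_trace hD hF hAB.hasC2BoundaryAt ht).mono_set hAF
    rwa [← surfaceMeasure_eq] at hi
  -- As ∇φ vanishes on the complement of Ω, the volume term over Ω equals the one over the whole
  -- space, which is zero; the boundary term sees only ∂A.
  obtain ⟨φ, hφ, hφc, hφA, hφB, hφg⟩ := hAB.exists_separating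
  have hdiv : HasWeakDiv (outerDomain A B) (fun z => c.weight ε z • c.drift z) fun _ => 0 := by
    intro ψ hψ hψc hs
    simp only [real_inner_smul_left, zero_mul, add_zero]
    exact hc.integral_weight_drift_eq_zero hψ hψc hs
  have hg := green_formula hD hF hAB.hasC2BoundaryAt ht integrableOn_zero hdiv hφ hφc
  simp only [real_inner_smul_left, zero_mul, add_zero] at hg
  have h0 := hc.integral_weight_drift_eq_zero hφ hφc (subset_univ _)
  rw [setIntegral_univ] at h0
  rw [setIntegral_eq_integral_of_forall_compl_eq_zero, h0, ← surfaceMeasure_eq] at hg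
  · rw [setIntegral_eq_of_subset_of_forall_sdiff_eq_zero isClosed_frontier.measurableSet hAF
      fun z hz => ?_] at hg
    · refine Eq.trans ?_ hg.symm
      refine setIntegral_congr_fun isClosed_frontier.measurableSet fun z hz => ?_
      rw [hφA z (frontier_subset_closure hz), one_mul]
    · have hzB : z ∈ frontier B := by
        have h1 := hz.1
        rw [hAB.frontier_outerDomain] at h1
        exact h1.resolve_left hz.2
      rw [hφB z (frontier_subset_closure hzB), zero_mul]
  · intro z hz
    rw [hφg z (not_not.1 hz), inner_zero_right, mul_zero]

theorem cap_eq_cap_adjoint (hc : c.Regular ε) {A B : Set (Space n)}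
    (hAB : AdmissiblePair A B) {h w : Space n → ℝ} (hh : c.IsEquilibriumPotential ε A B h)
    (hw : c.adjoint.IsEquilibriumPotential ε A B w) :
    c.cap ε A B h = c.adjoint.cap ε A B w := by
  have hD := isOpen_outerDomain A B
  have hAF : frontier A ⊆ frontier (outerDomain A B) := by
    rw [hAB.frontier_outerDomain]; exact subset_union_left
  have hBF : frontier B ⊆ frontier (outerDomain A B) := by
    rw [hAB.frontier_outerDomain]; exact subset_union_right
  have hgreen := hc.integral_frontier_eq_zero hD hAB.isCompact_frontier hAB.hasC2BoundaryAt
    hh.weakSolution hw.weakSolution hh.continuousOn hw.continuousOn hh.conormal hw.conormal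
  have hadj : ∀ z, c.adjoint.weight ε z = c.weight ε z := fun _ => rfl
  have hmA : MeasurableSet (frontier A) := isClosed_frontier.measurableSet
  -- With boundary value 0 on ∂B, each term of the flux density vanishes there.
  rw [setIntegral_eq_of_subset_of_forall_sdiff_eq_zero isClosed_frontier.measurableSet hAF
    fun z hz => ?_] at hgreen
  · obtain ⟨hvi, hv⟩ := hc.integral_drift_frontier_eq_zero hAB hh
    have i1 := (hc.integrableOn_capIntegrand hAB hh).const_mul (1 / c.Z ε)
    have i2 := (hc.adjoint.integrableOn_capIntegrand hAB hw).const_mul (1 / c.Z ε)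
    have hsum : ∫ z in frontier A, (c.fluxTrace ε (outerDomain A B) h (fun z => ε * w z)
          (fun z => h z * w z) z
        + c.adjoint.fluxTrace ε (outerDomain A B) w (fun z => -(ε * h z)) (fun _ => 0) z)
          ∂(surfaceMeasure n)
        = ∫ z in frontier A, ((1 / c.Z ε * c.capIntegrand ε A B h z
          - 1 / c.Z ε * c.adjoint.capIntegrand ε A B w z)
          + c.weight ε z * inner ℝ (c.drift z) (outwardNormal (outerDomain A B) z))
            ∂(surfaceMeasure n) := by
      refine setIntegral_congr_fun hmA fun z hz => ?_
      obtain ⟨e1, e2, e3⟩ := boundary_terms_eq_zero (c := c) (h := h) (w := w) (hAF hz)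
        (fun hr => hh.eq_one z ⟨hr, hz⟩) (fun hr => hw.eq_one z ⟨hr, hz⟩)
      have hexp : Real.exp (-(c.W z) / ε) = c.Z ε * c.weight ε z := by
        rw [weight, mul_div_cancel₀ _ hc.Z_pos.ne']
      have hexp' : Real.exp (-(c.adjoint.W z) / ε) = c.Z ε * c.weight ε z := hexp
      have hZ := hc.Z_pos.ne'
      simp only [fluxTrace, capIntegrand, hadj, adjoint_drift, inner_neg_left]
      rw [hexp, hexp']
      field_simp
      -- With boundary value 1 on ∂A: hw = (h−1) − (1−w) + 1 + (h−1)(w−1), where `e3` removes the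
      -- last product and `e1`, `e2` replace w and h by 1 in front of the conormal derivatives.
      linear_combination c.weight ε z * (ε * e1 - ε * e2 + e3)
    have hadd := integral_add (i1.sub i2) hvi
    simp only [Pi.sub_apply] at hadd
    rw [hsum, hadd, hv, add_zero, integral_sub i1 i2,
      integral_const_mul, integral_const_mul] at hgreen
    exact sub_eq_zero.1 hgreen
  · have hzB : z ∈ frontier B := by
      have h1 := hz.1
      rw [hAB.frontier_outerDomain] at h1
      exact h1.resolve_left hz.2
    obtain ⟨e1, e2, e3⟩ := boundary_terms_eq_zero (c := c) (h := h) (w := w) (hBF hzB)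
      (fun hr => hh.eq_zero z ⟨hr, hzB⟩) (fun hr => hw.eq_zero z ⟨hr, hzB⟩)
    simp only [fluxTrace, hadj, sub_zero] at e1 e2 e3 ⊢
    linear_combination c.weight ε z * (ε * e1 - ε * e2 + e3)

end Regular

end Coefficients

end FokkerPlanck

end

theorem mainTheorem2 {κ : ℕ} {n : Fin (κ + 1) → ℕ} (c : FokkerPlanck.Coefficients κ n)
    (hc : c.Admissible) (ε : ℝ) (hε : 0 < ε) (hdiv : c.WeightedDivFree ε)
    (hb : MemLp c.b 2 (c.rho ε))
    (A B : Set (FokkerPlanck.Space n)) (hAB : FokkerPlanck.AdmissiblePair A B)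
    (h hadj : FokkerPlanck.Space n → ℝ)
    (hh : c.IsEquilibriumPotential ε A B h)
    (hhadj : c.adjoint.IsEquilibriumPotential ε A B hadj) :
    IntegrableOn (c.capIntegrand ε A B h) (frontier A) (FokkerPlanck.surfaceMeasure n) ∧
    IntegrableOn (c.adjoint.capIntegrand ε A B hadj) (frontier A)
      (FokkerPlanck.surfaceMeasure n) ∧
    c.cap ε A B h = c.adjoint.cap ε A B hadj := by
  have hreg := hc.regular hε hdiv hb
  exact ⟨hreg.integrableOn_capIntegrand hAB hh, hreg.adjoint.integrableOn_capIntegrand hAB hhadj,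
    hreg.cap_eq_cap_adjoint hAB hh hhadj⟩
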